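/- Let $B>0$ and $R>0$ be fixed. For $h>0$ and $m\in\mathbb Z$ let $\mathcal P_m(h)$ denote the self-adjoint Dirichlet realization, in the Hilbert space $L^2((0,R),r\,dr)$, of $$\mathcal P_m(h)=h^2\Bigl[-\frac{d^2}{dr^2}-\frac1r\frac{d}{dr}+\Bigl(\frac mr-\frac{Br}{2h}\Bigr)^2\Bigr]-hB ,$$ that is, the operator associated with the quadratic form $$u\mapsto h^2\int_0^R\Bigl(|u'(r)|^2+\Bigl|\Bigl(\frac mr-\frac{Br}{2h}\Bigr)u(r)\Bigr|^2\Bigr)\,r\,dr-hB\int_0^R|u(r)|^2\,r\,dr$$ whose domain consists of all $u\in L^2((0,R),r\,dr)$ that are locally absolutely continuous on $(0,R]$, satisfy $u(R)=0$, and have $u'$ and $(\frac mr-\frac{Br}{2h})u$ in $L^2((0,R),r\,dr)$. (These operators are the angular momentum components of the Dirichlet Pauli operator $P_-=(hD_{x_1}-A_1)^2+(hD_{x_2}-A_2)^2-hB$ with constant magnetic field $B$ in the disk of radius $R$.) Then, for all $m\in\mathbb Z$ and $h>0$, all the eigenvalues of $\mathcal P_m(h)$, repeated according to multiplicity, form an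 increasing sequence of real numbers $\lambda_{m,0}(h)\le\lambda_{m,1}(h)\le\lambda_{m,2}(h)\le\cdots$, and the following hold. (a) If $m<0$, then $\lambda_{m,0}(h)\ge(2|m|-1)hB$ for all $h>0$. (b) If $m\ge0$, then $\lambda_{m,k}(h)\ge 2hBk$ for all integers $k\ge 0$ and all $h>0$. In particular, $\lambda_{m,1}(h)\ge 2hB$. (c) If $m\ge0$ then, as $h\to0^+$, $$\lambda_{m,0}(h)=2hB\,\frac{(BR^2/2h)^{m+1}}{m!}\,e^{-BR^2/2h}\,\bigl(1+O(h)\bigr),$$ where the constant in $O(h)$ may depend on $m$, $B$ and $R$. -/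

import Mathlib

open MeasureTheory Set Filter Topology Asymptotics
open scoped InnerProductSpace ContDiff

namespace RadialPauli

/-- The measure `r dr` on the interval `(0, R)`. -/
noncomputable def radialMeasure (R : ℝ) : Measure ℝ :=
  (volume.restrict (Ioo 0 R)).withDensity (fun r => ENNReal.ofReal r)

/-- The complex Hilbert space `L²((0, R), r dr)`. -/
abbrev RadialL2 (R : ℝ) : Type := Lp ℂ 2 (radialMeasure R)

instance instIsFiniteMeasureRadialMeasure (R : ℝ) : IsFiniteMeasure (radialMeasure R) := by
  refine isFiniteMeasure_withDensity_ofReal (Integrable.hasFiniteIntegral ?_)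
  exact (continuous_id.integrableOn_Icc (a := 0) (b := R)).mono_set Ioo_subset_Icc_self

theorem ae_radialMeasure_iff (R : ℝ) (p : ℝ → Prop) :
    (∀ᵐ r ∂radialMeasure R, p r) ↔ ∀ᵐ r, r ∈ Ioo 0 R → p r := by
  rw [radialMeasure, ae_withDensity_iff (by fun_prop), ae_restrict_iff' measurableSet_Ioo]
  refine eventually_congr (Eventually.of_forall fun r => ?_)
  refine ⟨fun h hr => h hr (by simpa using hr.1), fun h hr _ => h hr⟩

theorem integrableOn_smul_of_integrable (R : ℝ) (f : ℝ → ℂ) (hf : Integrable f (radialMeasure R)) :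
    IntegrableOn (fun r : ℝ => r • f r) (Ioo 0 R) := by
  rw [radialMeasure, integrable_withDensity_iff_integrable_smul' (by fun_prop)
    (Eventually.of_forall fun r => ENNReal.ofReal_lt_top)] at hf
  refine hf.congr ?_
  filter_upwards [ae_restrict_mem measurableSet_Ioo] with r hr
  rw [ENNReal.toReal_ofReal hr.1.le]

theorem integral_radialMeasure (R : ℝ) (f : ℝ → ℂ) :
    ∫ r, f r ∂radialMeasure R = ∫ r in Ioo 0 R, (r : ℂ) * f r := by
  rw [radialMeasure, integral_withDensity_eq_integral_toReal_smul (by fun_prop)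
    (Eventually.of_forall fun r => ENNReal.ofReal_lt_top)]
  refine setIntegral_congr_fun measurableSet_Ioo fun r hr => ?_
  simp only [ENNReal.toReal_ofReal hr.1.le, Complex.real_smul]

theorem integrableOn_smul (R : ℝ) (f : RadialL2 R) :
    IntegrableOn (fun r : ℝ => r • f r) (Ioo 0 R) :=
  integrableOn_smul_of_integrable R f ((Lp.memLp f).integrable (by norm_num))

theorem intervalIntegrable (R : ℝ) (f : RadialL2 R) {r : ℝ} (hr : r ∈ Ioo 0 R) :
    IntervalIntegrable f volume r R := by
  rw [intervalIntegrable_iff_integrableOn_Ioo_of_le hr.2.le]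
  have h1 : IntegrableOn (fun s : ℝ => s • f s) (Ioo r R) :=
    (integrableOn_smul R f).mono_set (Ioo_subset_Ioo_left hr.1.le)
  have h2 : IntegrableOn (fun s : ℝ => s⁻¹ • (s • f s)) (Ioo r R) := by
    refine Integrable.bdd_smul (C := r⁻¹) (φ := fun s : ℝ => s⁻¹) h1 ?_ ?_
    · exact measurable_inv.aestronglyMeasurable
    · filter_upwards [ae_restrict_mem measurableSet_Ioo] with s hs
      have h3 : 0 < s := hr.1.trans hs.1
      rw [Real.norm_of_nonneg (inv_nonneg.2 h3.le)]
      exact inv_anti₀ hr.1 hs.1.le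
  refine h2.congr ?_
  filter_upwards [ae_restrict_mem measurableSet_Ioo] with s hs
  have h3 : s ≠ 0 := (hr.1.trans hs.1).ne'
  simp [h3]

/-- The form domain of the radial operator of angular momentum `m`, together with the two
components of the magnetic gradient: an element `u` of `L²((0, R), r dr)` is in the form domain iff
there are `g`, `w` in `L²((0, R), r dr)` with
* `u(r) = - ∫ s in r..R, g s` for almost every `r ∈ (0, R)`, i.e. `u` is locally absolutely
  continuous on `(0, R]`, `u' = g`, and `u(R) = 0` (Dirichlet condition);
* `w(r) = (m / r - B r / (2 h)) u(r)` for almost every `r ∈ (0, R)`.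
Equivalently, `u(r) exp(i m θ)` belongs to `H¹₀` of the disk of radius `R`. -/
structure IsMagneticGradient (B R h : ℝ) (m : ℤ) (u g w : RadialL2 R) : Prop where
  radial : ∀ᵐ r ∂radialMeasure R, u r = -∫ s in r..R, g s
  angular : ∀ᵐ r ∂radialMeasure R, w r = (((m : ℝ) / r - B * r / (2 * h) : ℝ) : ℂ) * u r

theorem intervalIntegral_congr_radial {R : ℝ} {f g : ℝ → ℂ} (hfg : f =ᵐ[radialMeasure R] g)
    {r : ℝ} (hr : r ∈ Ioo 0 R) : ∫ s in r..R, f s = ∫ s in r..R, g s := by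
  have h5 : ∀ᵐ r ∂radialMeasure R, f r = g r := hfg
  rw [ae_radialMeasure_iff] at h5
  rw [intervalIntegral.integral_of_le hr.2.le, intervalIntegral.integral_of_le hr.2.le,
    integral_Ioc_eq_integral_Ioo, integral_Ioc_eq_integral_Ioo]
  refine setIntegral_congr_ae measurableSet_Ioo ?_
  filter_upwards [h5] with s hs hs'
  exact hs ⟨hr.1.trans hs'.1, hs'.2⟩

theorem ae_mem_radialMeasure (R : ℝ) : ∀ᵐ r ∂radialMeasure R, r ∈ Ioo 0 R :=
  (ae_radialMeasure_iff R _).2 (Eventually.of_forall fun _ hr => hr)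

theorem IsMagneticGradient.zero (B R h : ℝ) (m : ℤ) : IsMagneticGradient B R h m 0 0 0 := by
  have h0 : (0 : RadialL2 R) =ᵐ[radialMeasure R] fun _ => (0 : ℂ) := Lp.coeFn_zero _ _ _
  refine ⟨?_, ?_⟩
  · filter_upwards [h0, ae_mem_radialMeasure R] with r hr hr'
    rw [hr, intervalIntegral_congr_radial h0 hr']
    simp
  · filter_upwards [h0] with r hr
    rw [hr, mul_zero]

theorem IsMagneticGradient.add {B R h : ℝ} {m : ℤ} {u g w v k z : RadialL2 R}
    (h1 : IsMagneticGradient B R h m u g w) (h2 : IsMagneticGradient B R h m v k z) :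
    IsMagneticGradient B R h m (u + v) (g + k) (w + z) := by
  refine ⟨?_, ?_⟩
  · filter_upwards [h1.radial, h2.radial, Lp.coeFn_add u v, ae_mem_radialMeasure R]
      with r a1 a3 a6 hr
    rw [intervalIntegral_congr_radial (Lp.coeFn_add g k) hr, a6, Pi.add_apply, a1, a3]
    simp only [Pi.add_apply]
    rw [intervalIntegral.integral_add (intervalIntegrable R g hr) (intervalIntegrable R k hr)]
    ring
  · filter_upwards [h1.angular, h2.angular, Lp.coeFn_add w z, Lp.coeFn_add u v] with r a2 a4 a5 a6
    rw [a5, a6, Pi.add_apply, Pi.add_apply, a2, a4]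
    ring

theorem IsMagneticGradient.smul {B R h : ℝ} {m : ℤ} {u g w : RadialL2 R} (c : ℂ)
    (h1 : IsMagneticGradient B R h m u g w) :
    IsMagneticGradient B R h m (c • u) (c • g) (c • w) := by
  refine ⟨?_, ?_⟩
  · filter_upwards [h1.radial, Lp.coeFn_smul c u, ae_mem_radialMeasure R] with r a1 a6 hr
    rw [intervalIntegral_congr_radial (Lp.coeFn_smul c g) hr, a6, Pi.smul_apply, a1]
    simp only [Pi.smul_apply]
    rw [intervalIntegral.integral_smul, smul_neg]
  · filter_upwards [h1.angular, Lp.coeFn_smul c w, Lp.coeFn_smul c u] with r a2 a5 a6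
    rw [a5, a6, Pi.smul_apply, Pi.smul_apply, a2, smul_eq_mul, smul_eq_mul]
    ring

/-- The graph of the Dirichlet realization in `L²((0, R), r dr)` of the differential expression
`h² (- d²/dr² - (1/r) d/dr + (m/r - B r/(2h))²) - h B`, through its quadratic form: `(u, f)` is in
the graph iff `u` is in the form domain and, for every `v` in the form domain,
`h² ∫ (conj v' u' + (m/r - B r/(2h))² conj v u) r dr - h B ∫ conj v u r dr = ∫ conj v f r dr`. -/
noncomputable def pauliGraph (B R h : ℝ) (m : ℤ) : Submodule ℂ (RadialL2 R × RadialL2 R) where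
  carrier := {q | ∃ g w : RadialL2 R, IsMagneticGradient B R h m q.1 g w ∧
    ∀ v k z : RadialL2 R, IsMagneticGradient B R h m v k z →
      (h : ℂ) ^ 2 * (⟪k, g⟫_ℂ + ⟪z, w⟫_ℂ) - (h : ℂ) * (B : ℂ) * ⟪v, q.1⟫_ℂ = ⟪v, q.2⟫_ℂ}
  zero_mem' := by
    refine ⟨0, 0, IsMagneticGradient.zero B R h m, fun v k z _ => ?_⟩
    rw [Prod.fst_zero, Prod.snd_zero, inner_zero_right, inner_zero_right, inner_zero_right]
    ring
  add_mem' := by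
    rintro ⟨u, f⟩ ⟨u', f'⟩ ⟨g, w, h1, h2⟩ ⟨g', w', h3, h4⟩
    refine ⟨g + g', w + w', h1.add h3, fun v k z hv => ?_⟩
    have a := h2 v k z hv
    have b := h4 v k z hv
    rw [Prod.mk_add_mk, inner_add_right, inner_add_right, inner_add_right, inner_add_right, ← a, ← b]
    ring
  smul_mem' := by
    rintro c ⟨u, f⟩ ⟨g, w, h1, h2⟩
    refine ⟨c • g, c • w, h1.smul c, fun v k z hv => ?_⟩
    have a := h2 v k z hv
    rw [Prod.smul_mk, inner_smul_right, inner_smul_right, inner_smul_right, inner_smul_right, ← a]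
    ring

/-- The operator `𝒫_m(h)` in `L²((0, R), r dr)` with Dirichlet condition at `r = R`, as an
unbounded operator; see `graph_pauliOperator` for its graph. -/
noncomputable def pauliOperator (B R h : ℝ) (m : ℤ) : RadialL2 R →ₗ.[ℂ] RadialL2 R :=
  (pauliGraph B R h m).toLinearPMap

/-- The eigenspace of an unbounded operator `T` for `z`: all `u` in the domain with `T u = z u`. -/
def eigenspace {H : Type*} [AddCommGroup H] [Module ℂ H] (T : H →ₗ.[ℂ] H) (z : ℂ) :
    Submodule ℂ H :=
  T.graph.comap (LinearMap.prod LinearMap.id (z • LinearMap.id))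

/-- `lam 0 ≤ lam 1 ≤ …` is the increasing sequence of all the eigenvalues of `T`, each one
repeated according to its multiplicity (in particular all eigenvalues are real). -/
structure IsEigenvalueSequence {H : Type*} [AddCommGroup H] [Module ℂ H] (T : H →ₗ.[ℂ] H)
    (lam : ℕ → ℝ) : Prop where
  monotone : Monotone lam
  encard_eq : ∀ z : ℂ,
    {k : ℕ | (lam k : ℂ) = z}.encard = Cardinal.toENat (Module.rank ℂ (eigenspace T z))

/-! The relation `pauliGraph` is the graph of an operator. -/

theorem deriv_unique (B R h : ℝ) (m : ℤ) (g w : RadialL2 R)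
    (hgw : IsMagneticGradient B R h m 0 g w) : g = 0 ∧ w = 0 := by
  obtain ⟨h1, h2⟩ := hgw
  have h0 : ∀ᵐ r ∂radialMeasure R, (0 : RadialL2 R) r = 0 := Lp.coeFn_zero _ _ _
  have hw : w = 0 := by
    rw [Lp.eq_zero_iff_ae_eq_zero]
    filter_upwards [h2, h0] with r a b
    rw [a, b, mul_zero, Pi.zero_apply]
  refine ⟨?_, hw⟩
  have h3 : ∀ᵐ r ∂radialMeasure R, ∫ s in r..R, g s = 0 := by
    filter_upwards [h1, h0] with r a b
    rw [b] at a
    exact neg_eq_zero.1 a.symm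
  rw [ae_radialMeasure_iff] at h3
  have hcont : ∀ a ∈ Ioo 0 R, ContinuousOn (fun r => ∫ s in r..R, g s) (Ioo a R) := by
    intro a ha
    have := intervalIntegral.continuousOn_primitive_interval_left
      (μ := volume) (f := g) (a := a) (b := R)
      (by
        have := intervalIntegrable R g ha
        rwa [intervalIntegrable_iff', ] at this)
    exact this.mono (by rw [uIcc_of_le ha.2.le]; exact Ioo_subset_Icc_self)
  have hzero : ∀ r ∈ Ioo 0 R, ∫ s in r..R, g s = 0 := by
    intro r hr
    have ha : r / 2 ∈ Ioo 0 R := ⟨by linarith [hr.1], by linarith [hr.1, hr.2]⟩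
    have hEq : EqOn (fun r => ∫ s in r..R, g s) (fun _ => (0 : ℂ)) (Ioo (r / 2) R) := by
      refine Measure.eqOn_open_of_ae_eq (μ := volume) ?_ isOpen_Ioo (hcont _ ha) continuousOn_const
      refine (ae_restrict_iff' measurableSet_Ioo).2 ?_
      filter_upwards [h3] with s hs hs'
      exact hs ⟨ha.1.trans hs'.1, hs'.2⟩
    exact hEq ⟨by linarith [hr.1], hr.2⟩
  have hder : ∀ n : ℕ, ∀ᵐ r, r ∈ Ioo (1 / ((n : ℝ) + 1)) R → g r = 0 := by
    intro n
    have hn : 0 < 1 / ((n : ℝ) + 1) := by positivity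
    by_cases hnR : 1 / ((n : ℝ) + 1) < R
    · have hI := intervalIntegrable R g ⟨hn, hnR⟩
      filter_upwards [hI.ae_hasDerivAt_integral] with r hr hr'
      have hd := hr (by rw [uIcc_of_le hnR.le]; exact Ioo_subset_Icc_self hr') R right_mem_uIcc
      refine hd.unique ((hasDerivAt_const r (0 : ℂ)).congr_of_eventuallyEq ?_)
      filter_upwards [Ioo_mem_nhds hr'.1 hr'.2] with s hs
      rw [intervalIntegral.integral_symm, hzero s ⟨hn.trans hs.1, hs.2⟩, neg_zero]
    · refine Eventually.of_forall fun r hr => absurd (hr.1.trans hr.2) hnR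
  rw [Lp.eq_zero_iff_ae_eq_zero]
  refine (ae_radialMeasure_iff R _).2 ?_
  filter_upwards [ae_all_iff.2 hder] with r hr hr'
  obtain ⟨n, hn⟩ := exists_nat_one_div_lt hr'.1
  exact hr n ⟨hn, hr'.2⟩

theorem exists_radialL2 (R : ℝ) (f : ℝ → ℂ) (hf : Continuous f) (hf' : HasCompactSupport f) :
    ∃ v : RadialL2 R, v =ᵐ[radialMeasure R] f :=
  ⟨(hf.memLp_of_hasCompactSupport hf').toLp f, MemLp.coeFn_toLp _⟩

theorem continuous_angular (B R h : ℝ) (m : ℤ) (phi : ℝ → ℝ) (hphi : Continuous phi)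
    (hc : HasCompactSupport phi) (hs : tsupport phi ⊆ Ioo 0 R) :
    (Continuous fun r => (((m : ℝ) / r - B * r / (2 * h) : ℝ) : ℂ) * (phi r : ℂ)) ∧
      HasCompactSupport fun r => (((m : ℝ) / r - B * r / (2 * h) : ℝ) : ℂ) * (phi r : ℂ) := by
  have hphic : Continuous fun r => (phi r : ℂ) := Complex.continuous_ofReal.comp hphi
  have hcphi : HasCompactSupport fun r => (phi r : ℂ) :=
    hc.comp_left (g := fun x : ℝ => (x : ℂ)) (by simp)
  refine ⟨?_, hcphi.mul_left⟩
  refine continuous_iff_continuousAt.2 fun r => ?_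
  by_cases hr : r ∈ tsupport phi
  · have h0 : r ≠ 0 := (hs hr).1.ne'
    refine ContinuousAt.mul ?_ hphic.continuousAt
    refine Complex.continuous_ofReal.continuousAt.comp ?_
    exact (continuousAt_const.div continuousAt_id h0).sub (by fun_prop)
  · have h0 : phi =ᶠ[𝓝 r] 0 := notMem_tsupport_iff_eventuallyEq.1 hr
    refine (continuousAt_const (y := (0 : ℂ))).congr ?_
    filter_upwards [h0] with s hs
    simp [hs]

theorem exists_isMagneticGradient (B R h : ℝ) (m : ℤ) (phi : ℝ → ℝ) (hphi : ContDiff ℝ ∞ phi)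
    (hc : HasCompactSupport phi) (hs : tsupport phi ⊆ Ioo 0 R) :
    ∃ v k z : RadialL2 R, IsMagneticGradient B R h m v k z ∧
      ∀ᵐ r ∂radialMeasure R, v r = (phi r : ℂ) := by
  have hphic : Continuous fun r => (phi r : ℂ) := Complex.continuous_ofReal.comp hphi.continuous
  have hdc : Continuous (deriv phi) := hphi.continuous_deriv (by simp)
  have hcphi : HasCompactSupport fun r => (phi r : ℂ) :=
    hc.comp_left (g := fun x : ℝ => (x : ℂ)) (by simp)
  have hcd0 : HasCompactSupport (deriv phi) := hc.deriv
  have hcd : HasCompactSupport fun r => ((deriv phi r : ℝ) : ℂ) :=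
    hcd0.comp_left (g := fun x : ℝ => (x : ℂ)) Complex.ofReal_zero
  have hPP := continuous_angular B R h m phi hphi.continuous hc hs
  obtain ⟨v, hv⟩ := exists_radialL2 R _ hphic hcphi
  obtain ⟨k, hk⟩ := exists_radialL2 R (fun r => ((deriv phi r : ℝ) : ℂ))
    (Complex.continuous_ofReal.comp hdc) hcd
  obtain ⟨z, hz⟩ := exists_radialL2 R _ hPP.1 hPP.2
  have hR : phi R = 0 := by
    by_contra hne
    have hmem : R ∈ Ioo 0 R := hs (subset_tsupport phi hne)
    exact lt_irrefl R hmem.2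
  refine ⟨v, k, z, ⟨?_, ?_⟩, hv⟩
  · filter_upwards [hv, ae_mem_radialMeasure R] with r hr hr'
    rw [hr, intervalIntegral_congr_radial hk hr']
    rw [intervalIntegral.integral_ofReal, intervalIntegral.integral_deriv_eq_sub]
    · simp [hR]
    · intro x _
      exact (hphi.differentiable (by simp)).differentiableAt
    · exact hdc.intervalIntegrable _ _
  · filter_upwards [hv, hz] with r a b
    rw [a, b]

theorem eq_zero_of_inner_eq_zero (B R h : ℝ) (m : ℤ) (f : RadialL2 R)
    (hf : ∀ v k z : RadialL2 R, IsMagneticGradient B R h m v k z → ⟪v, f⟫_ℂ = 0) : f = 0 := by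
  have h1 : ∀ᵐ r, r ∈ Ioo 0 R → r • f r = 0 := by
    refine (isOpen_Ioo (a := (0 : ℝ)) (b := R)).ae_eq_zero_of_integral_contDiff_smul_eq_zero
      (integrableOn_smul R f).locallyIntegrableOn ?_
    intro phi hphi hc hs
    obtain ⟨v, k, z, hv, hvphi⟩ := exists_isMagneticGradient B R h m phi hphi hc hs
    have h2 := hf v k z hv
    rw [L2.inner_def] at h2
    have h3 : ∫ r, ⟪v r, f r⟫_ℂ ∂radialMeasure R = ∫ r, (phi r : ℂ) * f r ∂radialMeasure R := by
      refine integral_congr_ae ?_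
      filter_upwards [hvphi] with r hr
      rw [hr]
      simp [mul_comm]
    rw [h3, integral_radialMeasure] at h2
    have h4 : ∫ r in Ioo 0 R, phi r • r • f r = ∫ r, phi r • r • f r := by
      refine setIntegral_eq_integral_of_forall_compl_eq_zero fun r hr => ?_
      have : phi r = 0 := by
        by_contra hne
        exact hr (hs (subset_tsupport phi hne))
      rw [this, zero_smul]
    rw [← h4, ← h2]
    refine setIntegral_congr_fun measurableSet_Ioo fun r _ => ?_
    simp only [Complex.real_smul]
    ring
  rw [Lp.eq_zero_iff_ae_eq_zero]
  refine (ae_radialMeasure_iff R _).2 ?_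
  filter_upwards [h1] with r hr hr'
  have h0 : (0 : ℝ) < r := hr'.1
  exact (smul_eq_zero.1 (hr hr')).resolve_left h0.ne'

theorem graph_pauliOperator (B R h : ℝ) (m : ℤ) :
    (pauliOperator B R h m).graph = pauliGraph B R h m := by
  refine Submodule.toLinearPMap_graph_eq _ ?_
  rintro ⟨u, f⟩ ⟨g, w, h1, h2⟩ hu
  simp only at hu h1 h2 ⊢
  subst hu
  obtain ⟨rfl, rfl⟩ := deriv_unique B R h m g w h1
  refine eq_zero_of_inner_eq_zero B R h m f fun v k z hv => ?_
  rw [← h2 v k z hv]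
  simp

end RadialPauli

namespace RadialPauli

/-! Write `g = u'`, `w = (m/r - Br/(2h)) u` and `b = B/(2h)`. The form norm `‖g‖² + ‖w‖²` makes the
form domain a Hilbert space `V`, and the embedding of `V` into `L²(r dr)` is compact because it
factors through integration from `R`. If `J` is this embedding, `J J†` is the inverse of `h⁻²(𝒫_m +
hB)`, so the spectrum of `𝒫_m` is that of a compact operator with compact inverse image: real,
discrete and infinite (`exists_resolvent`, `exists_isEigenvalueSequence_of_graph`).

For `m < 0` the square `(m/r - br)²` is at least `4|m|b`, which is (a).

Integration by parts gives `2 Re⟪g, w⟫ = (B/h) ‖u‖²`, so the quadratic form equals `h² ‖g - w‖²`.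
The map `u ↦ g - w` is an annihilation operator from angular momentum `m` to `m + 1`; its formal
adjoint sends `v`, with gradient `(k, z)` at `m + 1`, to `-(k + z)`, and `‖k + z‖² = ‖k - z‖² +
2(B/h) ‖v‖²`. For `m ≥ 0`, a form domain element orthogonal to the zero mode `r^m exp(-br²/2)` is a
creation image of a form domain element at `m + 1` (`IsMagneticGradient.exists_creation`). Each rung
thus costs one dimension and gains `2hB` of energy; induction on `k` and min-max give (b)
(`exists_mem_mul_norm_sq_le`).

For (c), put `ρ = bR² = BR²/(2h)`. Dividing `u` by the zero mode turns annihilation into a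
derivative, and Cauchy-Schwarz from the end `R` yields a Hardy inequality. Its constant is a product
of two Laplace-type integrals, one concentrated at `R` and one at `0`, and matches the reciprocal of
the claimed leading term up to `1 + O(1/ρ)` (`exists_groundEnergy_le`). A trial function, the zero
mode minus its reflection at `R`, gives the same leading term from above
(`IsEigenvalueSequence.mul_le_groundEnergy`). Since `1/ρ` is a multiple of `h`, the errors are
`O(h)`. -/

/-! ### Listing a discrete set of reals with multiplicities. -/

/-- In the lexicographic sum of the `Fin (d z)`, each value `z` occurs `d z` times. Initial segments
are finite and there is no maximum, so this order is isomorphic to `ℕ`; the sequence is the first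
coordinate read along the isomorphism. -/
theorem exists_monotone_enumeration (d : ℝ → ℕ) (hfin : ∀ c, {z | z ≤ c ∧ d z ≠ 0}.Finite)
    (hinf : {z | d z ≠ 0}.Infinite) :
    ∃ lam : ℕ → ℝ, Monotone lam ∧ ∀ z, {k | lam k = z}.encard = d z := by
  let S := Σₗ z : ℝ, Fin (d z)
  have hIic : ∀ c : ℝ, {s : S | (ofLex s).1 ≤ c}.Finite := by
    intro c
    have : {s : S | (ofLex s).1 ≤ c} ⊆
        ⋃ z ∈ {z | z ≤ c ∧ d z ≠ 0}, Set.range fun i : Fin (d z) => (toLex ⟨z, i⟩ : S) := by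
      intro s hs
      obtain ⟨⟨z, i⟩, rfl⟩ := toLex.surjective s
      simp only [mem_iUnion]
      exact ⟨z, ⟨hs, fun h0 => (Fin.cast h0 i).elim0⟩, i, rfl⟩
    exact ((hfin c).biUnion fun z _ => Set.finite_range _).subset this
  have hfst : ∀ s t : S, s ≤ t → (ofLex s).1 ≤ (ofLex t).1 := by
    intro s t hst
    rcases (Sigma.Lex.le_def).1 hst with h | ⟨h, _⟩
    · exact h.le
    · exact h.le
  have hfinIic : ∀ t : S, (Iic t).Finite := fun t => (hIic (ofLex t).1).subset fun s hs => hfst s t hs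
  have hSinf : Infinite S := by
    by_contra hcon
    rw [not_infinite_iff_finite] at hcon
    refine hinf (((Set.finite_univ (α := S)).image fun s => (ofLex s).1).subset ?_)
    intro z hz
    exact ⟨toLex ⟨z, ⟨0, Nat.pos_of_ne_zero hz⟩⟩, mem_univ _, rfl⟩
  have hnomax : NoMaxOrder S := by
    refine ⟨fun a => ?_⟩
    by_contra hcon
    push Not at hcon
    exact Set.infinite_univ ((hfinIic a).subset fun x _ => mem_Iic.2 (not_lt.1 (hcon x)))
  obtain ⟨s0⟩ : Nonempty S := inferInstance
  obtain ⟨b, -, hb⟩ := Set.exists_min_image (Iic s0) id (hfinIic s0) ⟨s0, le_refl s0⟩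
  have hbot : ∀ x, b ≤ x := fun x => by
    rcases le_total x s0 with h | h
    · exact hb x h
    · exact (hb s0 self_mem_Iic).trans h
  let _ : OrderBot S := { bot := b, bot_le := hbot }
  let _ : LocallyFiniteOrder S :=
    LocallyFiniteOrder.ofFiniteIcc fun x y => (hfinIic y).subset fun z hz => hz.2
  let _ := LinearLocallyFiniteOrder.succOrder S
  let _ := LinearLocallyFiniteOrder.predOrder S
  let e : S ≃o ℕ := orderIsoNatOfLinearSuccPredArch
  refine ⟨fun k => (ofLex (e.symm k)).1, fun k l hkl => hfst _ _ (e.symm.monotone hkl), fun z => ?_⟩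
  have himg : {k | (ofLex (e.symm k)).1 = z} =
      (fun i : Fin (d z) => e (toLex ⟨z, i⟩)) '' Set.univ := by
    ext k
    simp only [mem_ofPred_eq, image_univ, mem_range]
    constructor
    · intro hk
      obtain ⟨s, rfl⟩ := e.surjective k
      obtain ⟨⟨y, i⟩, rfl⟩ := toLex.surjective s
      have : y = z := by
        rw [OrderIso.symm_apply_apply] at hk
        exact hk
      subst this
      exact ⟨i, rfl⟩
    · rintro ⟨i, rfl⟩
      simp
  rw [himg, Function.Injective.encard_image]
  · rw [Set.encard_univ]
    simp
  · intro i j hij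
    have := e.injective hij
    have h2 : (⟨z, i⟩ : Σ z : ℝ, Fin (d z)) = ⟨z, j⟩ := toLex.injective this
    simpa using h2

/-! ### Eigenvalues of an operator with compact resolvent. -/

section CompactResolvent

variable {H : Type*} [NormedAddCommGroup H] [InnerProductSpace ℂ H]

/-- Infinitely many such eigenvalues would have orthonormal eigenvectors, whose images under `K` lie
at mutual distance `√(μ_i² + μ_j²) > ε`; no subsequence of the images could converge. -/
theorem finite_setOf_hasEigenvalue_ge [CompleteSpace H] {K : H →L[ℂ] H} (hK : IsCompactOperator K)
    (hsymm : K.IsSymmetric) {ε : ℝ} (hε : 0 < ε) :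
    {μ : ℝ | ε ≤ μ ∧ Module.End.HasEigenvalue (K : Module.End ℂ H) (μ : ℂ)}.Finite := by
  by_contra hinf
  rw [← Set.Infinite] at hinf
  let f := hinf.natEmbedding
  have hf : ∀ n, ε ≤ (f n : ℝ) ∧ Module.End.HasEigenvalue (K : Module.End ℂ H) ((f n : ℝ) : ℂ) :=
    fun n => (f n).2
  have hvec : ∀ n, ∃ e : H, ‖e‖ = 1 ∧ K e = ((f n : ℝ) : ℂ) • e := by
    intro n
    obtain ⟨v, hv⟩ := (hf n).2.exists_hasEigenvector
    have hv0 : ‖v‖ ≠ 0 := norm_ne_zero_iff.2 hv.2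
    refine ⟨((‖v‖⁻¹ : ℝ) : ℂ) • v, ?_, ?_⟩
    · rw [norm_smul, Complex.norm_real, norm_inv, norm_norm, inv_mul_cancel₀ hv0]
    · rw [map_smul, smul_comm]
      congr 1
      exact hv.apply_eq_smul
  choose e he1 he2 using hvec
  have horth : ∀ i j, i ≠ j → ⟪e i, e j⟫_ℂ = 0 := by
    intro i j hij
    have hne : ((f i : ℝ) : ℂ) ≠ ((f j : ℝ) : ℂ) := by
      intro h
      exact hij (f.injective (Subtype.ext (Complex.ofReal_injective h)))
    exact hsymm.orthogonalFamily_eigenspaces hne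
      ⟨e i, Module.End.mem_eigenspace_iff.2 (he2 i)⟩ ⟨e j, Module.End.mem_eigenspace_iff.2 (he2 j)⟩
  have hcpt := hK.isCompact_closure_image_closedBall (𝕜₁ := ℂ) (f := (K : H →ₗ[ℂ] H)) 1
  obtain ⟨x, -, φ, hφ, hlim⟩ := hcpt.tendsto_subseq (x := fun n => K (e n)) fun n =>
    subset_closure ⟨e n, by simp [he1], rfl⟩
  have hcauchy := hlim.cauchySeq
  rw [Metric.cauchySeq_iff] at hcauchy
  obtain ⟨N, hN⟩ := hcauchy ε hε
  have h1 := hN (N + 1) (by omega) N le_rfl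
  have hij : φ (N + 1) ≠ φ N := fun h => by
    have := hφ.injective h
    omega
  simp only [Function.comp] at h1
  rw [dist_eq_norm, he2, he2] at h1
  have h2 : ‖((f (φ (N + 1)) : ℝ) : ℂ) • e (φ (N + 1)) - ((f (φ N) : ℝ) : ℂ) • e (φ N)‖ ^ 2 =
      (f (φ (N + 1)) : ℝ) ^ 2 + (f (φ N) : ℝ) ^ 2 := by
    rw [@norm_sub_sq ℂ, inner_smul_left, inner_smul_right, horth _ _ hij, norm_smul, norm_smul,
      he1, he1]
    simp
  have h3 := (hf (φ (N + 1))).1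
  have h4 : ‖((f (φ (N + 1)) : ℝ) : ℂ) • e (φ (N + 1)) - ((f (φ N) : ℝ) : ℂ) • e (φ N)‖ ^ 2
      < ε ^ 2 := pow_lt_pow_left₀ h1 (norm_nonneg _) two_ne_zero
  rw [h2] at h4
  nlinarith [sq_nonneg (f (φ N) : ℝ)]

theorem mem_eigenspace_iff {T : H →ₗ.[ℂ] H} {z : ℂ} {u : H} :
    u ∈ eigenspace T z ↔ (u, z • u) ∈ T.graph := Iff.rfl

theorem hasEigenvalue_nonneg {K : H →L[ℂ] H} (hsymm : K.IsSymmetric)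
    (hpos : ∀ x, 0 ≤ (⟪x, K x⟫_ℂ).re) {μ : ℂ}
    (hμ : Module.End.HasEigenvalue (K : Module.End ℂ H) μ) : μ = (μ.re : ℂ) ∧ 0 ≤ μ.re := by
  have hre : μ = (μ.re : ℂ) := by
    have := hsymm.conj_eigenvalue_eq_self hμ
    exact (Complex.conj_eq_iff_re.1 this).symm
  refine ⟨hre, ?_⟩
  rw [hre] at hμ
  exact eigenvalue_nonneg_of_nonneg (𝕜 := ℂ) (T := (K : H →ₗ[ℂ] H)) hμ hpos

/-- The eigenvectors of `T` are those of the compact operator `K` if `c (T + β)⁻¹ = K`. -/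
theorem eigenspace_eq_of_graph {K : H →L[ℂ] H} {T : H →ₗ.[ℂ] H} {c β : ℝ}
    (hT : ∀ u f, (u, f) ∈ T.graph ↔ (c : ℂ) • u = K (f + (β : ℂ) • u)) {z : ℂ}
    (hz : z + β ≠ 0) :
    eigenspace T z = Module.End.eigenspace (K : Module.End ℂ H) (c / (z + β)) := by
  ext u
  rw [mem_eigenspace_iff, hT, Module.End.mem_eigenspace_iff, ← add_smul, map_smul]
  simp only [ContinuousLinearMap.coe_coe]
  constructor
  · intro h
    rw [div_eq_inv_mul, mul_smul, h, smul_smul, inv_mul_cancel₀ hz, one_smul]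
  · intro h
    rw [h, smul_smul, mul_div_cancel₀ _ hz]

/-- A nonzero eigenspace at `z` transfers to the eigenvalue `c / (z + β)` of `K`, which is real,
nonnegative and nonzero. The case `z = -β` is excluded because it would give `c • u = K 0`. -/
theorem eigenspace_eq_bot_of_graph {K : H →L[ℂ] H} {T : H →ₗ.[ℂ] H} {c β : ℝ} (hc : 0 < c)
    (hsymm : K.IsSymmetric) (hpos : ∀ x, 0 ≤ (⟪x, K x⟫_ℂ).re)
    (hT : ∀ u f, (u, f) ∈ T.graph ↔ (c : ℂ) • u = K (f + (β : ℂ) • u)) {z : ℂ}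
    (hz : eigenspace T z ≠ ⊥) : z = (z.re : ℂ) ∧ 0 < z.re + β := by
  have hzβ : z + β ≠ 0 := by
    intro h0
    refine hz ((Submodule.eq_bot_iff _).2 fun u hu => ?_)
    rw [mem_eigenspace_iff, hT, ← add_smul, h0, zero_smul, map_zero] at hu
    exact (smul_eq_zero.1 hu).resolve_left (by exact_mod_cast hc.ne')
  rw [eigenspace_eq_of_graph hT hzβ] at hz
  obtain ⟨h1, h2⟩ := hasEigenvalue_nonneg hsymm hpos (Module.End.hasEigenvalue_iff.2 hz)
  set μ := (c : ℂ) / (z + β) with hμ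
  have hμ0 : μ ≠ 0 := div_ne_zero (by exact_mod_cast hc.ne') hzβ
  have hz' : z + β = c / μ := by rw [hμ, div_div_cancel₀ (by exact_mod_cast hc.ne')]
  rw [h1] at hz' hμ0
  have hre : 0 < μ.re := lt_of_le_of_ne h2 fun h => hμ0 (by rw [← h]; simp)
  have hz2 : z = ((c / μ.re - β : ℝ) : ℂ) := by
    push_cast
    rw [← hz']
    ring
  refine ⟨by rw [hz2, Complex.ofReal_re], ?_⟩
  rw [hz2, Complex.ofReal_re]
  have := div_pos hc hre
  linarith

/-- The eigenspaces span a dense subspace by the spectral theorem. They are finite dimensional, by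
compactness off `0` and by injectivity at `0`, so finitely many of them span only a
finite-dimensional space; being closed, it would be all of `H`. -/
theorem infinite_setOf_hasEigenvalue [CompleteSpace H] {K : H →L[ℂ] H} (hK : IsCompactOperator K)
    (hsymm : K.IsSymmetric) (hinj : ∀ x, K x = 0 → x = 0) (hH : ¬ FiniteDimensional ℂ H) :
    {μ : ℂ | Module.End.HasEigenvalue (K : Module.End ℂ H) μ}.Infinite := by
  intro hfin
  have htop := ContinuousLinearMap.orthogonalComplement_iSup_eigenspaces_eq_bot hK hsymm
  have heq : (⨆ μ, Module.End.eigenspace (K : Module.End ℂ H) μ) =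
      ⨆ μ ∈ hfin.toFinset, Module.End.eigenspace (K : Module.End ℂ H) μ := by
    refine le_antisymm (iSup_le fun μ => ?_) (iSup₂_le fun μ _ => le_iSup _ μ)
    by_cases hμ : Module.End.HasEigenvalue (K : Module.End ℂ H) μ
    · exact le_iSup₂_of_le μ (by simpa using hμ) le_rfl
    · rw [Module.End.hasEigenvalue_iff, not_not] at hμ
      rw [hμ]
      exact bot_le
  have hfd : ∀ μ : ℂ, FiniteDimensional ℂ (Module.End.eigenspace (K : Module.End ℂ H) μ) := by
    intro μ
    by_cases hμ : μ = 0
    · have : Module.End.eigenspace (K : Module.End ℂ H) μ = ⊥ := by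
        refine (Submodule.eq_bot_iff _).2 fun u hu => hinj u ?_
        rw [Module.End.mem_eigenspace_iff, hμ, zero_smul] at hu
        exact hu
      rw [this]
      infer_instance
    · exact ContinuousLinearMap.finite_dimensional_eigenspace hK μ hμ
  have hfd2 : FiniteDimensional ℂ (⨆ μ, Module.End.eigenspace (K : Module.End ℂ H) μ : Submodule ℂ H) := by
    rw [heq]
    rw [← Finset.sup_eq_iSup]
    exact Submodule.finiteDimensional_finset_sup _ _
  rw [Submodule.orthogonal_eq_bot_iff] at htop
  rw [htop] at hfd2
  exact hH (LinearEquiv.finiteDimensional (Submodule.topEquiv (R := ℂ) (M := H)))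

/-- The substitution `μ = c / (z + β)` matches the eigenvalues and eigenspaces of `T` with those of
`K`. Eigenvalues of `T` below a bound become eigenvalues of `K` bounded away from `0`, hence finite
in number. -/
theorem exists_isEigenvalueSequence_of_graph [CompleteSpace H] {K : H →L[ℂ] H}
    (hK : IsCompactOperator K) (hsymm : K.IsSymmetric) (hpos : ∀ x, 0 ≤ (⟪x, K x⟫_ℂ).re)
    (hinj : ∀ x, K x = 0 → x = 0) (hH : ¬ FiniteDimensional ℂ H) {T : H →ₗ.[ℂ] H} {c β : ℝ}
    (hc : 0 < c) (hT : ∀ u f, (u, f) ∈ T.graph ↔ (c : ℂ) • u = K (f + (β : ℂ) • u)) :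
    ∃ lam : ℕ → ℝ, IsEigenvalueSequence T lam := by
  have hcC : (c : ℂ) ≠ 0 := by exact_mod_cast hc.ne'
  have hfd : ∀ z : ℂ, FiniteDimensional ℂ (eigenspace T z) := by
    intro z
    by_cases hz : eigenspace T z = ⊥
    · rw [hz]; infer_instance
    obtain ⟨h1, h2⟩ := eigenspace_eq_bot_of_graph hc hsymm hpos hT hz
    have hzβ : z + β ≠ 0 := by
      rw [h1]
      exact_mod_cast h2.ne'
    rw [eigenspace_eq_of_graph hT hzβ]
    exact ContinuousLinearMap.finite_dimensional_eigenspace hK _ (div_ne_zero hcC hzβ)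
  let d : ℝ → ℕ := fun z => Module.finrank ℂ (eigenspace T (z : ℂ))
  have hd : ∀ z, d z ≠ 0 ↔ eigenspace T (z : ℂ) ≠ ⊥ := fun z => by
    rw [not_iff_not]
    exact Submodule.finrank_eq_zero
  have hev : ∀ z : ℝ, d z ≠ 0 → 0 < z + β ∧
      Module.End.HasEigenvalue (K : Module.End ℂ H) ((c / (z + β) : ℝ) : ℂ) := by
    intro z hz
    rw [hd] at hz
    obtain ⟨h1, h2⟩ := eigenspace_eq_bot_of_graph hc hsymm hpos hT hz
    rw [Complex.ofReal_re] at h2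
    refine ⟨h2, ?_⟩
    rw [eigenspace_eq_of_graph hT (by exact_mod_cast h2.ne')] at hz
    rw [Module.End.hasEigenvalue_iff]
    push_cast
    exact hz
  have hfinite : ∀ a, {z | z ≤ a ∧ d z ≠ 0}.Finite := by
    intro a
    -- The maximum with `1 - β` keeps the denominator at least `1`, also when `a ≤ -β`.
    have hfin := finite_setOf_hasEigenvalue_ge hK hsymm
      (ε := c / (max a (1 - β) + β)) (div_pos hc (by linarith [le_max_right a (1 - β)]))
    refine (hfin.preimage (f := fun z : ℝ => c / (z + β)) ?_).subset ?_
    · intro x hx y hy hxy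
      simp only [mem_preimage, mem_ofPred_eq] at hx hy hxy
      have hp : 0 < c / (max a (1 - β) + β) :=
        div_pos hc (by linarith [le_max_right a (1 - β)])
      have hx0 : x + β ≠ 0 := fun h => by
        rw [h, div_zero] at hx
        linarith [hx.1]
      have hy0 : y + β ≠ 0 := fun h => by
        rw [h, div_zero] at hy
        linarith [hy.1]
      rw [div_eq_div_iff hx0 hy0] at hxy
      have := mul_left_cancel₀ hc.ne' hxy
      linarith
    · rintro z ⟨hz1, hz2⟩
      obtain ⟨h1, h2⟩ := hev z hz2
      exact ⟨div_le_div_of_nonneg_left hc.le h1 (by linarith [le_max_left a (1 - β)]), h2⟩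
  have hinfinite : {z | d z ≠ 0}.Infinite := by
    intro hfin
    refine infinite_setOf_hasEigenvalue hK hsymm hinj hH
      ((hfin.image fun z : ℝ => (c : ℂ) / (z + β)).subset ?_)
    intro μ hμ
    obtain ⟨h1, h2⟩ := hasEigenvalue_nonneg hsymm hpos hμ
    have hμ0 : μ ≠ 0 := by
      rintro rfl
      obtain ⟨v, hv⟩ := hμ.exists_hasEigenvector
      refine hv.2 (hinj v ?_)
      have := hv.apply_eq_smul
      rwa [zero_smul] at this
    have hre : μ.re ≠ 0 := fun h => hμ0 (by rw [h1, h, Complex.ofReal_zero])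
    have hval : (c : ℂ) / (((c / μ.re - β : ℝ) : ℂ) + β) = μ := by
      conv_rhs => rw [h1]
      push_cast
      rw [sub_add_cancel, div_div_cancel₀ hcC]
    refine ⟨c / μ.re - β, ?_, hval⟩
    have hne : (((c / μ.re - β : ℝ) : ℂ) + β) ≠ 0 := by
      intro h
      rw [h, div_zero] at hval
      exact hμ0 hval.symm
    rw [mem_ofPred_eq, hd, eigenspace_eq_of_graph hT hne, hval]
    exact Module.End.hasEigenvalue_iff.1 hμ
  obtain ⟨lam, hmono, hcard⟩ := exists_monotone_enumeration d hfinite hinfinite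
  refine ⟨lam, hmono, fun z => ?_⟩
  by_cases hz : z = (z.re : ℂ)
  · have h1 : {k : ℕ | (lam k : ℂ) = z} = {k | lam k = z.re} := by
      ext k
      rw [mem_ofPred_eq, mem_ofPred_eq, hz, Complex.ofReal_inj, Complex.ofReal_re]
    rw [h1, hcard, ← Module.finrank_eq_rank, map_natCast]
    simp only [d]
    rw [← hz]
  · have h1 : {k : ℕ | (lam k : ℂ) = z} = ∅ := by
      refine Set.eq_empty_of_forall_notMem fun k hk => hz ?_
      rw [← (hk : (lam k : ℂ) = z), Complex.ofReal_re]
    have h2 : eigenspace T z = ⊥ := by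
      by_contra hne
      exact hz (eigenspace_eq_bot_of_graph hc hsymm hpos hT hne).1
    rw [h1, h2]
    simp

/-- The multiplicity count leaves room for Gram-Schmidt inside each eigenspace; symmetry of `T`
makes different eigenspaces orthogonal. -/
theorem IsEigenvalueSequence.exists_orthonormal {T : H →ₗ.[ℂ] H} {lam : ℕ → ℝ}
    (hlam : IsEigenvalueSequence T lam)
    (hsymm : ∀ u f v g, (u, f) ∈ T.graph → (v, g) ∈ T.graph → ⟪f, v⟫_ℂ = ⟪u, g⟫_ℂ) (n : ℕ) :
    ∃ e : Fin n → H, Orthonormal ℂ e ∧ ∀ j : Fin n, (e j, (lam j : ℂ) • e j) ∈ T.graph := by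
  classical
  have key : ∀ z : ℝ, ∃ o : {j : Fin n // lam j = z} → H, Orthonormal ℂ o ∧
      ∀ j, o j ∈ eigenspace T (z : ℂ) := by
    intro z
    have h1 : ((Fintype.card {j : Fin n // lam j = z} : ℕ) : ℕ∞) ≤
        {k : ℕ | (lam k : ℂ) = z}.encard := by
      have hinj : Function.Injective fun j : {j : Fin n // lam j = z} => ((j : Fin n) : ℕ) :=
        fun i j hij => Subtype.ext (Fin.ext hij)
      have h2 : (fun j : {j : Fin n // lam j = z} => ((j : Fin n) : ℕ)) '' Set.univ ⊆
          {k : ℕ | (lam k : ℂ) = z} := by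
        rintro _ ⟨j, -, rfl⟩
        exact congrArg Complex.ofReal j.2
      refine le_trans (le_of_eq ?_) (Set.encard_le_encard h2)
      rw [hinj.encard_image, Set.encard_univ, ENat.card_eq_coe_fintype_card]
    rw [hlam.encard_eq, Cardinal.natCast_le_toENat, Module.le_rank_iff] at h1
    obtain ⟨v, hv⟩ := h1
    have ho := InnerProductSpace.gramSchmidtNormed_orthonormal hv
    let φ := Fintype.equivFin {j : Fin n // lam j = z}
    refine ⟨fun j => ((InnerProductSpace.gramSchmidtNormed ℂ v (φ j) : eigenspace T (z : ℂ)) : H),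
      ?_, fun j => Subtype.property _⟩
    exact (ho.comp_linearIsometry (eigenspace T (z : ℂ)).subtypeₗᵢ).comp φ φ.injective
  choose o ho1 ho2 using key
  -- The families are indexed by the eigenvalue, so equal eigenvalues at different positions draw
  -- from one orthonormal family.
  have hcast : ∀ (j : Fin n) (z z' : ℝ) (h : lam j = z) (h' : lam j = z'),
      o z ⟨j, h⟩ = o z' ⟨j, h'⟩ := by
    rintro j z z' rfl rfl
    rfl
  have hmem : ∀ j : Fin n, (o (lam j) ⟨j, rfl⟩, (lam j : ℂ) • o (lam j) ⟨j, rfl⟩) ∈ T.graph :=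
    fun j => ho2 (lam j) ⟨j, rfl⟩
  refine ⟨fun j => o (lam j) ⟨j, rfl⟩, ⟨fun j => (ho1 _).1 _, fun i j hij => ?_⟩, hmem⟩
  by_cases heq : lam i = lam j
  · simp only
    rw [hcast i (lam i) (lam j) rfl heq]
    exact (ho1 (lam j)).2 fun h => hij (Subtype.ext_iff.1 h)
  · have h := hsymm _ _ _ _ (hmem i) (hmem j)
    rw [inner_smul_left, inner_smul_right, Complex.conj_ofReal] at h
    have h2 : ((lam i : ℂ) - lam j) * ⟪o (lam i) ⟨i, rfl⟩, o (lam j) ⟨j, rfl⟩⟫_ℂ = 0 := by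
      rw [sub_mul, h, sub_self]
    exact (mul_eq_zero.1 h2).resolve_left (sub_ne_zero.2 fun h => heq (Complex.ofReal_injective h))

/-- The norm of a self-adjoint operator is its spectral radius, and the nonzero spectrum of a
compact operator consists of eigenvalues. -/
theorem norm_le_of_hasEigenvalue_le [CompleteSpace H] {K : H →L[ℂ] H} (hK : IsCompactOperator K)
    (hsymm : K.IsSymmetric) (hpos : ∀ x, 0 ≤ (⟪x, K x⟫_ℂ).re) {M : ℝ} (hM : 0 ≤ M)
    (hle : ∀ μ : ℝ, 0 < μ → Module.End.HasEigenvalue (K : Module.End ℂ H) (μ : ℂ) → μ ≤ M) :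
    ‖K‖ ≤ M := by
  have h1 := K.spectralRadius_eq_nnnorm hsymm.isSelfAdjoint
  have h2 : spectralRadius ℂ K ≤ ((M.toNNReal : NNReal) : ENNReal) := by
    refine iSup₂_le fun k hk => ?_
    rw [ENNReal.coe_le_coe, ← NNReal.coe_le_coe, coe_nnnorm, Real.coe_toNNReal M hM]
    by_cases hk0 : k = 0
    · rw [hk0, norm_zero]
      exact hM
    rw [← hK.hasEigenvalue_iff_mem_spectrum hk0] at hk
    obtain ⟨h3, h4⟩ := hasEigenvalue_nonneg hsymm hpos hk
    rw [h3] at hk hk0 ⊢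
    rw [Complex.norm_real, Real.norm_of_nonneg h4]
    exact hle _ (lt_of_le_of_ne h4 fun h => hk0 (by rw [← h, Complex.ofReal_zero])) hk
  rw [h1, ENNReal.coe_le_coe, ← NNReal.coe_le_coe, coe_nnnorm, Real.coe_toNNReal M hM] at h2
  exact h2

theorem IsEigenvalueSequence.eigenspace_ne_bot {T : H →ₗ.[ℂ] H} {lam : ℕ → ℝ}
    (hlam : IsEigenvalueSequence T lam) (k : ℕ) : eigenspace T (lam k : ℂ) ≠ ⊥ := by
  intro hbot
  have h := hlam.encard_eq (lam k)
  rw [hbot, rank_bot, map_zero, Set.encard_eq_zero] at h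
  have hk : k ∈ {j : ℕ | (lam j : ℂ) = lam k} := rfl
  rw [h] at hk
  exact hk

theorem IsEigenvalueSequence.exists_eq {T : H →ₗ.[ℂ] H} {lam : ℕ → ℝ}
    (hlam : IsEigenvalueSequence T lam) {z : ℝ} (hz : eigenspace T (z : ℂ) ≠ ⊥) :
    ∃ k, lam k = z := by
  by_contra! hcon
  have h := hlam.encard_eq z
  have h1 : {k : ℕ | (lam k : ℂ) = z} = ∅ :=
    Set.eq_empty_of_forall_notMem fun k hk => hcon k (Complex.ofReal_injective hk)
  rw [h1, Set.encard_empty, eq_comm, Cardinal.toENat_eq_zero, Submodule.rank_eq_zero] at h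
  exact hz h

/-- The lowest eigenvalue of `T` corresponds to the largest one of `K`. This is the source of the
variational upper bound for `lam 0`. -/
theorem IsEigenvalueSequence.norm_le_of_graph [CompleteSpace H] {K : H →L[ℂ] H}
    (hK : IsCompactOperator K) (hsymm : K.IsSymmetric) (hpos : ∀ x, 0 ≤ (⟪x, K x⟫_ℂ).re)
    {T : H →ₗ.[ℂ] H} {c β : ℝ} (hc : 0 < c)
    (hT : ∀ u f, (u, f) ∈ T.graph ↔ (c : ℂ) • u = K (f + (β : ℂ) • u)) {lam : ℕ → ℝ}
    (hlam : IsEigenvalueSequence T lam) : 0 < lam 0 + β ∧ ‖K‖ ≤ c / (lam 0 + β) := by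
  have h0 : 0 < lam 0 + β := by
    have := (eigenspace_eq_bot_of_graph hc hsymm hpos hT (hlam.eigenspace_ne_bot 0)).2
    rwa [Complex.ofReal_re] at this
  refine ⟨h0, norm_le_of_hasEigenvalue_le hK hsymm hpos (div_pos hc h0).le fun μ hμ hev => ?_⟩
  have hne : (((c / μ - β : ℝ) : ℂ) + β) = ((c / μ : ℝ) : ℂ) := by
    push_cast
    ring
  have hz : eigenspace T ((c / μ - β : ℝ) : ℂ) ≠ ⊥ := by
    rw [eigenspace_eq_of_graph hT, hne, ← Complex.ofReal_div, div_div_cancel₀ hc.ne']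
    · exact Module.End.hasEigenvalue_iff.1 hev
    · rw [hne]
      exact_mod_cast (div_pos hc hμ).ne'
  obtain ⟨k, hk⟩ := hlam.exists_eq hz
  have hle : lam 0 + β ≤ c / μ := by
    have := hlam.monotone (Nat.zero_le k)
    linarith
  rw [le_div_iff₀ h0]
  rw [le_div_iff₀ hμ] at hle
  linarith

end CompactResolvent

/-! ### The weighted space `L²(r dr)` and its Cauchy-Schwarz estimates. -/

section RadialMeasure

theorem radialMeasure_absolutelyContinuous (R : ℝ) :
    radialMeasure R ≪ volume.restrict (Ioo 0 R) :=
  withDensity_absolutelyContinuous _ _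

theorem absolutelyContinuous_radialMeasure (R : ℝ) :
    volume.restrict (Ioo 0 R) ≪ radialMeasure R := by
  refine withDensity_absolutelyContinuous' (by fun_prop) ?_
  filter_upwards [ae_restrict_mem measurableSet_Ioo] with r hr
  simpa using hr.1

theorem aestronglyMeasurable_radialMeasure_iff {E : Type*} [TopologicalSpace E] {R : ℝ}
    {f : ℝ → E} : AEStronglyMeasurable f (radialMeasure R) ↔
      AEStronglyMeasurable f (volume.restrict (Ioo 0 R)) :=
  ⟨fun h => h.mono_ac (absolutelyContinuous_radialMeasure R),
    fun h => h.mono_ac (radialMeasure_absolutelyContinuous R)⟩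

theorem integrable_radialMeasure_iff {E : Type*} [NormedAddCommGroup E] [NormedSpace ℝ E] {R : ℝ}
    {f : ℝ → E} : Integrable f (radialMeasure R) ↔
      IntegrableOn (fun r : ℝ => r • f r) (Ioo 0 R) := by
  rw [radialMeasure, integrable_withDensity_iff_integrable_smul' (by fun_prop)
    (Eventually.of_forall fun r => ENNReal.ofReal_lt_top)]
  refine integrable_congr ?_
  filter_upwards [ae_restrict_mem measurableSet_Ioo] with r hr
  rw [ENNReal.toReal_ofReal hr.1.le]

theorem integral_radialMeasure_real (R : ℝ) (f : ℝ → ℝ) :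
    ∫ r, f r ∂radialMeasure R = ∫ r in Ioo 0 R, r * f r := by
  rw [radialMeasure, integral_withDensity_eq_integral_toReal_smul (by fun_prop)
    (Eventually.of_forall fun r => ENNReal.ofReal_lt_top)]
  refine setIntegral_congr_fun measurableSet_Ioo fun r hr => ?_
  simp only [ENNReal.toReal_ofReal hr.1.le, smul_eq_mul]

theorem memLp_radialMeasure_iff {R : ℝ} {f : ℝ → ℂ} : MemLp f 2 (radialMeasure R) ↔
    AEStronglyMeasurable f (volume.restrict (Ioo 0 R)) ∧
      IntegrableOn (fun r : ℝ => r * ‖f r‖ ^ 2) (Ioo 0 R) := by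
  rw [← aestronglyMeasurable_radialMeasure_iff]
  constructor
  · intro h
    refine ⟨h.1, ?_⟩
    have := (memLp_two_iff_integrable_sq_norm h.1).1 h
    rwa [integrable_radialMeasure_iff] at this
  · rintro ⟨h1, h2⟩
    rw [memLp_two_iff_integrable_sq_norm h1, integrable_radialMeasure_iff]
    exact h2

variable {R : ℝ}

theorem aestronglyMeasurable_restrict (f : RadialL2 R) :
    AEStronglyMeasurable f (volume.restrict (Ioo 0 R)) :=
  (memLp_radialMeasure_iff.1 (Lp.memLp f)).1

theorem integrableOn_norm_sq (f : RadialL2 R) :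
    IntegrableOn (fun r : ℝ => r * ‖f r‖ ^ 2) (Ioo 0 R) :=
  (memLp_radialMeasure_iff.1 (Lp.memLp f)).2

theorem norm_sq_eq_integral (f : RadialL2 R) : ‖f‖ ^ 2 = ∫ r in Ioo 0 R, r * ‖f r‖ ^ 2 := by
  have h : (‖f‖ : ℝ) ^ 2 = (⟪f, f⟫_ℂ).re := by
    rw [inner_self_eq_norm_sq_to_K]
    norm_cast
  rw [h, L2.inner_def, ← integral_radialMeasure_real]
  have h2 : ∫ r, ⟪f r, f r⟫_ℂ ∂radialMeasure R = ((∫ r, ‖f r‖ ^ 2 ∂radialMeasure R : ℝ) : ℂ) := by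
    refine (integral_congr_ae (Eventually.of_forall fun r => ?_)).trans (integral_ofReal (𝕜 := ℂ))
    rw [inner_self_eq_norm_sq_to_K]
    norm_cast
  rw [h2, Complex.ofReal_re]

theorem inner_eq_integral (f g : RadialL2 R) :
    ⟪f, g⟫_ℂ = ∫ r in Ioo 0 R, (r : ℂ) * (starRingEnd ℂ (f r) * g r) := by
  rw [L2.inner_def, integral_radialMeasure]
  refine setIntegral_congr_fun measurableSet_Ioo fun r _ => ?_
  simp [mul_comm]

theorem ae_Ioo_iff {p : ℝ → Prop} :
    (∀ᵐ r ∂radialMeasure R, p r) ↔ ∀ᵐ r ∂(volume.restrict (Ioo 0 R)), p r := by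
  rw [ae_radialMeasure_iff, ae_restrict_iff' measurableSet_Ioo]

/-- An almost everywhere bound `r ‖f r‖² ≤ C` gives an `L²` bound. -/
theorem norm_sq_le_of_forall_mul_le (hR : 0 ≤ R) {C : ℝ} (f : RadialL2 R)
    (h : ∀ᵐ r ∂radialMeasure R, r * ‖f r‖ ^ 2 ≤ C) : ‖f‖ ^ 2 ≤ R * C := by
  rw [norm_sq_eq_integral]
  have h1 : ∫ r in Ioo 0 R, r * ‖f r‖ ^ 2 ≤ ∫ _ in Ioo 0 R, C :=
    setIntegral_mono_ae_restrict (integrableOn_norm_sq f) (by simp) (ae_Ioo_iff.1 h)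
  simpa [hR] using h1

theorem memLp_of_forall_mul_le {C : ℝ} {f : ℝ → ℂ}
    (hf : AEStronglyMeasurable f (volume.restrict (Ioo 0 R)))
    (h : ∀ r ∈ Ioo 0 R, r * ‖f r‖ ^ 2 ≤ C) : MemLp f 2 (radialMeasure R) := by
  refine memLp_radialMeasure_iff.2 ⟨hf, ?_⟩
  refine Integrable.of_bound (C := C) ?_ ?_
  · exact measurable_id.aestronglyMeasurable.mul (hf.norm.pow 2)
  · filter_upwards [ae_restrict_mem measurableSet_Ioo] with r hr
    rw [Real.norm_of_nonneg (mul_nonneg hr.1.le (sq_nonneg _))]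
    exact h r hr

theorem sq_norm_integral_mul_le {α : Type*} [MeasurableSpace α] {μ : Measure α} {f g : α → ℂ}
    (hf : MemLp f 2 μ) (hg : MemLp g 2 μ) :
    ‖∫ x, f x * g x ∂μ‖ ^ 2 ≤ (∫ x, ‖f x‖ ^ 2 ∂μ) * ∫ x, ‖g x‖ ^ 2 ∂μ := by
  have h1 : ‖∫ x, f x * g x ∂μ‖ ≤ ∫ x, ‖f x‖ * ‖g x‖ ∂μ := by
    refine (norm_integral_le_integral_norm _).trans_eq ?_
    simp
  have h2 := integral_mul_norm_le_Lp_mul_Lq (p := 2) (q := 2) (f := f) (g := g) (μ := μ)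
    (by constructor <;> norm_num) (by simpa using hf) (by simpa using hg)
  have h3 : ∀ k : α → ℂ, (∫ x, ‖k x‖ ^ (2 : ℝ) ∂μ) ^ (1 / 2 : ℝ) = √(∫ x, ‖k x‖ ^ 2 ∂μ) := by
    intro k
    rw [Real.sqrt_eq_rpow]
    simp
  rw [h3, h3] at h2
  calc ‖∫ x, f x * g x ∂μ‖ ^ 2 ≤ (√(∫ x, ‖f x‖ ^ 2 ∂μ) * √(∫ x, ‖g x‖ ^ 2 ∂μ)) ^ 2 :=
        pow_le_pow_left₀ (norm_nonneg _) (h1.trans h2) 2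
    _ = _ := by
        rw [mul_pow, Real.sq_sqrt (integral_nonneg fun _ => sq_nonneg _),
          Real.sq_sqrt (integral_nonneg fun _ => sq_nonneg _)]

/-- The Cauchy-Schwarz inequality for the integral of an element of `L²(r dr)` against a function
which is continuous away from the origin. -/
theorem sq_norm_intervalIntegral_mul_le (g : RadialL2 R) {ψ : ℝ → ℝ} {a b : ℝ} (ha : 0 < a)
    (hab : a ≤ b) (hb : b ≤ R) (hψ : ContinuousOn ψ (Icc a b)) :
    ‖∫ s in a..b, (ψ s : ℂ) * g s‖ ^ 2 ≤ (∫ s in a..b, ψ s ^ 2 / s) * ‖g‖ ^ 2 := by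
  have hsub : Ioo a b ⊆ Ioo 0 R := Ioo_subset_Ioo ha.le hb
  rw [intervalIntegral.integral_of_le hab, intervalIntegral.integral_of_le hab,
    integral_Ioc_eq_integral_Ioo, integral_Ioc_eq_integral_Ioo]
  -- Splitting `ψ g = (ψ / √s) (√s g)` puts the weight `s` on `g` and leaves `ψ² / s` in the other
  -- factor.
  have hcont : ContinuousOn (fun s => ψ s / √s) (Icc a b) :=
    hψ.div Real.continuous_sqrt.continuousOn fun s hs => (Real.sqrt_pos.2 (ha.trans_le hs.1)).ne'
  have hf : MemLp (fun s => ((ψ s / √s : ℝ) : ℂ)) 2 (volume.restrict (Ioo a b)) := by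
    have hc2 : ContinuousOn (fun s => ((ψ s / √s : ℝ) : ℂ)) (Icc a b) :=
      Complex.continuous_ofReal.comp_continuousOn hcont
    have hm := (hc2.mono Ioo_subset_Icc_self).aestronglyMeasurable measurableSet_Ioo (μ := volume)
    rw [memLp_two_iff_integrable_sq_norm hm]
    exact ((hc2.norm.pow 2).integrableOn_Icc).mono_set Ioo_subset_Icc_self
  have hg : MemLp (fun s => ((√s : ℝ) : ℂ) * g s) 2 (volume.restrict (Ioo a b)) := by
    have hm : AEStronglyMeasurable (fun s => ((√s : ℝ) : ℂ) * g s) (volume.restrict (Ioo a b)) := by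
      refine AEStronglyMeasurable.mul ?_ ((aestronglyMeasurable_restrict g).mono_set hsub)
      exact (Complex.continuous_ofReal.comp Real.continuous_sqrt).aestronglyMeasurable
    rw [memLp_two_iff_integrable_sq_norm hm]
    refine ((integrableOn_norm_sq g).mono_set hsub).congr ?_
    filter_upwards [ae_restrict_mem measurableSet_Ioo] with s hs
    rw [norm_mul, mul_pow, Complex.norm_real, Real.norm_of_nonneg (Real.sqrt_nonneg _),
      Real.sq_sqrt (ha.trans hs.1).le]
  have h := sq_norm_integral_mul_le hf hg
  have e1 : ∫ s in Ioo a b, ((ψ s / √s : ℝ) : ℂ) * (((√s : ℝ) : ℂ) * g s) =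
      ∫ s in Ioo a b, (ψ s : ℂ) * g s := by
    refine setIntegral_congr_fun measurableSet_Ioo fun s hs => ?_
    have : ((√s : ℝ) : ℂ) ≠ 0 := by exact_mod_cast (Real.sqrt_pos.2 (ha.trans hs.1)).ne'
    push_cast
    field_simp
  have e2 : ∫ s in Ioo a b, ‖((ψ s / √s : ℝ) : ℂ)‖ ^ 2 = ∫ s in Ioo a b, ψ s ^ 2 / s := by
    refine setIntegral_congr_fun measurableSet_Ioo fun s hs => ?_
    rw [Complex.norm_real, norm_div, div_pow, Real.norm_eq_abs, sq_abs,
      Real.norm_of_nonneg (Real.sqrt_nonneg _), Real.sq_sqrt (ha.trans hs.1).le]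
  have e3 : ∫ s in Ioo a b, ‖((√s : ℝ) : ℂ) * g s‖ ^ 2 ≤ ‖g‖ ^ 2 := by
    rw [norm_sq_eq_integral]
    refine le_trans (le_of_eq ?_) (setIntegral_mono_set (integrableOn_norm_sq g) ?_
      (Eventually.of_forall hsub))
    · refine setIntegral_congr_fun measurableSet_Ioo fun s hs => ?_
      rw [norm_mul, mul_pow, Complex.norm_real, Real.norm_of_nonneg (Real.sqrt_nonneg _),
        Real.sq_sqrt (ha.trans hs.1).le]
    · filter_upwards [ae_restrict_mem measurableSet_Ioo] with s hs
      exact mul_nonneg hs.1.le (sq_nonneg _)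
  rw [e1, e2] at h
  refine h.trans (mul_le_mul_of_nonneg_left e3 ?_)
  exact setIntegral_nonneg measurableSet_Ioo fun s hs => div_nonneg (sq_nonneg _) (ha.trans hs.1).le

theorem sq_norm_intervalIntegral_le (g : RadialL2 R) {a b : ℝ} (ha : 0 < a)
    (hab : a ≤ b) (hb : b ≤ R) : ‖∫ s in a..b, g s‖ ^ 2 ≤ (b - a) / a * ‖g‖ ^ 2 := by
  have h := sq_norm_intervalIntegral_mul_le g (ψ := fun _ => 1) ha hab hb continuousOn_const
  simp only [Complex.ofReal_one, one_mul] at h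
  refine h.trans (mul_le_mul_of_nonneg_right ?_ (sq_nonneg _))
  have h2 : ∫ s in a..b, (1 : ℝ) ^ 2 / s ≤ ∫ _ in a..b, 1 / a := by
    refine intervalIntegral.integral_mono_on hab ?_ (by simp) fun s hs => ?_
    · refine ContinuousOn.intervalIntegrable_of_Icc hab ?_
      exact continuousOn_const.div continuousOn_id fun s hs => (ha.trans_le hs.1).ne'
    · rw [one_pow]
      exact one_div_le_one_div_of_le ha hs.1
  refine h2.trans_eq ?_
  simp [div_eq_mul_inv]

theorem continuousOn_integral_right (g : RadialL2 R) :
    ContinuousOn (fun r => ∫ s in r..R, g s) (Ioc 0 R) := by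
  intro r hr
  have hr2 : r / 2 ∈ Ioo 0 R := ⟨by linarith [hr.1], by linarith [hr.1, hr.2]⟩
  have := intervalIntegral.continuousOn_primitive_interval_left
    (μ := volume) (f := g) (a := r / 2) (b := R)
    (by
      have := intervalIntegrable R g hr2
      rwa [intervalIntegrable_iff'] at this)
  have h1 := this r (by rw [uIcc_of_le hr2.2.le]; exact ⟨by linarith [hr.1], hr.2⟩)
  refine h1.mono_of_mem_nhdsWithin ?_
  rw [uIcc_of_le hr2.2.le]
  refine mem_nhdsWithin.2 ⟨Ioi (r / 2), isOpen_Ioi, by simp [hr.1], fun s hs => ⟨le_of_lt hs.1, hs.2.2⟩⟩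

end RadialMeasure

/-! ### Bounded operators on `L²(r dr)` and compactness of integration. -/

variable {R : ℝ}

theorem norm_le_sqrt_mul (hR : 0 ≤ R) {C : ℝ} {f g : RadialL2 R}
    (h : ∀ᵐ r ∂radialMeasure R, r * ‖f r‖ ^ 2 ≤ C * ‖g‖ ^ 2) : ‖f‖ ≤ √(R * C) * ‖g‖ := by
  have h1 := norm_sq_le_of_forall_mul_le hR f h
  rw [← Real.sqrt_sq (norm_nonneg f)]
  refine (Real.sqrt_le_sqrt h1).trans_eq ?_
  rw [← mul_assoc, Real.sqrt_mul' _ (sq_nonneg _), Real.sqrt_sq (norm_nonneg g)]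

/-- The factor `r` in the pointwise bound is the weight of the measure, so integrating over `(0, R)`
gives the operator norm bound `√(R C)`. -/
theorem exists_clm_of_pointwise (hR : 0 ≤ R) {Φ : RadialL2 R → ℝ → ℂ} {C : ℝ}
    (hm : ∀ g, AEStronglyMeasurable (Φ g) (volume.restrict (Ioo 0 R)))
    (hadd : ∀ f g, ∀ r ∈ Ioo 0 R, Φ (f + g) r = Φ f r + Φ g r)
    (hsmul : ∀ (c : ℂ) (g), ∀ r ∈ Ioo 0 R, Φ (c • g) r = c * Φ g r)
    (hC : ∀ g, ∀ r ∈ Ioo 0 R, r * ‖Φ g r‖ ^ 2 ≤ C * ‖g‖ ^ 2) :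
    ∃ S : RadialL2 R →L[ℂ] RadialL2 R, ∀ g, S g =ᵐ[radialMeasure R] Φ g := by
  have hL : ∀ g, MemLp (Φ g) 2 (radialMeasure R) := fun g => memLp_of_forall_mul_le (hm g) (hC g)
  let S : RadialL2 R →ₗ[ℂ] RadialL2 R :=
    { toFun := fun g => (hL g).toLp
      map_add' := fun f g => by
        rw [← MemLp.toLp_add]
        refine MemLp.toLp_congr _ _ ?_
        filter_upwards [ae_mem_radialMeasure R] with r hr
        exact hadd f g r hr
      map_smul' := fun c g => by
        rw [RingHom.id_apply, ← MemLp.toLp_const_smul]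
        refine MemLp.toLp_congr _ _ ?_
        filter_upwards [ae_mem_radialMeasure R] with r hr
        exact hsmul c g r hr }
  have hS : ∀ g, S g =ᵐ[radialMeasure R] Φ g := fun g => MemLp.coeFn_toLp (hL g)
  refine ⟨S.mkContinuous (√(R * C)) fun g => ?_, hS⟩
  refine norm_le_sqrt_mul hR ?_
  filter_upwards [hS g, ae_mem_radialMeasure R] with r h1 hr
  rw [h1]
  exact hC g r hr

theorem exists_mul_clm (R : ℝ) {ψ : ℝ → ℝ} (hψ : Continuous ψ) :
    ∃ M : RadialL2 R →L[ℂ] RadialL2 R, ∀ g : RadialL2 R,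
      M g =ᵐ[radialMeasure R] fun r => (ψ r : ℂ) * g r := by
  obtain ⟨C, hC⟩ := (isCompact_Icc (a := (0 : ℝ)) (b := R)).exists_bound_of_continuousOn
    hψ.continuousOn
  let ψL : Lp ℂ ⊤ (radialMeasure R) := MemLp.toLp (fun r => (ψ r : ℂ)) (by
    refine memLp_top_of_bound (Complex.continuous_ofReal.comp hψ).aestronglyMeasurable C ?_
    filter_upwards [ae_mem_radialMeasure R] with r hr
    simpa using hC r (Ioo_subset_Icc_self hr))
  refine ⟨(ContinuousLinearMap.mul ℂ ℂ).holderL (radialMeasure R) ⊤ 2 2 ψL, fun g => ?_⟩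
  have h1 := ContinuousLinearMap.coeFn_holder (r := 2) (ContinuousLinearMap.mul ℂ ℂ) ψL g
  refine EventuallyEq.trans h1 ?_
  filter_upwards [MemLp.coeFn_toLp (μ := radialMeasure R) (p := ⊤) (f := fun r => (ψ r : ℂ)) _] with r hr
  rw [ContinuousLinearMap.mul_apply', hr]

/-- On a nonzero finite-dimensional complex space, multiplication by `r` would have an eigenvector;
it would vanish away from one point, hence almost everywhere. -/
theorem not_finiteDimensional_radialL2 (hR : 0 < R) : ¬ FiniteDimensional ℂ (RadialL2 R) := by
  intro hfd
  obtain ⟨M, hM⟩ := exists_mul_clm R continuous_id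
  have hne : Nontrivial (RadialL2 R) := by
    refine ⟨⟨MemLp.toLp (fun _ => (1 : ℂ)) (memLp_const 1), 0, fun h => ?_⟩⟩
    rw [Lp.eq_zero_iff_ae_eq_zero] at h
    have h1 : ∀ᵐ r ∂radialMeasure R, False := by
      filter_upwards [h, MemLp.coeFn_toLp (memLp_const (μ := radialMeasure R) (p := 2) (1 : ℂ))]
        with r h1 h2
      rw [h1] at h2
      simp at h2
    rw [ae_radialMeasure_iff] at h1
    have h2 : volume (Ioo 0 R) = 0 := by
      rw [measure_eq_zero_iff_ae_notMem]
      filter_upwards [h1] with r hr hr'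
      exact hr hr'
    rw [Real.volume_Ioo] at h2
    simp at h2
    linarith
  obtain ⟨c, hc⟩ := Module.End.exists_eigenvalue (M : Module.End ℂ (RadialL2 R))
  obtain ⟨v, hv⟩ := hc.exists_hasEigenvector
  refine hv.2 ((Lp.eq_zero_iff_ae_eq_zero).2 ?_)
  have h1 : M v = c • v := hv.apply_eq_smul
  have h2 : ∀ᵐ r ∂radialMeasure R, r ≠ c.re := by
    rw [ae_radialMeasure_iff]
    filter_upwards [Measure.ae_ne volume c.re] with r hr _ using hr
  have h3 := hM v
  rw [h1] at h3
  filter_upwards [h2, h3, Lp.coeFn_smul c v] with r h4 h5 h6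
  rw [h6, Pi.smul_apply, smul_eq_mul, id] at h5
  have h7 : (c - r) * v r = 0 := by rw [sub_mul, h5, sub_self]
  refine (mul_eq_zero.1 h7).resolve_left fun h8 => h4 ?_
  rw [sub_eq_zero.1 h8, Complex.ofReal_re]

theorem exists_integral_clm {a : ℝ} (ha : a ∈ Ioc 0 R) :
    ∃ l : RadialL2 R →L[ℂ] ℂ, ∀ g : RadialL2 R, l g = ∫ s in a..R, g s := by
  have hint : ∀ g : RadialL2 R, IntervalIntegrable g volume a R := by
    intro g
    rcases eq_or_lt_of_le ha.2 with h | h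
    · rw [h]
    · exact intervalIntegrable R g ⟨ha.1, h⟩
  have hcongr : ∀ f g : ℝ → ℂ, f =ᵐ[radialMeasure R] g → ∫ s in a..R, f s = ∫ s in a..R, g s := by
    intro f g hfg
    rcases eq_or_lt_of_le ha.2 with h | h
    · rw [h, intervalIntegral.integral_same, intervalIntegral.integral_same]
    · exact intervalIntegral_congr_radial hfg ⟨ha.1, h⟩
  let l : RadialL2 R →ₗ[ℂ] ℂ :=
    { toFun := fun g => ∫ s in a..R, g s
      map_add' := fun f g => by
        rw [hcongr _ _ (Lp.coeFn_add f g)]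
        exact intervalIntegral.integral_add (hint f) (hint g)
      map_smul' := fun c g => by
        rw [hcongr _ _ (Lp.coeFn_smul c g)]
        exact intervalIntegral.integral_smul c _ }
  refine ⟨l.mkContinuous (√((R - a) / a)) fun g => ?_, fun g => rfl⟩
  have h := sq_norm_intervalIntegral_le g ha.1 ha.2 le_rfl
  rw [← Real.sqrt_sq (norm_nonneg (l g)), ← Real.sqrt_sq (norm_nonneg g), ← Real.sqrt_mul'
    _ (sq_nonneg _)]
  exact Real.sqrt_le_sqrt h

/-- The operator of integration from the Dirichlet end point is compact on `L²(r dr)`. -/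
theorem exists_primitive_clm (hR : 0 < R) : ∃ S : RadialL2 R →L[ℂ] RadialL2 R,
    IsCompactOperator S ∧
      ∀ g : RadialL2 R, S g =ᵐ[radialMeasure R] fun r => -∫ s in r..R, g s := by
  choose! l hl using fun a (ha : a ∈ Ioc 0 R) => exists_integral_clm ha
  obtain ⟨S, hS⟩ := exists_clm_of_pointwise hR.le (Φ := fun g r => -∫ s in r..R, g s) (C := R)
    (fun g => ((continuousOn_integral_right g).neg.mono Ioo_subset_Ioc_self).aestronglyMeasurable
      measurableSet_Ioo)
    (fun f g r hr => by
      rw [← hl r ⟨hr.1, hr.2.le⟩, ← hl r ⟨hr.1, hr.2.le⟩, ← hl r ⟨hr.1, hr.2.le⟩, map_add, neg_add])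
    (fun c g r hr => by
      rw [← hl r ⟨hr.1, hr.2.le⟩, ← hl r ⟨hr.1, hr.2.le⟩, map_smul, smul_eq_mul, mul_neg])
    (fun g r hr => by
      rw [norm_neg]
      have h := sq_norm_intervalIntegral_le g hr.1 hr.2.le le_rfl
      calc r * ‖∫ s in r..R, g s‖ ^ 2 ≤ r * ((R - r) / r * ‖g‖ ^ 2) :=
            mul_le_mul_of_nonneg_left h hr.1.le
        _ = (R - r) * ‖g‖ ^ 2 := by
            have := hr.1.ne'
            field_simp
        _ ≤ R * ‖g‖ ^ 2 := mul_le_mul_of_nonneg_right (by linarith [hr.1]) (sq_nonneg _))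
  refine ⟨S, ?_, hS⟩
  -- Finite rank approximation: the lower limit `r` is replaced by the right end of its cell in a
  -- mesh of width `δ = R / (N + 1)`. The right end stays away from `0`, and the error is an
  -- integral over a length at most `δ`.
  have happrox : ∀ N : ℕ, ∃ T : RadialL2 R →L[ℂ] RadialL2 R, IsCompactOperator T ∧
      ‖T - S‖ ≤ √(R * (R / (N + 1))) := by
    intro N
    set δ : ℝ := R / (N + 1) with hδ
    have hN : (0 : ℝ) < N + 1 := by positivity
    have hδ0 : 0 < δ := div_pos hR hN
    -- The reduction modulo `N + 1` in `Fin.ofNat` has no effect on `(0, R)`, where the floor is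
    -- below `N + 1`.
    let idx : ℝ → Fin (N + 1) := fun r => Fin.ofNat (N + 1) ⌊r / δ⌋₊
    have hidx : Measurable idx := by
      refine (Measurable.of_discrete (f := fun n : ℕ => Fin.ofNat (N + 1) n)).comp ?_
      exact Nat.measurable_floor.comp (measurable_id.div_const δ)
    have hcell : ∀ r ∈ Ioo 0 R, r ≤ ((idx r : ℕ) + 1) * δ ∧ ((idx r : ℕ) + 1) * δ ≤ r + δ := by
      intro r hr
      have h0 : 0 ≤ r / δ := (div_pos hr.1 hδ0).le
      have hlt : ⌊r / δ⌋₊ < N + 1 := by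
        rw [Nat.floor_lt h0, div_lt_iff₀ hδ0, hδ]
        push_cast
        rw [mul_div_cancel₀ _ hN.ne']
        exact hr.2
      have hval : ((idx r : ℕ) : ℝ) = (⌊r / δ⌋₊ : ℝ) := by
        simp only [idx, Fin.val_ofNat, Nat.mod_eq_of_lt hlt]
      rw [hval]
      have h1 := Nat.floor_le h0
      have h2 := Nat.lt_floor_add_one (r / δ)
      rw [le_div_iff₀ hδ0] at h1
      rw [div_lt_iff₀ hδ0] at h2
      exact ⟨h2.le, by linarith⟩
    have hpt : ∀ j : Fin (N + 1), ((j : ℕ) + 1 : ℝ) * δ ∈ Ioc 0 R := by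
      intro j
      refine ⟨by positivity, ?_⟩
      have hj : ((j : ℕ) + 1 : ℝ) ≤ N + 1 := by exact_mod_cast j.2
      calc ((j : ℕ) + 1 : ℝ) * δ ≤ (N + 1) * δ := mul_le_mul_of_nonneg_right hj hδ0.le
        _ = R := by rw [hδ, mul_div_cancel₀ _ hN.ne']
    have hstepm : ∀ c : Fin (N + 1) → ℂ, MemLp (fun r => c (idx r)) 2 (radialMeasure R) := by
      intro c
      refine MemLp.of_bound (Measurable.aestronglyMeasurable
        ((Measurable.of_discrete (f := c)).comp hidx)) (∑ j, ‖c j‖) (Eventually.of_forall fun r => ?_)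
      exact Finset.single_le_sum (f := fun j => ‖c j‖) (fun j _ => norm_nonneg _)
        (Finset.mem_univ (idx r))
    let A : (Fin (N + 1) → ℂ) →ₗ[ℂ] RadialL2 R :=
      { toFun := fun c => (hstepm c).toLp
        map_add' := fun c d => by
          rw [← MemLp.toLp_add]
          rfl
        map_smul' := fun c d => by
          rw [RingHom.id_apply, ← MemLp.toLp_const_smul]
          rfl }
    let P : RadialL2 R →L[ℂ] (Fin (N + 1) → ℂ) :=
      ContinuousLinearMap.pi fun j => -l (((j : ℕ) + 1 : ℝ) * δ)
    let T : RadialL2 R →L[ℂ] RadialL2 R := (LinearMap.toContinuousLinearMap A).comp P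
    have hT : ∀ g : RadialL2 R, T g =ᵐ[radialMeasure R]
        fun r => -∫ s in ((idx r : ℕ) + 1) * δ..R, g s := by
      intro g
      refine (MemLp.coeFn_toLp (hstepm (P g))).trans (Eventually.of_forall fun r => ?_)
      simp only [P, ContinuousLinearMap.pi_apply, _root_.neg_apply]
      rw [hl _ (hpt _)]
    refine ⟨T, ?_, ?_⟩
    · exact (isCompactOperator_of_locallyCompactSpace_rng (LinearMap.toContinuousLinearMap A)).comp_clm P
    · refine ContinuousLinearMap.opNorm_le_bound _ (Real.sqrt_nonneg _) fun g => ?_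
      refine norm_le_sqrt_mul hR.le ?_
      rw [_root_.sub_apply]
      filter_upwards [hT g, hS g, Lp.coeFn_sub (T g) (S g), ae_mem_radialMeasure R]
        with r h1 h2 h3 hr
      obtain ⟨hc1, hc2⟩ := hcell r hr
      obtain ⟨hp1, hp2⟩ := hpt (idx r)
      rw [h3, Pi.sub_apply, h1, h2]
      have hsplit : -∫ s in ((idx r : ℕ) + 1) * δ..R, g s = (∫ s in r..((idx r : ℕ) + 1) * δ, g s) +
          -∫ s in r..R, g s := by
        have hi := intervalIntegrable R g hr
        have hmem : ((idx r : ℕ) + 1 : ℝ) * δ ∈ uIcc r R := by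
          rw [uIcc_of_le hr.2.le]
          exact ⟨hc1, hp2⟩
        rw [← intervalIntegral.integral_add_adjacent_intervals
          (hi.mono_set (uIcc_subset_uIcc_left hmem)) (hi.mono_set (uIcc_subset_uIcc_right hmem))]
        ring
      rw [hsplit, add_sub_cancel_right]
      have h := sq_norm_intervalIntegral_le g hr.1 hc1 hp2
      calc r * ‖∫ s in r..((idx r : ℕ) + 1) * δ, g s‖ ^ 2
          ≤ r * ((((idx r : ℕ) + 1) * δ - r) / r * ‖g‖ ^ 2) := mul_le_mul_of_nonneg_left h hr.1.le
        _ = (((idx r : ℕ) + 1) * δ - r) * ‖g‖ ^ 2 := by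
            have := hr.1.ne'
            field_simp
        _ ≤ δ * ‖g‖ ^ 2 := mul_le_mul_of_nonneg_right (by linarith) (sq_nonneg _)
  choose T hTc hTS using happrox
  refine isCompactOperator_of_tendsto (l := atTop) (F := T) ?_ (Eventually.of_forall hTc)
  rw [tendsto_iff_norm_sub_tendsto_zero]
  refine squeeze_zero (fun _ => norm_nonneg _) hTS ?_
  have h1 : Tendsto (fun N : ℕ => R * (R / ((N : ℝ) + 1))) atTop (𝓝 (R * 0)) :=
    by
    have := (tendsto_const_div_atTop_nhds_zero_nat R).comp (tendsto_add_atTop_nat 1)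
    exact tendsto_const_nhds.mul (this.congr fun n => by simp)
  have h2 := (Real.continuous_sqrt.tendsto _).comp h1
  rw [mul_zero, Real.sqrt_zero] at h2
  exact h2

/-! ### The form domain as a Hilbert space, and the resolvent. -/

/-- Multiplied by `r`, the angular condition becomes `r w = (m - B r²/(2h)) S g`, with bounded
multipliers only. The admissible pairs `(g, w)` are therefore the kernel of a bounded operator, and
`u = S g` is recovered from the pair. -/
theorem exists_formDomain (hR : 0 < R) (B h : ℝ) (m : ℤ) :
    ∃ (S : RadialL2 R →L[ℂ] RadialL2 R) (V : Submodule ℂ (WithLp 2 (RadialL2 R × RadialL2 R))),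
      IsCompactOperator S ∧ IsClosed (V : Set (WithLp 2 (RadialL2 R × RadialL2 R))) ∧
      ∀ u g w : RadialL2 R,
        IsMagneticGradient B R h m u g w ↔ u = S g ∧ WithLp.toLp 2 (g, w) ∈ V := by
  obtain ⟨S, hSc, hS⟩ := exists_primitive_clm hR
  obtain ⟨M, hM⟩ := exists_mul_clm R continuous_id
  obtain ⟨N, hN⟩ := exists_mul_clm R (ψ := fun r => (m : ℝ) - B * r ^ 2 / (2 * h)) (by fun_prop)
  let F : WithLp 2 (RadialL2 R × RadialL2 R) →L[ℂ] RadialL2 R :=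
    M.comp (WithLp.sndL 2 ℂ _ _) - (N.comp S).comp (WithLp.fstL 2 ℂ _ _)
  refine ⟨S, LinearMap.ker (F : _ →ₗ[ℂ] RadialL2 R), hSc, F.isClosed_ker, fun u g w => ?_⟩
  have hF : F (WithLp.toLp 2 (g, w)) = M w - N (S g) := rfl
  rw [LinearMap.mem_ker, ContinuousLinearMap.coe_coe, hF, sub_eq_zero]
  have hiff : u = S g → ((M w = N (S g)) ↔
      ∀ᵐ r ∂radialMeasure R, w r = (((m : ℝ) / r - B * r / (2 * h) : ℝ) : ℂ) * u r) := by
    rintro rfl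
    have hpt : ∀ r ∈ Ioo 0 R, ∀ x y : ℂ, (r : ℂ) * x = (((m : ℝ) - B * r ^ 2 / (2 * h) : ℝ) : ℂ) * y ↔
        x = (((m : ℝ) / r - B * r / (2 * h) : ℝ) : ℂ) * y := by
      intro r hr x y
      have hr0 : (r : ℂ) ≠ 0 := by exact_mod_cast hr.1.ne'
      have h1 : (((m : ℝ) - B * r ^ 2 / (2 * h) : ℝ) : ℂ) =
          r * (((m : ℝ) / r - B * r / (2 * h) : ℝ) : ℂ) := by
        have hr1 : r ≠ 0 := hr.1.ne'
        rw [← Complex.ofReal_mul]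
        congr 1
        field_simp
      rw [h1, mul_assoc, mul_right_inj' hr0]
    rw [Lp.ext_iff]
    refine ⟨fun heq => ?_, fun heq => ?_⟩
    · filter_upwards [heq, hM w, hN (S g), ae_mem_radialMeasure R] with r h1 h2 h3 hr
      rw [h2, h3] at h1
      exact (hpt r hr _ _).1 h1
    · filter_upwards [heq, hM w, hN (S g), ae_mem_radialMeasure R] with r h1 h2 h3 hr
      rw [h2, h3]
      exact (hpt r hr _ _).2 h1
  constructor
  · rintro ⟨h1, h2⟩
    have hu : u = S g := by
      rw [Lp.ext_iff]
      filter_upwards [h1, hS g] with r a b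
      rw [a, b]
    exact ⟨hu, (hiff hu).2 h2⟩
  · rintro ⟨hu, h2⟩
    refine ⟨?_, (hiff hu).1 h2⟩
    rw [hu]
    exact hS g

/-- The nonnegative compact self-adjoint operator `J J†` of a compact embedding `J`. -/
theorem exists_compact_of_embedding {V H : Type*} [NormedAddCommGroup V] [InnerProductSpace ℂ V]
    [CompleteSpace V] [NormedAddCommGroup H] [InnerProductSpace ℂ H] [CompleteSpace H]
    (J : V →L[ℂ] H) (hJ : IsCompactOperator J) :
    ∃ K : H →L[ℂ] H, IsCompactOperator K ∧ K.IsSymmetric ∧ (∀ x, 0 ≤ (⟪x, K x⟫_ℂ).re) ∧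
      (∀ x, K x = 0 → ∀ y, ⟪J y, x⟫_ℂ = 0) ∧
      (∀ c : ℂ, c ≠ 0 → ∀ u f, c • u = K f ↔ ∃ x, u = J x ∧ ∀ y, c * ⟪y, x⟫_ℂ = ⟪J y, f⟫_ℂ) ∧
      ∀ x, ‖J x‖ ^ 2 ≤ ‖K‖ * ‖x‖ ^ 2 := by
  let Ja : H →L[ℂ] V := ContinuousLinearMap.adjoint J
  have hadj : ∀ (y : V) (f : H), ⟪y, Ja f⟫_ℂ = ⟪J y, f⟫_ℂ :=
    fun y f => ContinuousLinearMap.adjoint_inner_right J y f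
  have hKK : ∀ x, ⟪x, J (Ja x)⟫_ℂ = ⟪Ja x, Ja x⟫_ℂ := by
    intro x
    rw [← inner_conj_symm, ← hadj, inner_conj_symm]
  have hpos : ∀ x, (⟪x, J (Ja x)⟫_ℂ).re = ‖Ja x‖ ^ 2 := by
    intro x
    rw [hKK, inner_self_eq_norm_sq_to_K]
    norm_cast
  refine ⟨J.comp Ja, hJ.comp_clm Ja, fun x y => ?_, fun x => ?_, fun x hx y => ?_,
    fun c hc u f => ?_, fun x => ?_⟩
  · simp only [ContinuousLinearMap.coe_coe, ContinuousLinearMap.comp_apply]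
    rw [← hadj, ← inner_conj_symm x, ← hadj, inner_conj_symm]
  · rw [ContinuousLinearMap.comp_apply, hpos]
    exact sq_nonneg _
  · rw [ContinuousLinearMap.comp_apply] at hx
    have h1 := hpos x
    rw [hx, inner_zero_right, Complex.zero_re] at h1
    have h2 : Ja x = 0 := norm_eq_zero.1 (pow_eq_zero_iff two_ne_zero |>.1 h1.symm)
    rw [← hadj, h2, inner_zero_right]
  · rw [ContinuousLinearMap.comp_apply]
    constructor
    · intro h1
      refine ⟨c⁻¹ • Ja f, ?_, fun y => ?_⟩
      · rw [map_smul, ← h1, smul_smul, inv_mul_cancel₀ hc, one_smul]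
      · rw [← inner_smul_right, smul_smul, mul_inv_cancel₀ hc, one_smul, hadj]
    · rintro ⟨x, rfl, hx⟩
      have h1 : c • x = Ja f := by
        refine ext_inner_left ℂ fun y => ?_
        rw [inner_smul_right, hx, hadj]
      rw [← h1, map_smul]
  · have hJn : ‖J.comp Ja‖ = ‖J‖ ^ 2 := by
      have h2 := ContinuousLinearMap.norm_adjoint_comp_self Ja
      rw [show ContinuousLinearMap.adjoint Ja = J from ContinuousLinearMap.adjoint_adjoint J] at h2
      rw [h2, sq, show ‖Ja‖ = ‖J‖ from LinearIsometryEquiv.norm_map _ J]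
    rw [hJn, ← mul_pow]
    exact pow_le_pow_left₀ (norm_nonneg _) (J.le_opNorm x) 2

/-- The inverse of `h⁻² (𝒫_m(h) + h B)` is a compact nonnegative self-adjoint operator. -/
theorem exists_resolvent (hR : 0 < R) (B : ℝ) {h : ℝ} (hh : 0 < h) (m : ℤ) :
    ∃ K : RadialL2 R →L[ℂ] RadialL2 R, IsCompactOperator K ∧ K.IsSymmetric ∧
      (∀ x, 0 ≤ (⟪x, K x⟫_ℂ).re) ∧ (∀ x, K x = 0 → x = 0) ∧
      (∀ u f, (u, f) ∈ (pauliOperator B R h m).graph ↔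
        ((h ^ 2 : ℝ) : ℂ) • u = K (f + ((h * B : ℝ) : ℂ) • u)) ∧
      ∀ u g w : RadialL2 R, IsMagneticGradient B R h m u g w →
        ‖u‖ ^ 2 ≤ ‖K‖ * (‖g‖ ^ 2 + ‖w‖ ^ 2) := by
  obtain ⟨S, V, hSc, hV, hdom⟩ := exists_formDomain hR B h m
  have : CompleteSpace V := hV.completeSpace_coe
  let P : V →L[ℂ] RadialL2 R := (WithLp.fstL 2 ℂ _ _).comp V.subtypeL
  -- The form of `𝒫_m + hB` is `h²` times the inner product of `V`, so `J J†` inverts `h⁻²(𝒫_m +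
  -- hB)`.
  let J : V →L[ℂ] RadialL2 R := S.comp P
  have hin : ∀ x y : V, ⟪y, x⟫_ℂ =
      ⟪(y : WithLp 2 (RadialL2 R × RadialL2 R)).fst, (x : WithLp 2 (RadialL2 R × RadialL2 R)).fst⟫_ℂ +
      ⟪(y : WithLp 2 (RadialL2 R × RadialL2 R)).snd, (x : WithLp 2 (RadialL2 R × RadialL2 R)).snd⟫_ℂ :=
    fun x y => rfl
  have hJdom : ∀ y : V, IsMagneticGradient B R h m (J y)
      (y : WithLp 2 (RadialL2 R × RadialL2 R)).fst (y : WithLp 2 (RadialL2 R × RadialL2 R)).snd :=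
    fun y => (hdom _ _ _).2 ⟨rfl, y.2⟩
  obtain ⟨K, h1, h2, h3, h4, h5, h6⟩ := exists_compact_of_embedding J (hSc.comp_clm P)
  have hh2 : ((h ^ 2 : ℝ) : ℂ) ≠ 0 := by exact_mod_cast (pow_pos hh 2).ne'
  refine ⟨K, h1, h2, h3, fun x hx => ?_, fun u f => ?_, fun u g w huv => ?_⟩
  · refine eq_zero_of_inner_eq_zero B R h m x fun v k z hv => ?_
    obtain ⟨rfl, hmem⟩ := (hdom v k z).1 hv
    exact h4 x hx ⟨_, hmem⟩
  · rw [graph_pauliOperator, h5 _ hh2]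
    have hcomm : ∀ a b c d : ℂ, (h : ℂ) ^ 2 * (a + b) - (h : ℂ) * (B : ℂ) * c = d ↔
        ((h ^ 2 : ℝ) : ℂ) * (a + b) = d + ((h * B : ℝ) : ℂ) * c := by
      intro a b c d
      push_cast
      exact sub_eq_iff_eq_add
    constructor
    · rintro ⟨g, w, h7, h8⟩
      obtain ⟨hu, hmem⟩ := (hdom u g w).1 h7
      refine ⟨⟨_, hmem⟩, hu, fun y => ?_⟩
      rw [inner_add_right, inner_smul_right]
      exact (hcomm _ _ _ _).1 (h8 _ _ _ (hJdom y))
    · rintro ⟨x, rfl, h8⟩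
      refine ⟨_, _, hJdom x, fun v k z hv => ?_⟩
      obtain ⟨rfl, hmem⟩ := (hdom v k z).1 hv
      have h9 := h8 ⟨_, hmem⟩
      rw [inner_add_right, inner_smul_right] at h9
      exact (hcomm _ _ _ _).2 h9
  · obtain ⟨rfl, hmem⟩ := (hdom u g w).1 huv
    have h7 := h6 ⟨_, hmem⟩
    have hx : ‖(⟨_, hmem⟩ : V)‖ ^ 2 = ‖g‖ ^ 2 + ‖w‖ ^ 2 := WithLp.prod_norm_sq_eq_of_L2 _
    rw [hx] at h7
    exact h7

theorem exists_isEigenvalueSequence (hR : 0 < R) (B : ℝ) {h : ℝ} (hh : 0 < h) (m : ℤ) :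
    ∃ lam : ℕ → ℝ, IsEigenvalueSequence (pauliOperator B R h m) lam := by
  obtain ⟨K, h1, h2, h3, h4, h5, -⟩ := exists_resolvent hR B hh m
  exact exists_isEigenvalueSequence_of_graph h1 h2 h3 h4 (not_finiteDimensional_radialL2 hR)
    (pow_pos hh 2) h5

/-- The variational upper bound for the lowest eigenvalue. -/
theorem IsEigenvalueSequence.mul_norm_sq_le (hR : 0 < R) {B h : ℝ} (hh : 0 < h) {m : ℤ}
    {lam : ℕ → ℝ} (hlam : IsEigenvalueSequence (pauliOperator B R h m) lam) {u g w : RadialL2 R}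
    (hu : IsMagneticGradient B R h m u g w) :
    lam 0 * ‖u‖ ^ 2 ≤ h ^ 2 * (‖g‖ ^ 2 + ‖w‖ ^ 2) - h * B * ‖u‖ ^ 2 := by
  obtain ⟨K, h1, h2, h3, -, h5, h6⟩ := exists_resolvent hR B hh m
  obtain ⟨h7, h8⟩ := hlam.norm_le_of_graph h1 h2 h3 (pow_pos hh 2) h5
  have h9 := (h6 u g w hu).trans (mul_le_mul_of_nonneg_right h8 (by positivity))
  rw [div_mul_eq_mul_div, le_div_iff₀ h7] at h9
  linarith

/-- The energy form on pairs in the graph. -/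
theorem exists_energy_of_mem_graph {B h : ℝ} {m : ℤ} {u f : RadialL2 R}
    (hu : (u, f) ∈ (pauliOperator B R h m).graph) :
    ∃ g w, IsMagneticGradient B R h m u g w ∧
      h ^ 2 * (‖g‖ ^ 2 + ‖w‖ ^ 2) - h * B * ‖u‖ ^ 2 = (⟪u, f⟫_ℂ).re := by
  rw [graph_pauliOperator] at hu
  obtain ⟨g, w, h1, h2⟩ := hu
  refine ⟨g, w, h1, ?_⟩
  have h3 := h2 u g w h1
  simp only at h3
  rw [← h3, inner_self_eq_norm_sq_to_K, inner_self_eq_norm_sq_to_K, inner_self_eq_norm_sq_to_K]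
  rw [← Complex.ofReal_re (h ^ 2 * (‖g‖ ^ 2 + ‖w‖ ^ 2) - h * B * ‖u‖ ^ 2)]
  push_cast
  rfl

theorem pauliOperator_symmetric {B h : ℝ} {m : ℤ} (u f v k : RadialL2 R)
    (hu : (u, f) ∈ (pauliOperator B R h m).graph) (hv : (v, k) ∈ (pauliOperator B R h m).graph) :
    ⟪f, v⟫_ℂ = ⟪u, k⟫_ℂ := by
  rw [graph_pauliOperator] at hu hv
  obtain ⟨g, w, h1, h2⟩ := hu
  obtain ⟨g', w', h1', h2'⟩ := hv
  have h3 := h2 v g' w' h1'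
  have h4 := h2' u g w h1
  simp only at h3 h4
  rw [← inner_conj_symm, ← h3, ← h4]
  simp only [map_sub, map_mul, map_add, map_pow, inner_conj_symm, Complex.conj_ofReal]

/-! ### Integration by parts with a singular end point. -/

section IntegrationByParts

theorem integral_mul_add_mul_of_primitive_real {f g F G : ℝ → ℝ} {a b : ℝ} (hab : a ≤ b)
    (hf : IntervalIntegrable f volume a b) (hg : IntervalIntegrable g volume a b)
    (hF : ∀ x ∈ Icc a b, F x = F b - ∫ s in x..b, f s)
    (hG : ∀ x ∈ Icc a b, G x = G b - ∫ s in x..b, g s) :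
    ∫ x in a..b, (f x * G x + F x * g x) = F b * G b - F a * G a := by
  have key : ∀ f F : ℝ → ℝ, IntervalIntegrable f volume a b →
      (∀ x ∈ Icc a b, F x = F b - ∫ s in x..b, f s) → ∃ F' : ℝ → ℝ,
        AbsolutelyContinuousOnInterval F' a b ∧ (∀ x ∈ Icc a b, F' x = F x) ∧
        ∀ᵐ x, x ∈ Icc a b → deriv F' x = f x := by
    intro f F hf hF
    -- `F` is prescribed on `[a, b]` only; this absolutely continuous function is defined everywhere
    -- and agrees with it there.
    refine ⟨fun x => F b + ∫ s in b..x, f s, ?_, fun x hx => ?_, ?_⟩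
    · have h1 : AbsolutelyContinuousOnInterval (fun _ : ℝ => F b) a b :=
        (LipschitzWith.const (F b)).lipschitzOnWith.absolutelyContinuousOnInterval
      exact h1.add (hf.absolutelyContinuousOnInterval_intervalIntegral right_mem_uIcc)
    · rw [hF x hx, intervalIntegral.integral_symm]
      ring
    · filter_upwards [hf.ae_hasDerivAt_integral] with x hx hx'
      exact ((hx (by rwa [uIcc_of_le hab]) b right_mem_uIcc).const_add (F b)).deriv
  obtain ⟨F', h1, h2, h3⟩ := key f F hf hF
  obtain ⟨G', k1, k2, k3⟩ := key g G hg hG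
  have h := h1.integral_deriv_mul_eq_sub k1
  rw [h2 b ⟨hab, le_rfl⟩, h2 a ⟨le_rfl, hab⟩, k2 b ⟨hab, le_rfl⟩, k2 a ⟨le_rfl, hab⟩] at h
  rw [← h]
  refine intervalIntegral.integral_congr_ae ?_
  filter_upwards [h3, k3] with x hx kx hx'
  rw [uIoc_of_le hab] at hx'
  have hx'' := Ioc_subset_Icc_self hx'
  rw [hx hx'', kx hx'', h2 x hx'', k2 x hx'']

theorem continuousOn_of_primitive {f F : ℝ → ℂ} {a b : ℝ} (hab : a ≤ b)
    (hf : IntervalIntegrable f volume a b)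
    (hF : ∀ x ∈ Icc a b, F x = F b - ∫ s in x..b, f s) : ContinuousOn F (Icc a b) := by
  have := intervalIntegral.continuousOn_primitive_interval_left (μ := volume) (f := f) (a := a)
    (b := b) ((intervalIntegrable_iff').1 hf)
  rw [uIcc_of_le hab] at this
  exact (continuousOn_const.sub this).congr hF

/-- Integration by parts for complex valued primitives of integrable functions. -/
theorem integral_mul_add_mul_of_primitive {f g F G : ℝ → ℂ} {a b : ℝ} (hab : a ≤ b)
    (hf : IntervalIntegrable f volume a b) (hg : IntervalIntegrable g volume a b)
    (hF : ∀ x ∈ Icc a b, F x = F b - ∫ s in x..b, f s)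
    (hG : ∀ x ∈ Icc a b, G x = G b - ∫ s in x..b, g s) :
    IntervalIntegrable (fun x => f x * G x + F x * g x) volume a b ∧
    ∫ x in a..b, (f x * G x + F x * g x) = F b * G b - F a * G a := by
  have cF := continuousOn_of_primitive hab hf hF
  have cG := continuousOn_of_primitive hab hg hG
  have hint : IntervalIntegrable (fun x => f x * G x + F x * g x) volume a b := by
    refine (hf.mul_continuousOn ?_).add (hg.continuousOn_mul ?_)
    · rwa [uIcc_of_le hab]
    · rwa [uIcc_of_le hab]
  refine ⟨hint, ?_⟩
  have sub : ∀ x ∈ Icc a b, ∀ f : ℝ → ℂ, IntervalIntegrable f volume a b →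
      IntervalIntegrable f volume x b := fun x hx f hf =>
    hf.mono_set (uIcc_subset_uIcc_right (by rwa [uIcc_of_le hab]))
  have re_int : ∀ (f : ℝ → ℂ) (x : ℝ), IntervalIntegrable f volume x b →
      ∫ s in x..b, (f s).re = (∫ s in x..b, f s).re := fun f x hf =>
    Complex.reCLM.intervalIntegral_comp_comm hf
  have im_int : ∀ (f : ℝ → ℂ) (x : ℝ), IntervalIntegrable f volume x b →
      ∫ s in x..b, (f s).im = (∫ s in x..b, f s).im := fun f x hf =>
    Complex.imCLM.intervalIntegral_comp_comm hf
  have ire : ∀ f : ℝ → ℂ, IntervalIntegrable f volume a b →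
      IntervalIntegrable (fun s => (f s).re) volume a b :=
    fun f hf => ⟨hf.1.re, hf.2.re⟩
  have iim : ∀ f : ℝ → ℂ, IntervalIntegrable f volume a b →
      IntervalIntegrable (fun s => (f s).im) volume a b :=
    fun f hf => ⟨hf.1.im, hf.2.im⟩
  have pre : ∀ f F : ℝ → ℂ, IntervalIntegrable f volume a b →
      (∀ x ∈ Icc a b, F x = F b - ∫ s in x..b, f s) →
      ∀ x ∈ Icc a b, (F x).re = (F b).re - ∫ s in x..b, (f s).re := by
    intro f F hf hF x hx
    rw [re_int f x (sub x hx f hf), hF x hx, Complex.sub_re]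
  have pim : ∀ f F : ℝ → ℂ, IntervalIntegrable f volume a b →
      (∀ x ∈ Icc a b, F x = F b - ∫ s in x..b, f s) →
      ∀ x ∈ Icc a b, (F x).im = (F b).im - ∫ s in x..b, (f s).im := by
    intro f F hf hF x hx
    rw [im_int f x (sub x hx f hf), hF x hx, Complex.sub_im]
  have crr := integral_mul_add_mul_of_primitive_real hab (ire f hf) (ire g hg) (pre f F hf hF)
    (pre g G hg hG)
  have cri := integral_mul_add_mul_of_primitive_real hab (ire f hf) (iim g hg) (pre f F hf hF)
    (pim g G hg hG)
  have cir := integral_mul_add_mul_of_primitive_real hab (iim f hf) (ire g hg) (pim f F hf hF)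
    (pre g G hg hG)
  have cii := integral_mul_add_mul_of_primitive_real hab (iim f hf) (iim g hg) (pim f F hf hF)
    (pim g G hg hG)
  have prodint : ∀ φ γ Φ Γ : ℝ → ℝ, IntervalIntegrable φ volume a b →
      IntervalIntegrable γ volume a b → ContinuousOn Φ (Icc a b) → ContinuousOn Γ (Icc a b) →
      IntervalIntegrable (fun x => φ x * Γ x + Φ x * γ x) volume a b := by
    intro φ γ Φ Γ h1 h2 h3 h4
    refine (h1.mul_continuousOn ?_).add (h2.continuousOn_mul ?_)
    · rwa [uIcc_of_le hab]
    · rwa [uIcc_of_le hab]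
  have cre : ∀ F : ℝ → ℂ, ContinuousOn F (Icc a b) → ContinuousOn (fun s => (F s).re) (Icc a b) :=
    fun F hF => Complex.continuous_re.comp_continuousOn hF
  have cim : ∀ F : ℝ → ℂ, ContinuousOn F (Icc a b) → ContinuousOn (fun s => (F s).im) (Icc a b) :=
    fun F hF => Complex.continuous_im.comp_continuousOn hF
  refine Complex.ext ?_ ?_
  · rw [← re_int _ _ hint]
    have e : ∀ x, (f x * G x + F x * g x).re = ((f x).re * (G x).re + (F x).re * (g x).re) -
        ((f x).im * (G x).im + (F x).im * (g x).im) := by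
      intro x
      simp only [Complex.add_re, Complex.mul_re]
      ring
    simp_rw [e]
    rw [intervalIntegral.integral_sub, crr, cii]
    · simp only [Complex.sub_re, Complex.mul_re]
      ring
    · exact prodint _ _ _ _ (ire f hf) (ire g hg) (cre F cF) (cre G cG)
    · exact prodint _ _ _ _ (iim f hf) (iim g hg) (cim F cF) (cim G cG)
  · rw [← im_int _ _ hint]
    have e : ∀ x, (f x * G x + F x * g x).im = ((f x).re * (G x).im + (F x).re * (g x).im) +
        ((f x).im * (G x).re + (F x).im * (g x).re) := by
      intro x
      simp only [Complex.add_im, Complex.mul_im]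
      ring
    simp_rw [e]
    rw [intervalIntegral.integral_add, cri, cir]
    · simp only [Complex.sub_im, Complex.mul_im]
      ring
    · exact prodint _ _ _ _ (ire f hf) (iim g hg) (cre F cF) (cim G cG)
    · exact prodint _ _ _ _ (iim f hf) (ire g hg) (cim F cF) (cre G cG)

theorem primitive_mul {f g F G : ℝ → ℂ} {a b : ℝ}
    (hf : IntervalIntegrable f volume a b) (hg : IntervalIntegrable g volume a b)
    (hF : ∀ x ∈ Icc a b, F x = F b - ∫ s in x..b, f s)
    (hG : ∀ x ∈ Icc a b, G x = G b - ∫ s in x..b, g s) :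
    ∀ x ∈ Icc a b, F x * G x = F b * G b - ∫ s in x..b, (f s * G s + F s * g s) := by
  intro x hx
  have hab := hx.1.trans hx.2
  have hs : Icc x b ⊆ Icc a b := Icc_subset_Icc_left hx.1
  have hu : uIcc x b ⊆ uIcc a b := uIcc_subset_uIcc_right (by rwa [uIcc_of_le hab])
  rw [(integral_mul_add_mul_of_primitive hx.2 (hf.mono_set hu) (hg.mono_set hu)
    (fun y hy => hF y (hs hy)) (fun y hy => hG y (hs hy))).2]
  ring

/-- A nonzero limit would bound `‖Ψ r / r‖` below by a multiple of `1/r` near `0`, which is not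
integrable. This removes boundary terms at the origin without any pointwise information there. -/
theorem eq_zero_of_tendsto_of_integrableOn_div {R : ℝ} (hR : 0 < R) {Ψ : ℝ → ℂ} {L : ℂ}
    (hlim : Tendsto Ψ (𝓝[>] 0) (𝓝 L)) (hint : IntegrableOn (fun r : ℝ => Ψ r / r) (Ioo 0 R)) :
    L = 0 := by
  by_contra hL
  have hL' : 0 < ‖L‖ / 2 := by positivity
  have h1 : ∀ᶠ r in 𝓝[>] (0 : ℝ), ‖L‖ / 2 < ‖Ψ r‖ :=
    hlim.norm.eventually (lt_mem_nhds (by linarith))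
  rw [eventually_nhdsWithin_iff, Metric.eventually_nhds_iff] at h1
  obtain ⟨ε, hε, h2⟩ := h1
  set δ := min ε R with hδ
  have hδ0 : 0 < δ := lt_min hε hR
  have h3 : IntegrableOn (fun r : ℝ => r⁻¹) (Ioo 0 δ) := by
    have h4 : IntegrableOn (fun r : ℝ => (‖L‖ / 2)⁻¹ * ‖Ψ r / r‖) (Ioo 0 δ) :=
      ((hint.mono_set (Ioo_subset_Ioo_right (min_le_right _ _))).norm).const_mul _
    refine Integrable.mono' h4 measurable_inv.aestronglyMeasurable ?_
    filter_upwards [ae_restrict_mem measurableSet_Ioo] with r hr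
    have h5 : ‖L‖ / 2 < ‖Ψ r‖ := h2 (by
      rw [Real.dist_eq, sub_zero, abs_of_pos hr.1]
      exact hr.2.trans_le (min_le_left _ _)) hr.1
    rw [norm_div, Complex.norm_real, norm_inv, Real.norm_of_nonneg hr.1.le, ← div_eq_inv_mul,
      div_right_comm, inv_eq_one_div]
    refine div_le_div_of_nonneg_right ?_ hr.1.le
    rw [le_div_iff₀ hL', one_mul]
    exact h5.le
  have h6 : IntervalIntegrable (fun r : ℝ => r⁻¹) volume 0 δ :=
    (intervalIntegrable_iff_integrableOn_Ioo_of_le hδ0.le).2 h3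
  rw [intervalIntegrable_inv_iff] at h6
  rcases h6 with h7 | h7
  · exact hδ0.ne h7
  · exact h7 left_mem_uIcc

/-- Integration by parts on `(0, R)` for two functions vanishing at `R`; the boundary term at the
origin vanishes as soon as it is integrable against `dr / r`. -/
theorem integral_byParts_eq_zero (hR : 0 < R) (g k : RadialL2 R) {q q' : ℝ → ℝ}
    (hq : ∀ r, HasDerivAt q (q' r) r) (hq' : Continuous q') {U V : ℝ → ℂ}
    (hU : ∀ r ∈ Ioc 0 R, U r = -∫ s in r..R, g s) (hV : ∀ r ∈ Ioc 0 R, V r = -∫ s in r..R, k s)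
    (h0 : IntegrableOn (fun r : ℝ => (q r : ℂ) * (U r * starRingEnd ℂ (V r)) / r) (Ioo 0 R))
    {I : ℝ → ℂ} (hI : ∀ r, I r = (q r : ℂ) * (g r * starRingEnd ℂ (V r) +
      U r * starRingEnd ℂ (k r)) + (q' r : ℂ) * (U r * starRingEnd ℂ (V r)))
    (h1 : IntegrableOn I (Ioo 0 R)) : ∫ r in Ioo 0 R, I r = 0 := by
  have hUR : U R = 0 := by rw [hU R ⟨hR, le_rfl⟩, intervalIntegral.integral_same, neg_zero]
  have hVR : V R = 0 := by rw [hV R ⟨hR, le_rfl⟩, intervalIntegral.integral_same, neg_zero]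
  have hparts : ∀ ε ∈ Ioo 0 R, ∫ r in ε..R, I r = -((q ε : ℂ) * (U ε * starRingEnd ℂ (V ε))) := by
    intro ε hε
    have hg := intervalIntegrable R g hε
    have hk : IntervalIntegrable (fun s => starRingEnd ℂ (k s)) volume ε R := by
      have := intervalIntegrable R k hε
      rw [intervalIntegrable_iff] at this ⊢
      exact (Complex.conjCLE.toContinuousLinearMap).integrable_comp this
    have hsub : Icc ε R ⊆ Ioc 0 R := fun x hx => ⟨hε.1.trans_le hx.1, hx.2⟩
    have pU : ∀ x ∈ Icc ε R, U x = U R - ∫ s in x..R, g s := fun x hx => by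
      rw [hUR, hU x (hsub hx), zero_sub]
    have pV : ∀ x ∈ Icc ε R, starRingEnd ℂ (V x) = starRingEnd ℂ (V R) -
        ∫ s in x..R, starRingEnd ℂ (k s) := fun x hx => by
      have := (Complex.conjCLE.toContinuousLinearMap).intervalIntegral_comp_comm
        (f := k) (a := x) (b := R) (μ := volume)
        ((intervalIntegrable R k hε).mono_set (uIcc_subset_uIcc_right (by
          rw [uIcc_of_le hε.2.le]; exact hx)))
      have h3 : ∫ s in x..R, starRingEnd ℂ (k s) = starRingEnd ℂ (∫ s in x..R, k s) := this
      rw [h3, hV x (hsub hx), hVR, map_zero, map_neg, zero_sub]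
    have hq'i : IntervalIntegrable (fun r => (q' r : ℂ)) volume ε R :=
      (Complex.continuous_ofReal.comp hq').intervalIntegrable _ _
    have pq : ∀ x ∈ Icc ε R, (q x : ℂ) = (q R : ℂ) - ∫ s in x..R, (q' s : ℂ) := fun x hx => by
      rw [intervalIntegral.integral_ofReal, intervalIntegral.integral_eq_sub_of_hasDerivAt
        (fun y _ => hq y) (hq'.intervalIntegrable _ _)]
      push_cast
      ring
    have hqU := primitive_mul hq'i hg pq pU
    have hqUi := (integral_mul_add_mul_of_primitive hε.2.le hq'i hg pq pU).1
    have h := (integral_mul_add_mul_of_primitive hε.2.le hqUi hk hqU pV).2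
    rw [hUR, mul_zero, zero_mul, zero_sub] at h
    rw [← mul_assoc, ← h]
    refine intervalIntegral.integral_congr fun x _ => ?_
    rw [hI]
    ring
  have hIoc : IntervalIntegrable I volume 0 R :=
    (intervalIntegrable_iff_integrableOn_Ioo_of_le hR.le).2 h1
  -- Integrability of `I` makes the boundary term at `ε` converge as `ε → 0`; `h0` then forces its
  -- limit to be zero.
  have hcont := intervalIntegral.continuousOn_primitive_interval_left (μ := volume)
    ((intervalIntegrable_iff').1 hIoc)
  have hlim := (hcont 0 left_mem_uIcc).mono_of_mem_nhdsWithin (s := Ioi 0) (by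
    rw [uIcc_of_le hR.le]
    refine mem_nhdsWithin.2 ⟨Iio R, isOpen_Iio, hR, fun x hx => ⟨le_of_lt hx.2, le_of_lt hx.1⟩⟩)
  have hlim2 : Tendsto (fun ε => (q ε : ℂ) * (U ε * starRingEnd ℂ (V ε))) (𝓝[>] 0)
      (𝓝 (-∫ r in (0 : ℝ)..R, I r)) := by
    refine hlim.neg.congr' ?_
    filter_upwards [Ioo_mem_nhdsGT hR] with ε hε
    rw [Pi.neg_apply, hparts ε hε, neg_neg]
  have h2 := eq_zero_of_tendsto_of_integrableOn_div hR hlim2 h0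
  rw [neg_eq_zero, intervalIntegral.integral_of_le hR.le, integral_Ioc_eq_integral_Ioo] at h2
  exact h2

end IntegrationByParts

/-! ### Factorization of the form and the commutation relation. -/

theorem integrableOn_mul_conj (f g : RadialL2 R) :
    IntegrableOn (fun r : ℝ => (r : ℂ) * (starRingEnd ℂ (f r) * g r)) (Ioo 0 R) := by
  have h := L2.integrable_inner (𝕜 := ℂ) f g
  rw [integrable_radialMeasure_iff] at h
  refine h.congr (Eventually.of_forall fun r => ?_)
  simp [mul_comm]

theorem IsMagneticGradient.ae_eq_primitive {B h : ℝ} {m : ℤ} {u g w : RadialL2 R}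
    (hu : IsMagneticGradient B R h m u g w) :
    ∀ᵐ r ∂(volume.restrict (Ioo 0 R)), u r = -∫ s in r..R, g s := ae_Ioo_iff.1 hu.radial

/-- `m u / r` is square integrable for `u` in the form domain. -/
theorem IsMagneticGradient.exists_div {B h : ℝ} {m : ℤ} {u g w : RadialL2 R}
    (hu : IsMagneticGradient B R h m u g w) :
    ∃ z : RadialL2 R, ∀ᵐ (r : ℝ) ∂radialMeasure R, (r : ℂ) * z r = m * u r := by
  obtain ⟨M, hM⟩ := exists_mul_clm R (ψ := fun r => B * r / (2 * h)) (by fun_prop)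
  refine ⟨w + M u, ?_⟩
  filter_upwards [hM u, hu.angular, Lp.coeFn_add w (M u), ae_mem_radialMeasure R] with r h1 h2 h3 hr
  have hr0 : (r : ℂ) ≠ 0 := by exact_mod_cast hr.1.ne'
  rw [h3, Pi.add_apply, h1, h2]
  push_cast
  field_simp
  ring

/-- With `q = m - B r²/(2h)` one has `r w = q u` and `q' = -B r/h`, so the integral of `(q |u|²)'`
is `2 Re⟪g, w⟫ - (B/h) ‖u‖²`; it vanishes because both boundary terms do. -/
theorem IsMagneticGradient.two_mul_re_inner (hR : 0 < R) {B h : ℝ} (hh : h ≠ 0) {m : ℤ}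
    {u g w : RadialL2 R} (hu : IsMagneticGradient B R h m u g w) :
    2 * (⟪g, w⟫_ℂ).re = B / h * ‖u‖ ^ 2 := by
  have hhC : (h : ℂ) ≠ 0 := by exact_mod_cast hh
  have hprim := hu.ae_eq_primitive
  have hang := ae_Ioo_iff.1 hu.angular
  have haeI : ∀ᵐ r ∂(volume.restrict (Ioo 0 R)),
      (((m : ℝ) - B * r ^ 2 / (2 * h) : ℝ) : ℂ) *
        (g r * starRingEnd ℂ (-∫ s in r..R, g s) + (-∫ s in r..R, g s) * starRingEnd ℂ (g r)) +
        ((-(B * r / h) : ℝ) : ℂ) * ((-∫ s in r..R, g s) * starRingEnd ℂ (-∫ s in r..R, g s)) =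
      (r : ℂ) * (starRingEnd ℂ (w r) * g r) + (r : ℂ) * (starRingEnd ℂ (g r) * w r) -
        (B / h : ℂ) * ((r : ℂ) * (starRingEnd ℂ (u r) * u r)) := by
    filter_upwards [hprim, hang, ae_restrict_mem measurableSet_Ioo] with r h1 h2 hr
    have hr0 : (r : ℂ) ≠ 0 := by exact_mod_cast hr.1.ne'
    rw [h2, ← h1]
    simp only [map_mul, Complex.conj_ofReal]
    push_cast
    field_simp
    ring
  have hint : IntegrableOn (fun r : ℝ => (r : ℂ) * (starRingEnd ℂ (w r) * g r) +
      (r : ℂ) * (starRingEnd ℂ (g r) * w r) -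
        (B / h : ℂ) * ((r : ℂ) * (starRingEnd ℂ (u r) * u r))) (Ioo 0 R) :=
    ((integrableOn_mul_conj w g).add (integrableOn_mul_conj g w)).sub
      ((integrableOn_mul_conj u u).const_mul _)
  have hzero := integral_byParts_eq_zero hR g g (q := fun r => (m : ℝ) - B * r ^ 2 / (2 * h))
    (q' := fun r => -(B * r / h)) (U := fun r => -∫ s in r..R, g s)
    (V := fun r => -∫ s in r..R, g s) (fun r => by
      have := (((hasDerivAt_id r).pow 2).const_mul B).div_const (2 * h) |>.const_sub (m : ℝ)
      convert! this using 1
      simp only [id]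
      field_simp
      norm_num
      ring) (by fun_prop)
    (fun r _ => rfl) (fun r _ => rfl) ?_ (fun r => rfl)
    (hint.congr (by filter_upwards [haeI] with r hr using hr.symm))
  · rw [integral_congr_ae haeI, integral_sub, integral_add, integral_const_mul,
      ← inner_eq_integral, ← inner_eq_integral, ← inner_eq_integral] at hzero
    · have h3 := congrArg Complex.re (sub_eq_zero.1 hzero)
      rw [← inner_conj_symm w g, Complex.add_re, Complex.conj_re, inner_self_eq_norm_sq_to_K,
        ← Complex.ofReal_div] at h3
      have h4 : ((B / h : ℝ) : ℂ) * ((‖u‖ : ℝ) : ℂ) ^ 2 = ((B / h * ‖u‖ ^ 2 : ℝ) : ℂ) := by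
        push_cast
        rfl
      have h5 : (((B / h : ℝ) : ℂ) * ((‖u‖ : ℝ) : ℂ) ^ 2).re = B / h * ‖u‖ ^ 2 := by
        rw [h4, Complex.ofReal_re]
      rw [two_mul]
      exact h3.trans h5
    · exact integrableOn_mul_conj w g
    · exact integrableOn_mul_conj g w
    · exact (integrableOn_mul_conj w g).add (integrableOn_mul_conj g w)
    · exact (integrableOn_mul_conj u u).const_mul _
  -- Integrability of `q |u|² / r = w conj u`. For `m = 0` it is a multiple of `r |u|²`; otherwise
  -- `u = r z / m` with `z` in `L²(r dr)` supplies the missing weight.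
  · by_cases hm : m = 0
    · refine ((integrableOn_mul_conj u u).const_mul (-(B / (2 * h)) : ℂ)).congr ?_
      filter_upwards [hprim, ae_restrict_mem measurableSet_Ioo] with r h1 hr
      have hr0 : (r : ℂ) ≠ 0 := by exact_mod_cast hr.1.ne'
      rw [← h1, hm]
      push_cast
      field_simp
      ring
    · obtain ⟨z, hz⟩ := hu.exists_div
      have hmC : (m : ℂ) ≠ 0 := by exact_mod_cast hm
      refine ((integrableOn_mul_conj z w).const_mul ((m : ℂ)⁻¹)).congr ?_
      filter_upwards [hprim, hang, ae_Ioo_iff.1 hz, ae_restrict_mem measurableSet_Ioo]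
        with r h1 h2 h3 hr
      have hr0 : (r : ℂ) ≠ 0 := by exact_mod_cast hr.1.ne'
      have h4 : starRingEnd ℂ (u r) = (m : ℂ)⁻¹ * (r * starRingEnd ℂ (z r)) := by
        have := congrArg (starRingEnd ℂ) h3
        simp only [map_mul, Complex.conj_ofReal, map_intCast] at this
        rw [this, inv_mul_cancel_left₀ hmC]
      rw [← h1, h4, h2]
      push_cast
      field_simp

/-- Multiplied by `h²`, the right side is the quadratic form of `𝒫_m`: the energy is the squared
norm of the annihilation image `g - w`. -/
theorem IsMagneticGradient.norm_sub_sq (hR : 0 < R) {B h : ℝ} (hh : h ≠ 0) {m : ℤ}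
    {u g w : RadialL2 R} (hu : IsMagneticGradient B R h m u g w) :
    ‖g - w‖ ^ 2 = ‖g‖ ^ 2 + ‖w‖ ^ 2 - B / h * ‖u‖ ^ 2 := by
  rw [← hu.two_mul_re_inner hR hh, @_root_.norm_sub_sq ℂ]
  simp only [RCLike.re_eq_complex_re]
  ring

/-- The commutation relation in form language; the constant `2B/h` becomes the Landau gap `2hB`
after multiplication by `h²`. -/
theorem IsMagneticGradient.norm_add_sq (hR : 0 < R) {B h : ℝ} (hh : h ≠ 0) {m : ℤ}
    {u g w : RadialL2 R} (hu : IsMagneticGradient B R h m u g w) :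
    ‖g + w‖ ^ 2 = ‖g - w‖ ^ 2 + 2 * (B / h) * ‖u‖ ^ 2 := by
  have := hu.two_mul_re_inner hR hh
  rw [@_root_.norm_add_sq ℂ, @_root_.norm_sub_sq ℂ]
  simp only [RCLike.re_eq_complex_re]
  linarith

/-- The creation and annihilation operators between neighbouring angular momenta are formally
adjoint to each other on the form domains. -/
theorem IsMagneticGradient.inner_sub (hR : 0 < R) {B h : ℝ} {m : ℤ} {u g w v k z : RadialL2 R}
    (hu : IsMagneticGradient B R h m u g w) (hv : IsMagneticGradient B R h (m + 1) v k z) :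
    ⟪v, g - w⟫_ℂ = -⟪k + z, u⟫_ℂ := by
  have hprim := hu.ae_eq_primitive
  have hprim' := hv.ae_eq_primitive
  have hang := ae_Ioo_iff.1 hu.angular
  have hang' := ae_Ioo_iff.1 hv.angular
  -- The angular coefficients at `m + 1` and `m` differ by `1/r`. Thus the unweighted product `conj
  -- v u` is integrable, which both cancels the term from `(r)' = 1` and controls the boundary term
  -- at `0`.
  have haeUV : ∀ᵐ r ∂(volume.restrict (Ioo 0 R)), starRingEnd ℂ (v r) * u r =
      (r : ℂ) * (starRingEnd ℂ (z r) * u r) - (r : ℂ) * (starRingEnd ℂ (v r) * w r) := by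
    filter_upwards [hang, hang', ae_restrict_mem measurableSet_Ioo] with r h3 h4 hr
    have hr0 : (r : ℂ) ≠ 0 := by exact_mod_cast hr.1.ne'
    rw [h3, h4]
    simp only [map_mul, Complex.conj_ofReal]
    push_cast
    field_simp
    ring
  have haeI : ∀ᵐ r ∂(volume.restrict (Ioo 0 R)),
      ((r : ℝ) : ℂ) * (g r * starRingEnd ℂ (-∫ s in r..R, k s) +
        (-∫ s in r..R, g s) * starRingEnd ℂ (k r)) +
        ((1 : ℝ) : ℂ) * ((-∫ s in r..R, g s) * starRingEnd ℂ (-∫ s in r..R, k s)) =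
      ((r : ℂ) * (starRingEnd ℂ (v r) * g r) - (r : ℂ) * (starRingEnd ℂ (v r) * w r)) +
        ((r : ℂ) * (starRingEnd ℂ (k r) * u r) + (r : ℂ) * (starRingEnd ℂ (z r) * u r)) := by
    filter_upwards [hprim, hprim', haeUV] with r h1 h2 h3
    rw [← h1, ← h2]
    push_cast
    linear_combination h3
  have i1 := integrableOn_mul_conj v g
  have i2 := integrableOn_mul_conj v w
  have i3 := integrableOn_mul_conj k u
  have i4 := integrableOn_mul_conj z u
  have hzero := integral_byParts_eq_zero hR g k (q := fun r => r)
    (q' := fun _ => 1) (U := fun r => -∫ s in r..R, g s)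
    (V := fun r => -∫ s in r..R, k s) (fun r => hasDerivAt_id r) continuous_const
    (fun r _ => rfl) (fun r _ => rfl) ?_ (fun r => rfl)
    (((i1.sub i2).add (i3.add i4)).congr (by filter_upwards [haeI] with r hr using hr.symm))
  · rw [integral_congr_ae haeI, integral_add, integral_sub i1 i2,
      integral_add i3 i4, ← inner_eq_integral, ← inner_eq_integral, ← inner_eq_integral,
      ← inner_eq_integral] at hzero
    · rw [inner_sub_right, inner_add_left]
      exact eq_neg_of_add_eq_zero_left hzero
    · exact i1.sub i2
    · exact i3.add i4
  · refine (i4.sub i2).congr ?_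
    filter_upwards [hprim, hprim', haeUV, ae_restrict_mem measurableSet_Ioo] with r h1 h2 h3 hr
    have hr0 : (r : ℂ) ≠ 0 := by exact_mod_cast hr.1.ne'
    rw [← h1, ← h2, Pi.sub_apply, ← h3, mul_div_cancel_left₀ _ hr0, mul_comm]

/-- The energy is a sum of a square, so the operator is nonnegative. -/
theorem energy_of_mem_graph (hR : 0 < R) {B h : ℝ} (hh : h ≠ 0) {m : ℤ} {u f : RadialL2 R}
    (hu : (u, f) ∈ (pauliOperator B R h m).graph) :
    ∃ g w, IsMagneticGradient B R h m u g w ∧ h ^ 2 * ‖g - w‖ ^ 2 = (⟪u, f⟫_ℂ).re := by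
  obtain ⟨g, w, h1, h2⟩ := exists_energy_of_mem_graph hu
  refine ⟨g, w, h1, ?_⟩
  rw [← h2, h1.norm_sub_sq hR hh]
  field_simp

theorem IsEigenvalueSequence.exists_eigenvector {H : Type*} [NormedAddCommGroup H]
    [InnerProductSpace ℂ H] {T : H →ₗ.[ℂ] H} {lam : ℕ → ℝ} (hlam : IsEigenvalueSequence T lam)
    (k : ℕ) : ∃ u, u ≠ 0 ∧ (u, (lam k : ℂ) • u) ∈ T.graph := by
  obtain ⟨u, hu, hu0⟩ := (Submodule.ne_bot_iff _).1 (hlam.eigenspace_ne_bot k)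
  exact ⟨u, hu0, hu⟩

theorem re_inner_smul_self {H : Type*} [NormedAddCommGroup H] [InnerProductSpace ℂ H] (u : H)
    (c : ℝ) : (⟪u, (c : ℂ) • u⟫_ℂ).re = c * ‖u‖ ^ 2 := by
  rw [inner_smul_right, inner_self_eq_norm_sq_to_K, Complex.re_ofReal_mul]
  norm_cast

/-! ### Negative angular momentum. -/

/-- For negative angular momentum the potential is bounded below. -/
theorem IsEigenvalueSequence.le_of_neg {B h : ℝ} (hB : 0 < B) (hh : 0 < h) {m : ℤ} (hm : m < 0)
    {lam : ℕ → ℝ} (hlam : IsEigenvalueSequence (pauliOperator B R h m) lam) :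
    (2 * |(m : ℝ)| - 1) * h * B ≤ lam 0 := by
  obtain ⟨u, hu0, hu⟩ := hlam.exists_eigenvector 0
  obtain ⟨g, w, h1, h2⟩ := exists_energy_of_mem_graph hu
  rw [re_inner_smul_self] at h2
  have hm' : (m : ℝ) < 0 := by exact_mod_cast hm
  rw [abs_of_neg hm']
  have hw : 2 * (-m) * B / h * ‖u‖ ^ 2 ≤ ‖w‖ ^ 2 := by
    rw [norm_sq_eq_integral, norm_sq_eq_integral, ← integral_const_mul]
    refine setIntegral_mono_ae_restrict ((integrableOn_norm_sq u).const_mul _)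
      (integrableOn_norm_sq w) ?_
    filter_upwards [ae_Ioo_iff.1 h1.angular, ae_restrict_mem measurableSet_Ioo] with r h3 hr
    rw [h3, norm_mul, mul_pow, Complex.norm_real, Real.norm_eq_abs, sq_abs]
    -- `(x - y)² = (x + y)² - 4xy` with `x = m/r`, `y = Br/(2h)`, whose product does not depend on
    -- `r`.
    have h4 : 2 * (-m) * B / h ≤ ((m : ℝ) / r - B * r / (2 * h)) ^ 2 := by
      have h5 : ((m : ℝ) / r - B * r / (2 * h)) ^ 2 - 2 * (-m) * B / h =
          ((m : ℝ) / r + B * r / (2 * h)) ^ 2 := by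
        have := hr.1.ne'
        field_simp
        ring
      nlinarith [sq_nonneg ((m : ℝ) / r + B * r / (2 * h))]
    calc 2 * (-m) * B / h * (r * ‖u r‖ ^ 2) = r * (2 * (-m) * B / h * ‖u r‖ ^ 2) := by ring
      _ ≤ r * (((m : ℝ) / r - B * r / (2 * h)) ^ 2 * ‖u r‖ ^ 2) :=
        mul_le_mul_of_nonneg_left (mul_le_mul_of_nonneg_right h4 (sq_nonneg _)) hr.1.le
  have hpos : 0 < ‖u‖ ^ 2 := by positivity
  refine le_of_mul_le_mul_right ?_ hpos
  rw [← h2]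
  have h6 : h ^ 2 * (2 * (-m) * B / h * ‖u‖ ^ 2) ≤ h ^ 2 * (‖g‖ ^ 2 + ‖w‖ ^ 2) :=
    mul_le_mul_of_nonneg_left (by nlinarith [sq_nonneg ‖g‖]) (sq_nonneg h)
  have h7 : h ^ 2 * (2 * (-m) * B / h * ‖u‖ ^ 2) = 2 * (-m) * B * h * ‖u‖ ^ 2 := by
    field_simp
  rw [h7] at h6
  linarith

/-! ### The ladder of angular momenta and the Landau levels. -/

theorem sqrt_mul_norm_primitive_le (g : RadialL2 R) {r : ℝ} (hr : r ∈ Ioo 0 R) :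
    √r * ‖∫ s in r..R, g s‖ ≤ √R * ‖g‖ := by
  have h := sq_norm_intervalIntegral_le g hr.1 hr.2.le le_rfl
  have h2 : r * ‖∫ s in r..R, g s‖ ^ 2 ≤ R * ‖g‖ ^ 2 := by
    calc r * ‖∫ s in r..R, g s‖ ^ 2 ≤ r * ((R - r) / r * ‖g‖ ^ 2) :=
          mul_le_mul_of_nonneg_left h hr.1.le
      _ = (R - r) * ‖g‖ ^ 2 := by
          have := hr.1.ne'
          field_simp
      _ ≤ R * ‖g‖ ^ 2 := mul_le_mul_of_nonneg_right (by linarith [hr.1]) (sq_nonneg _)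
  have h3 := Real.sqrt_le_sqrt h2
  rwa [Real.sqrt_mul' _ (sq_nonneg _), Real.sqrt_mul' _ (sq_nonneg _), Real.sqrt_sq (norm_nonneg _),
    Real.sqrt_sq (norm_nonneg _)] at h3

/-- The weight `r^(m+1) exp (-B r² / (4 h))`, an integrating factor for the creation operator. -/
theorem hasDerivAt_pow_mul_exp (b : ℝ) (m : ℕ) (r : ℝ) (hr : r ≠ 0) :
    HasDerivAt (fun r : ℝ => r ^ (m + 1) * Real.exp (-(b * r ^ 2 / 2)))
      (((m + 1 : ℝ) / r - b * r) * (r ^ (m + 1) * Real.exp (-(b * r ^ 2 / 2)))) r := by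
  have h1 : HasDerivAt (fun r : ℝ => -(b * r ^ 2 / 2)) (-(b * r)) r := by
    have := (((hasDerivAt_pow 2 r).const_mul b).div_const 2).neg
    convert! this using 1
    norm_num
    ring
  have h2 := (hasDerivAt_pow (m + 1) r).mul h1.exp
  convert! h2 using 1
  push_cast
  field_simp
  ring

/-- A function in the form domain for `m` which is orthogonal to the zero mode
`r^m exp (-B r² / (4 h))` is the image under the creation operator of a function in the form domain
for `m + 1`. -/
theorem IsMagneticGradient.exists_creation (hR : 0 < R) {B h : ℝ} {m : ℕ} {u g w : RadialL2 R}
    (hu : IsMagneticGradient B R h m u g w)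
    (horth : ∫ s in (0 : ℝ)..R, ((s ^ (m + 1) * Real.exp (-(B / (2 * h) * s ^ 2 / 2)) : ℝ) : ℂ) * u s
      = 0) :
    ∃ v k z, IsMagneticGradient B R h (m + 1) v k z ∧ u = -(k + z) := by
  set b : ℝ := B / (2 * h) with hb
  set χ : ℝ → ℝ := fun s => s ^ (m + 1) * Real.exp (-(b * s ^ 2 / 2)) with hχ
  have hχc : Continuous χ := by fun_prop
  have hχpos : ∀ s, 0 < s → 0 < χ s := fun s hs => by positivity
  set U : ℝ → ℂ := fun r => -∫ s in r..R, g s with hU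
  have hUc : ContinuousOn U (Ioc 0 R) := (continuousOn_integral_right g).neg
  set C : ℝ := √R * ‖g‖ with hC
  have hC0 : 0 ≤ C := by positivity
  have hUb : ∀ r ∈ Ioo 0 R, √r * ‖U r‖ ≤ C := fun r hr => by
    rw [hU]
    simp only [norm_neg]
    exact sqrt_mul_norm_primitive_le g hr
  set M : ℝ := Real.exp (|b| * R ^ 2 / 2) with hM
  have hMpos : 0 < M := Real.exp_pos _
  have hexp : ∀ s ∈ Ioc 0 R, Real.exp (-(b * s ^ 2 / 2)) ≤ M ∧ M⁻¹ ≤ Real.exp (-(b * s ^ 2 / 2)) := by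
    intro s hs
    have h1 : |b * s ^ 2| ≤ |b| * R ^ 2 := by
      rw [abs_mul, abs_of_nonneg (sq_nonneg s)]
      exact mul_le_mul_of_nonneg_left (pow_le_pow_left₀ hs.1.le hs.2 2) (abs_nonneg _)
    obtain ⟨h2, h3⟩ := abs_le.1 h1
    rw [hM, ← Real.exp_neg]
    exact ⟨Real.exp_le_exp.2 (by linarith), Real.exp_le_exp.2 (by linarith)⟩
  set F : ℝ → ℂ := fun s => (χ s : ℂ) * U s with hF
  have hFc : ContinuousOn F (Ioc 0 R) :=
    (Complex.continuous_ofReal.comp hχc).continuousOn.mul hUc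
  -- Powers of `r` near `0`: `U` is `O(r^(-1/2))` and `χ` is of order `r^(m+1)`, so `F`, `P`, `V`,
  -- `a V` are `O(r^(m+1/2))`, `O(r^(m+3/2))`, `O(r^(1/2))`, `O(r^(-1/2))`. The last bound is just
  -- enough for `r ‖a V‖²` to be bounded.
  have hFb : ∀ r ∈ Ioo 0 R, ‖F r‖ ≤ M * C * (r ^ m * √r) := by
    intro r hr
    have h1 : ‖F r‖ = Real.exp (-(b * r ^ 2 / 2)) * (r ^ m * √r) * (√r * ‖U r‖) := by
      rw [hF]
      simp only
      rw [norm_mul, Complex.norm_real, Real.norm_of_nonneg (hχpos r hr.1).le, hχ]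
      simp only
      rw [pow_succ]
      nth_rewrite 2 [← Real.mul_self_sqrt hr.1.le]
      ring
    rw [h1]
    calc Real.exp (-(b * r ^ 2 / 2)) * (r ^ m * √r) * (√r * ‖U r‖)
        ≤ M * (r ^ m * √r) * C := by
          have h3 : 0 ≤ r ^ m * √r := mul_nonneg (pow_nonneg hr.1.le _) (Real.sqrt_nonneg _)
          refine mul_le_mul (mul_le_mul_of_nonneg_right (hexp r ⟨hr.1, hr.2.le⟩).1 h3) (hUb r hr)
            (by positivity) (by positivity)
      _ = _ := by ring
  have hmono : ∀ s r : ℝ, 0 ≤ s → s ≤ r → s ^ m * √s ≤ r ^ m * √r := fun s r hs hsr =>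
    mul_le_mul (pow_le_pow_left₀ hs hsr m) (Real.sqrt_le_sqrt hsr) (Real.sqrt_nonneg _)
      (pow_nonneg (hs.trans hsr) _)
  have hFi : IntervalIntegrable F volume 0 R := by
    rw [intervalIntegrable_iff_integrableOn_Ioo_of_le hR.le]
    refine Integrable.of_bound (C := M * C * (R ^ m * √R))
      ((hFc.mono Ioo_subset_Ioc_self).aestronglyMeasurable measurableSet_Ioo) ?_
    filter_upwards [ae_restrict_mem measurableSet_Ioo] with r hr
    exact (hFb r hr).trans (mul_le_mul_of_nonneg_left (hmono r R hr.1.le hr.2.le) (by positivity))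
  set P : ℝ → ℂ := fun r => ∫ s in (0 : ℝ)..r, F s with hP
  have hPR : P R = 0 := by
    rw [← horth, hP]
    simp only
    rw [intervalIntegral.integral_of_le hR.le, intervalIntegral.integral_of_le hR.le,
      integral_Ioc_eq_integral_Ioo, integral_Ioc_eq_integral_Ioo]
    refine integral_congr_ae ?_
    filter_upwards [hu.ae_eq_primitive] with r hr
    rw [hr]
  have hPc : ContinuousOn P (Icc 0 R) := by
    have := intervalIntegral.continuousOn_primitive_interval (μ := volume)
      ((intervalIntegrable_iff').1 hFi)
    rwa [uIcc_of_le hR.le] at this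
  have hPd : ∀ r ∈ Ioo 0 R, HasDerivAt P (F r) r := by
    intro r hr
    refine intervalIntegral.integral_hasDerivAt_right (hFi.mono_set ?_) ?_ ?_
    · rw [uIcc_of_le hR.le, uIcc_of_le hr.1.le]
      exact Icc_subset_Icc_right hr.2.le
    · exact (hFc.mono Ioo_subset_Ioc_self).stronglyMeasurableAtFilter isOpen_Ioo r hr
    · exact (hFc.mono Ioo_subset_Ioc_self).continuousAt (isOpen_Ioo.mem_nhds hr)
  have hPb : ∀ r ∈ Ioo 0 R, ‖P r‖ ≤ M * C * (r ^ m * √r) * r := by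
    intro r hr
    have h1 := intervalIntegral.norm_integral_le_of_norm_le_const_ae (f := F) (a := 0) (b := r)
      (C := M * C * (r ^ m * √r)) (by
        filter_upwards [Measure.ae_ne volume r] with s hs hs'
        rw [uIoc_of_le hr.1.le] at hs'
        have hs2 : s < r := lt_of_le_of_ne hs'.2 hs
        exact (hFb s ⟨hs'.1, hs2.trans hr.2⟩).trans
          (mul_le_mul_of_nonneg_left (hmono s r hs'.1.le hs'.2) (by positivity)))
    rwa [sub_zero, abs_of_pos hr.1] at h1
  -- The equation `v' + a v = -u` reads `(χ v)' = -χ u`. Integrating from `0` makes `V` small there,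
  -- and the orthogonality, in the form `P R = 0`, gives the Dirichlet condition.
  set V : ℝ → ℂ := fun r => -(P r / (χ r : ℂ)) with hV
  have hχne : ∀ r, 0 < r → (χ r : ℂ) ≠ 0 := fun r hr => by exact_mod_cast (hχpos r hr).ne'
  have hVc : ContinuousOn V (Ioc 0 R) :=
    ((hPc.mono Ioc_subset_Icc_self).div (Complex.continuous_ofReal.comp hχc).continuousOn
      fun r hr => hχne r hr.1).neg
  have hVb : ∀ r ∈ Ioo 0 R, ‖V r‖ ≤ M * C * M * √r := by
    intro r hr
    rw [hV]
    simp only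
    rw [norm_neg, norm_div, Complex.norm_real, Real.norm_of_nonneg (hχpos r hr.1).le,
      div_le_iff₀ (hχpos r hr.1)]
    refine (hPb r hr).trans ?_
    have h1 : 1 ≤ M * Real.exp (-(b * r ^ 2 / 2)) := by
      have := mul_le_mul_of_nonneg_left (hexp r ⟨hr.1, hr.2.le⟩).2 hMpos.le
      rwa [mul_inv_cancel₀ hMpos.ne'] at this
    have h2 : 0 ≤ M * C * (r ^ m * √r) * r := by
      have := hr.1.le
      positivity
    calc M * C * (r ^ m * √r) * r ≤ M * C * (r ^ m * √r) * r * (M * Real.exp (-(b * r ^ 2 / 2))) :=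
          le_mul_of_one_le_right h2 h1
      _ = M * C * M * √r * χ r := by
          rw [hχ]
          simp only
          ring
  set a : ℝ → ℝ := fun r => (m + 1 : ℝ) / r - b * r with ha
  have hac : ContinuousOn a (Ioc 0 R) :=
    (continuousOn_const.div continuousOn_id fun r hr => hr.1.ne').sub (by fun_prop)
  have hVd : ∀ r ∈ Ioo 0 R, HasDerivAt V (-U r - a r * V r) r := by
    intro r hr
    have hχd : HasDerivAt χ (a r * χ r) r := hasDerivAt_pow_mul_exp b m r hr.1.ne'
    have h1 := (hPd r hr).div hχd.ofReal_comp (hχne r hr.1)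
    convert! h1.neg using 1
    have h2 := hχne r hr.1
    simp only [hV, hF]
    push_cast
    field_simp
    ring
  have hVm : MemLp V 2 (radialMeasure R) := by
    refine memLp_of_forall_mul_le (C := (M * C * M * R) ^ 2)
      ((hVc.mono Ioo_subset_Ioc_self).aestronglyMeasurable measurableSet_Ioo) fun r hr => ?_
    have h1 : √r * ‖V r‖ ≤ M * C * M * R := by
      calc √r * ‖V r‖ ≤ √r * (M * C * M * √r) :=
            mul_le_mul_of_nonneg_left (hVb r hr) (Real.sqrt_nonneg _)
        _ = M * C * M * (√r * √r) := by ring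
        _ ≤ M * C * M * R := by
            rw [Real.mul_self_sqrt hr.1.le]
            exact mul_le_mul_of_nonneg_left hr.2.le (by positivity)
    have h2 := pow_le_pow_left₀ (by positivity) h1 2
    rwa [mul_pow, Real.sq_sqrt hr.1.le] at h2
  have hZm : MemLp (fun r => (a r : ℂ) * V r) 2 (radialMeasure R) := by
    refine memLp_of_forall_mul_le (C := ((m + 1 + |b| * R ^ 2) * (M * C * M)) ^ 2)
      ((((Complex.continuous_ofReal.comp_continuousOn hac).mul hVc).mono
        Ioo_subset_Ioc_self).aestronglyMeasurable measurableSet_Ioo) fun r hr => ?_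
    have h0 : |a r| * r ≤ m + 1 + |b| * R ^ 2 := by
      have h1 : |a r| * r = |(m + 1 : ℝ) - b * r ^ 2| := by
        nth_rewrite 2 [← abs_of_pos hr.1]
        rw [← abs_mul, ha]
        congr 1
        have := hr.1.ne'
        field_simp
      rw [h1]
      refine (abs_sub _ _).trans ?_
      rw [abs_of_nonneg (by positivity : (0 : ℝ) ≤ m + 1), abs_mul, abs_of_nonneg (sq_nonneg r)]
      have := mul_le_mul_of_nonneg_left (pow_le_pow_left₀ hr.1.le hr.2.le 2) (abs_nonneg b)
      linarith
    have h1 : √r * ‖(a r : ℂ) * V r‖ ≤ (m + 1 + |b| * R ^ 2) * (M * C * M) := by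
      rw [norm_mul, Complex.norm_real, Real.norm_eq_abs]
      calc √r * (|a r| * ‖V r‖) ≤ √r * (|a r| * (M * C * M * √r)) :=
            mul_le_mul_of_nonneg_left (mul_le_mul_of_nonneg_left (hVb r hr) (abs_nonneg _))
              (Real.sqrt_nonneg _)
        _ = |a r| * (√r * √r) * (M * C * M) := by ring
        _ ≤ _ := by
            rw [Real.mul_self_sqrt hr.1.le]
            exact mul_le_mul_of_nonneg_right h0 (by positivity)
    have h2 := pow_le_pow_left₀ (by positivity) h1 2
    rwa [mul_pow, Real.sq_sqrt hr.1.le] at h2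
  set z : RadialL2 R := hZm.toLp with hz
  have hzae := MemLp.coeFn_toLp hZm
  have hvae := MemLp.coeFn_toLp hVm
  -- The derivative is taken to be `-u - z`, so that `u = -(k + z)` holds by construction; what
  -- remains is that `V` is its primitive.
  refine ⟨hVm.toLp, -u - z, z, ⟨?_, ?_⟩, by abel⟩
  · filter_upwards [hvae, ae_mem_radialMeasure R] with r h1 hr
    rw [h1]
    have hk : ((-u - z : RadialL2 R) : ℝ → ℂ) =ᵐ[radialMeasure R] fun r => -U r - a r * V r := by
      filter_upwards [Lp.coeFn_sub (-u) z, Lp.coeFn_neg u, hzae, hu.radial] with s h2 h3 h4 h5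
      rw [h2, Pi.sub_apply, h3, Pi.neg_apply, h5, hz, h4]
    rw [intervalIntegral_congr_radial hk hr,
      intervalIntegral.integral_eq_sub_of_hasDerivAt_of_le hr.2.le
        (hVc.mono fun s hs => ⟨hr.1.trans_le hs.1, hs.2⟩)
        fun s hs => hVd s ⟨hr.1.trans hs.1, hs.2⟩]
    · have hVR : V R = 0 := by
        rw [hV]
        simp only
        rw [hPR, zero_div, neg_zero]
      rw [hVR]
      ring
    · refine (intervalIntegrable R (-u - z) hr).congr_ae ?_
      rw [uIoc_of_le hr.2.le, ← restrict_Ioo_eq_restrict_Ioc]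
      exact ae_mono (Measure.restrict_mono (Ioo_subset_Ioo_left hr.1.le) le_rfl) (ae_Ioo_iff.1 hk)
  · filter_upwards [hzae, hvae] with r h1 h2
    rw [hz, h1, h2]
    congr 2
    rw [ha, hb]
    simp only
    push_cast
    ring

/-- The form domain as a subspace of `L²((0, R), r dr)`. -/
def formDomain (B R h : ℝ) (m : ℤ) : Submodule ℂ (RadialL2 R) where
  carrier := {u | ∃ g w, IsMagneticGradient B R h m u g w}
  zero_mem' := ⟨0, 0, .zero B R h m⟩
  add_mem' := by
    rintro u v ⟨g, w, h1⟩ ⟨k, z, h2⟩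
    exact ⟨g + k, w + z, h1.add h2⟩
  smul_mem' := by
    rintro c u ⟨g, w, h1⟩
    exact ⟨c • g, c • w, h1.smul c⟩

/-- The elements of the form domain whose image under the creation operator lies in `E`. -/
def creationPreimage (B R h : ℝ) (m : ℤ) (E : Submodule ℂ (RadialL2 R)) :
    Submodule ℂ (RadialL2 R) where
  carrier := {v | ∃ k z, IsMagneticGradient B R h m v k z ∧ -(k + z) ∈ E}
  zero_mem' := ⟨0, 0, .zero B R h m, by simp⟩
  add_mem' := by
    rintro u v ⟨g, w, h1, e1⟩ ⟨k, z, h2, e2⟩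
    refine ⟨g + k, w + z, h1.add h2, ?_⟩
    convert E.add_mem e1 e2 using 1
    abel
  smul_mem' := by
    rintro c u ⟨g, w, h1, e1⟩
    refine ⟨c • g, c • w, h1.smul c, ?_⟩
    rw [← smul_add, ← smul_neg]
    exact E.smul_mem c e1

theorem creationPreimage_le (B h : ℝ) (m : ℤ) (E : Submodule ℂ (RadialL2 R)) :
    creationPreimage B R h m E ≤ formDomain B R h m := by
  rintro v ⟨k, z, h1, -⟩
  exact ⟨k, z, h1⟩

theorem IsMagneticGradient.sum {B h : ℝ} {m : ℤ} {ι : Type*} (s : Finset ι) (c : ι → ℂ)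
    {v k z : ι → RadialL2 R} (hv : ∀ i, IsMagneticGradient B R h m (v i) (k i) (z i)) :
    IsMagneticGradient B R h m (∑ i ∈ s, c i • v i) (∑ i ∈ s, c i • k i) (∑ i ∈ s, c i • z i) := by
  classical
  induction s using Finset.induction_on with
  | empty => simpa using IsMagneticGradient.zero B R h m
  | insert i s hi ih =>
    rw [Finset.sum_insert hi, Finset.sum_insert hi, Finset.sum_insert hi]
    exact ((hv i).smul (c i)).add ih

theorem exists_linearIndependent_ker {H : Type*} [AddCommGroup H] [Module ℂ H] {n : ℕ}
    {e : Fin (n + 1) → H} (he : LinearIndependent ℂ e) (l : H →ₗ[ℂ] ℂ) :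
    ∃ f : Fin n → H, LinearIndependent ℂ f ∧
      ∀ j, f j ∈ Submodule.span ℂ (Set.range e) ∧ l (f j) = 0 := by
  set E := Submodule.span ℂ (Set.range e) with hE
  have hfd : FiniteDimensional ℂ E := FiniteDimensional.span_of_finite ℂ (Set.finite_range e)
  have hdim : Module.finrank ℂ E = n + 1 := by
    rw [hE, finrank_span_eq_card he, Fintype.card_fin]
  have h1 := LinearMap.finrank_range_add_finrank_ker (l.domRestrict E)
  have h2 : Module.finrank ℂ (LinearMap.range (l.domRestrict E)) ≤ 1 := by
    refine (Submodule.finrank_le _).trans ?_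
    rw [Module.finrank_self]
  have h3 : n ≤ Module.finrank ℂ (LinearMap.ker (l.domRestrict E)) := by omega
  have h4 : (n : Cardinal) ≤ Module.rank ℂ (LinearMap.ker (l.domRestrict E)) := by
    rw [← Module.finrank_eq_rank]
    exact_mod_cast h3
  obtain ⟨f, hf⟩ := Module.le_rank_iff.1 h4
  refine ⟨fun j => ((f j : E) : H), ?_, fun j => ⟨(f j : E).2, (f j).2⟩⟩
  exact (hf.map' (Submodule.subtype _) (Submodule.ker_subtype _)).map' E.subtype
    (Submodule.ker_subtype _)

/-- The lower half of min-max, by induction up the ladder. Orthogonality to the zero mode removes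
one dimension of `E`; the rest lifts through the creation operator to angular momentum `m + 1`,
where the induction hypothesis applies to the preimage of `E`. -/
theorem exists_mem_mul_norm_sq_le (hR : 0 < R) {B h : ℝ} (hB : 0 < B) (hh : 0 < h) (k : ℕ) :
    ∀ (m : ℕ) (E : Submodule ℂ (RadialL2 R)), E ≤ formDomain B R h m →
      (∃ e : Fin (k + 1) → RadialL2 R, LinearIndependent ℂ e ∧ ∀ j, e j ∈ E) →
      ∃ u ∈ E, u ≠ 0 ∧ ∃ g w, IsMagneticGradient B R h m u g w ∧
        2 * (B / h) * k * ‖u‖ ^ 2 ≤ ‖g - w‖ ^ 2 := by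
  induction k with
  | zero =>
    rintro m E hE ⟨e, he, heE⟩
    obtain ⟨g, w, h1⟩ := hE (heE 0)
    refine ⟨e 0, heE 0, he.ne_zero 0, g, w, h1, ?_⟩
    simp only [CharP.cast_eq_zero, mul_zero, zero_mul]
    exact sq_nonneg _
  | succ k ih =>
    rintro m E hE ⟨e, he, heE⟩
    -- The zero mode itself. The measure `s ds` supplies the further factor `s` of the weight in
    -- `IsMagneticGradient.exists_creation`.
    set χ : ℝ → ℝ := fun s => s ^ m * Real.exp (-(B / (2 * h) * s ^ 2 / 2)) with hχ
    have hχm : MemLp (fun s => (χ s : ℂ)) 2 (radialMeasure R) := by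
      have hc : Continuous fun s => (χ s : ℂ) := by fun_prop
      obtain ⟨C, hC⟩ := (isCompact_Icc (a := (0 : ℝ)) (b := R)).exists_bound_of_continuousOn
        hc.continuousOn
      refine MemLp.of_bound hc.aestronglyMeasurable C ?_
      filter_upwards [ae_mem_radialMeasure R] with r hr using hC r (Ioo_subset_Icc_self hr)
    obtain ⟨f, hf, hfE⟩ := exists_linearIndependent_ker he
      ((innerSL ℂ hχm.toLp : RadialL2 R →L[ℂ] ℂ) : RadialL2 R →ₗ[ℂ] ℂ)
    have hfE1 : ∀ j, f j ∈ E := fun j =>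
      (Submodule.span_le.2 (by rintro _ ⟨i, rfl⟩; exact heE i)) (hfE j).1
    have hlift : ∀ j, ∃ v k z, IsMagneticGradient B R h ((m : ℤ) + 1) v k z ∧ f j = -(k + z) := by
      intro j
      obtain ⟨g, w, h1⟩ := hE (hfE1 j)
      refine h1.exists_creation hR ?_
      have h2 : ⟪hχm.toLp, f j⟫_ℂ = 0 := (hfE j).2
      rw [inner_eq_integral] at h2
      rw [intervalIntegral.integral_of_le hR.le, integral_Ioc_eq_integral_Ioo, ← h2]
      refine integral_congr_ae ?_
      filter_upwards [ae_Ioo_iff.1 (MemLp.coeFn_toLp hχm)] with s hs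
      rw [hs, Complex.conj_ofReal, hχ]
      push_cast
      ring
    choose v κ z hv hfv using hlift
    -- A relation among the `v j` passes to the `f j`, because the gradient of `0` is `0`.
    have hvli : LinearIndependent ℂ v := by
      rw [Fintype.linearIndependent_iff] at hf ⊢
      intro c hc
      refine hf c ?_
      have h1 := IsMagneticGradient.sum Finset.univ c hv
      rw [hc] at h1
      obtain ⟨h2, h3⟩ := deriv_unique _ _ _ _ _ _ h1
      simp_rw [hfv, smul_neg, smul_add, Finset.sum_neg_distrib, Finset.sum_add_distrib]
      rw [h2, h3, add_zero, neg_zero]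
    obtain ⟨y, hyW, hy0, k', z', hy, hle⟩ := ih (m + 1) (creationPreimage B R h ((m : ℤ) + 1) E)
      (by exact_mod_cast creationPreimage_le B h _ E)
      ⟨v, hvli, fun j => ⟨κ j, z j, hv j, by rw [← hfv]; exact hfE1 j⟩⟩
    obtain ⟨k'', z'', hy2, hmem⟩ := hyW
    push_cast at hy
    have huniq : k' - k'' = 0 ∧ z' - z'' = 0 := by
      refine deriv_unique B R h (m + 1) _ _ ?_
      have := hy.add (hy2.smul (-1))
      simpa [← sub_eq_add_neg] using this
    obtain rfl := sub_eq_zero.1 huniq.1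
    obtain rfl := sub_eq_zero.1 huniq.2
    obtain ⟨g, w, hu⟩ := hE hmem
    have hβ : 0 < B / h := div_pos hB hh
    -- The commutation relation adds one `2B/h` to the `k` given by the induction hypothesis.
    have hsq : 2 * (B / h) * (k + 1) * ‖y‖ ^ 2 ≤ ‖-(k' + z')‖ ^ 2 := by
      rw [norm_neg, hy.norm_add_sq hR hh.ne']
      linarith
    have hypos : 0 < ‖y‖ ^ 2 := by positivity
    have hupos : 0 < ‖-(k' + z')‖ ^ 2 := lt_of_lt_of_le (by positivity) hsq
    refine ⟨_, hmem, fun h0 => ?_, g, w, hu, ?_⟩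
    · rw [h0] at hupos
      simp at hupos
    · have hin := hu.inner_sub hR hy
      rw [← inner_neg_left, inner_self_eq_norm_sq_to_K] at hin
      -- For `u = -(k' + z')` adjointness gives `⟪y, g - w⟫ = ‖u‖²`. Cauchy-Schwarz carries the
      -- bound of `‖u‖` by `‖y‖` over to one of `‖g - w‖` by `‖u‖`.
      have h1 : ‖-(k' + z')‖ ^ 2 ≤ ‖y‖ * ‖g - w‖ := by
        have h2 := norm_inner_le_norm (𝕜 := ℂ) y (g - w)
        rw [hin, norm_pow, RCLike.norm_ofReal, abs_norm] at h2
        exact h2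
      have h3 : (‖-(k' + z')‖ ^ 2) ^ 2 ≤ ‖y‖ ^ 2 * ‖g - w‖ ^ 2 := by
        rw [← mul_pow]
        exact pow_le_pow_left₀ (sq_nonneg _) h1 2
      push_cast
      refine le_of_mul_le_mul_left ?_ (mul_pos hypos hupos)
      calc ‖y‖ ^ 2 * ‖-(k' + z')‖ ^ 2 * (2 * (B / h) * (k + 1) * ‖-(k' + z')‖ ^ 2)
          = (2 * (B / h) * (k + 1) * ‖y‖ ^ 2) * (‖-(k' + z')‖ ^ 2) ^ 2 := by ring
        _ ≤ ‖-(k' + z')‖ ^ 2 * (‖y‖ ^ 2 * ‖g - w‖ ^ 2) :=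
          mul_le_mul hsq h3 (sq_nonneg _) hupos.le
        _ = ‖y‖ ^ 2 * ‖-(k' + z')‖ ^ 2 * ‖g - w‖ ^ 2 := by ring

/-- The `k`-th eigenvalue is at least the `k`-th Landau level. -/
theorem IsEigenvalueSequence.landau_le (hR : 0 < R) {B h : ℝ} (hB : 0 < B) (hh : 0 < h) {m : ℕ}
    {lam : ℕ → ℝ} (hlam : IsEigenvalueSequence (pauliOperator B R h m) lam) (k : ℕ) :
    2 * h * B * k ≤ lam k := by
  obtain ⟨e, he, hegraph⟩ := hlam.exists_orthonormal (fun u f v g => pauliOperator_symmetric u f v g)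
    (k + 1)
  have hE : Submodule.span ℂ (Set.range e) ≤ formDomain B R h m := by
    rw [Submodule.span_le]
    rintro _ ⟨j, rfl⟩
    obtain ⟨g, w, h1, -⟩ := exists_energy_of_mem_graph (hegraph j)
    exact ⟨g, w, h1⟩
  -- On the span of the first `k + 1` eigenvectors the energy is at most `lam k ‖u‖²`, which is
  -- compared with the lower bound at this `u`.
  obtain ⟨u, huE, hu0, g, w, hu, hle⟩ := exists_mem_mul_norm_sq_le hR hB hh k m _ hE
    ⟨e, he.linearIndependent, fun j => Submodule.subset_span ⟨j, rfl⟩⟩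
  obtain ⟨c, hc⟩ := (Submodule.mem_span_range_iff_exists_fun ℂ).1 huE
  have hgraph : (u, ∑ j, c j • (lam j : ℂ) • e j) ∈ (pauliOperator B R h m).graph := by
    have := Submodule.sum_mem (pauliOperator B R h m).graph (t := Finset.univ)
      (f := fun j => c j • (e j, (lam j : ℂ) • e j)) fun j _ => Submodule.smul_mem _ _ (hegraph j)
    convert this using 1
    rw [← hc]
    ext1
    · simp [Prod.fst_sum]
    · simp [Prod.snd_sum]
  obtain ⟨g', w', hu', hen⟩ := energy_of_mem_graph hR hh.ne' hgraph
  have huniq : g - g' = 0 ∧ w - w' = 0 := by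
    refine deriv_unique B R h m _ _ ?_
    have := hu.add (hu'.smul (-1))
    simpa [← sub_eq_add_neg] using this
  obtain rfl := sub_eq_zero.1 huniq.1
  obtain rfl := sub_eq_zero.1 huniq.2
  have hinner : (⟪u, ∑ j, c j • (lam j : ℂ) • e j⟫_ℂ).re = ∑ j : Fin (k + 1), lam j * ‖c j‖ ^ 2 := by
    rw [← hc]
    simp_rw [smul_smul]
    rw [he.inner_sum, Complex.re_sum]
    refine Finset.sum_congr rfl fun j _ => ?_
    rw [← mul_assoc, ← Complex.normSq_eq_conj_mul_self, ← Complex.ofReal_mul, Complex.ofReal_re,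
      Complex.normSq_eq_norm_sq, mul_comm]
  have hnorm : ‖u‖ ^ 2 = ∑ j : Fin (k + 1), ‖c j‖ ^ 2 := by
    have h1 : (⟪u, u⟫_ℂ).re = ∑ j : Fin (k + 1), ‖c j‖ ^ 2 := by
      rw [← hc, he.inner_sum, Complex.re_sum]
      refine Finset.sum_congr rfl fun j _ => ?_
      rw [← Complex.normSq_eq_conj_mul_self, Complex.ofReal_re, Complex.normSq_eq_norm_sq]
    rw [← h1, inner_self_eq_norm_sq_to_K]
    norm_cast
  have hup : h ^ 2 * ‖g - w‖ ^ 2 ≤ lam k * ‖u‖ ^ 2 := by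
    rw [hen, hinner, hnorm, Finset.mul_sum]
    refine Finset.sum_le_sum fun j _ => mul_le_mul_of_nonneg_right (hlam.monotone ?_) (sq_nonneg _)
    exact Nat.lt_succ_iff.1 j.2
  have hpos : 0 < ‖u‖ ^ 2 := by positivity
  refine le_of_mul_le_mul_right ?_ hpos
  refine le_trans ?_ hup
  calc 2 * h * B * k * ‖u‖ ^ 2 = h ^ 2 * (2 * (B / h) * k * ‖u‖ ^ 2) := by
        field_simp
    _ ≤ _ := mul_le_mul_of_nonneg_left hle (sq_nonneg h)

/-! ### Gaussian moments and Laplace-type integrals. -/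

section GaussianIntegrals

theorem integrableOn_pow_mul_exp_neg {b : ℝ} (hb : 0 < b) (n : ℕ) :
    IntegrableOn (fun r : ℝ => r ^ n * Real.exp (-(b * r ^ 2))) (Ioi 0) := by
  have h := integrableOn_rpow_mul_exp_neg_mul_sq hb (s := n) (by
    have : (0 : ℝ) ≤ n := n.cast_nonneg
    linarith)
  refine h.congr_fun (fun r _ => ?_) measurableSet_Ioi
  simp only [Real.rpow_natCast, neg_mul]

theorem integral_pow_mul_exp_neg {b : ℝ} (hb : 0 < b) (m : ℕ) :
    ∫ r in Ioi (0 : ℝ), r ^ (2 * m + 1) * Real.exp (-(b * r ^ 2)) =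
      m.factorial / (2 * b ^ (m + 1)) := by
  have h := integral_rpow_mul_exp_neg_mul_rpow (p := 2) (q := (2 * m + 1 : ℕ)) (b := b) (by norm_num)
    (by
      have : (0 : ℝ) ≤ ((2 * m + 1 : ℕ) : ℝ) := Nat.cast_nonneg _
      linarith) hb
  have e1 : (((2 * m + 1 : ℕ) : ℝ) + 1) / 2 = m + 1 := by
    push_cast
    ring
  have e2 : -(((2 * m + 1 : ℕ) : ℝ) + 1) / 2 = -((m + 1 : ℕ) : ℝ) := by
    push_cast
    ring
  rw [e1, e2, Real.Gamma_nat_eq_factorial, Real.rpow_neg hb.le, Real.rpow_natCast] at h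
  have h2 : ∫ r in Ioi (0 : ℝ), r ^ (2 * m + 1) * Real.exp (-(b * r ^ 2)) =
      ∫ r in Ioi (0 : ℝ), r ^ ((2 * m + 1 : ℕ) : ℝ) * Real.exp (-b * r ^ (2 : ℝ)) := by
    refine setIntegral_congr_fun measurableSet_Ioi fun r _ => ?_
    simp only [Real.rpow_natCast, neg_mul, Real.rpow_ofNat]
  rw [h2, h]
  field_simp

theorem setIntegral_pow_mul_exp_neg_le {b : ℝ} (hb : 0 < b) (m : ℕ) (R : ℝ) :
    ∫ r in Ioo 0 R, r ^ (2 * m + 1) * Real.exp (-(b * r ^ 2)) ≤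
      m.factorial / (2 * b ^ (m + 1)) := by
  rw [← integral_pow_mul_exp_neg hb]
  refine setIntegral_mono_set (integrableOn_pow_mul_exp_neg hb _) ?_
    (Eventually.of_forall Ioo_subset_Ioi_self)
  filter_upwards [ae_restrict_mem measurableSet_Ioi] with r hr
  have : (0 : ℝ) < r := hr
  positivity

/-- On the tail `r ≥ R` the factor `r²/R²` is at least `1`, so the tail is at most the next moment
over `R²`; consecutive moments have ratio `(m + 1)/b`. -/
theorem le_setIntegral_pow_mul_exp_neg {b : ℝ} (hb : 0 < b) (m : ℕ) {R : ℝ} (hR : 0 < R) :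
    m.factorial / (2 * b ^ (m + 1)) * (1 - (m + 1) / (b * R ^ 2)) ≤
      ∫ r in Ioo 0 R, r ^ (2 * m + 1) * Real.exp (-(b * r ^ 2)) := by
  have hI := integrableOn_pow_mul_exp_neg hb (2 * m + 1)
  have hI2 := integrableOn_pow_mul_exp_neg hb (2 * (m + 1) + 1)
  have hdis : Disjoint (Ioo 0 R) (Ici R) :=
    Set.disjoint_left.2 fun x hx hx' => absurd hx.2 (not_lt.2 hx')
  have hun : Ioi (0 : ℝ) = Ioo 0 R ∪ Ici R := (Ioo_union_Ici_eq_Ioi hR).symm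
  have hsub : Ici R ⊆ Ioi 0 := fun x hx => hR.trans_le hx
  have h1 := setIntegral_union (μ := volume) hdis measurableSet_Ici
    (hI.mono_set Ioo_subset_Ioi_self) (hI.mono_set hsub)
  rw [← hun, integral_pow_mul_exp_neg hb] at h1
  have h2 : ∫ r in Ici R, r ^ (2 * m + 1) * Real.exp (-(b * r ^ 2)) ≤
      ∫ r in Ici R, (R ^ 2)⁻¹ * (r ^ (2 * (m + 1) + 1) * Real.exp (-(b * r ^ 2))) := by
    refine setIntegral_mono_on (hI.mono_set hsub) ((hI2.mono_set hsub).const_mul _)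
      measurableSet_Ici fun r hr => ?_
    have hr0 : 0 < r := hsub hr
    have h3 : R ^ 2 ≤ r ^ 2 := pow_le_pow_left₀ hR.le hr 2
    rw [inv_mul_eq_div, le_div_iff₀ (by positivity)]
    calc r ^ (2 * m + 1) * Real.exp (-(b * r ^ 2)) * R ^ 2
        ≤ r ^ (2 * m + 1) * Real.exp (-(b * r ^ 2)) * r ^ 2 :=
          mul_le_mul_of_nonneg_left h3 (by positivity)
      _ = _ := by ring
  have h4 : ∫ r in Ici R, r ^ (2 * (m + 1) + 1) * Real.exp (-(b * r ^ 2)) ≤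
      (m + 1).factorial / (2 * b ^ (m + 1 + 1)) := by
    rw [← integral_pow_mul_exp_neg hb]
    refine setIntegral_mono_set hI2 ?_ (Eventually.of_forall hsub)
    filter_upwards [ae_restrict_mem measurableSet_Ioi] with r hr
    have : (0 : ℝ) < r := hr
    positivity
  rw [integral_const_mul] at h2
  have h5 := mul_le_mul_of_nonneg_left h4 (by positivity : 0 ≤ (R ^ 2)⁻¹)
  have h6 : (R ^ 2)⁻¹ * ((m + 1).factorial / (2 * b ^ (m + 1 + 1))) =
      m.factorial / (2 * b ^ (m + 1)) * ((m + 1) / (b * R ^ 2)) := by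
    rw [Nat.factorial_succ]
    push_cast
    field_simp
    ring
  rw [h6] at h5
  rw [mul_sub, mul_one]
  linarith

/-- `x^(m+1) e^{-x} ≤ (m+2)! / x`. -/
theorem pow_mul_exp_neg_le (m : ℕ) {x : ℝ} (hx : 0 < x) :
    x ^ (m + 1) * Real.exp (-x) ≤ (m + 2).factorial / x := by
  have h := Real.pow_div_factorial_le_exp x hx.le (m + 2)
  rw [div_le_iff₀ (by positivity)] at h
  rw [Real.exp_neg, ← div_eq_mul_inv, div_le_div_iff₀ (Real.exp_pos x) hx]
  calc x ^ (m + 1) * x = x ^ (m + 2) := by ring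
    _ ≤ _ := by linarith

/-- With `x = bs²`, the comparison function `G` is the leading asymptotic primitive times `1 +
2(m+1)/x`, twice the true next coefficient. The surplus gives `G'` the factor `1 + (m+1)/x -
2(m+1)(m+2)/x²`, which is at least `1` once `x ≥ 2(m+2)`. -/
theorem integral_pow_inv_mul_exp_le_of_le {b : ℝ} (hb : 0 < b) (m : ℕ) {r R : ℝ} (hr : 0 < r)
    (hrR : r ≤ R) (hc : 2 * (m + 2) ≤ b * r ^ 2) :
    ∫ s in r..R, (s ^ (2 * m + 1))⁻¹ * Real.exp (b * s ^ 2) ≤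
      Real.exp (b * R ^ 2) / (2 * b * R ^ (2 * m + 2)) * (1 + 2 * (m + 1) / (b * R ^ 2)) := by
  set G : ℝ → ℝ := fun s => Real.exp (b * s ^ 2) / (2 * b * s ^ (2 * m + 2)) *
    (1 + 2 * (m + 1) / (b * s ^ 2)) with hG
  set G' : ℝ → ℝ := fun s => (s ^ (2 * m + 1))⁻¹ * Real.exp (b * s ^ 2) *
    (1 + (m + 1) / (b * s ^ 2) - 2 * (m + 1) * (m + 2) / (b * s ^ 2) ^ 2) with hG'
  have hder : ∀ s, 0 < s → HasDerivAt G (G' s) s := by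
    intro s hs
    have h1 : HasDerivAt (fun s : ℝ => b * s ^ 2) (b * (2 * s)) s := by
      simpa using (hasDerivAt_pow 2 s).const_mul b
    have h2 := (hasDerivAt_pow (2 * m + 2) s).const_mul (2 * b)
    have h3 := (h1.exp.div h2 (by positivity)).mul
      (((hasDerivAt_const s (2 * (m + 1) : ℝ)).div h1 (by positivity)).const_add 1)
    convert! h3 using 1
    simp only [hG', Pi.div_apply]
    push_cast
    field_simp
    ring
  have hint : IntegrableOn (fun s : ℝ => (s ^ (2 * m + 1))⁻¹ * Real.exp (b * s ^ 2)) (Icc r R) := by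
    refine ContinuousOn.integrableOn_Icc ?_
    refine ContinuousOn.mul ?_ (by fun_prop)
    exact (continuousOn_pow _).inv₀ fun s hs => (pow_pos (hr.trans_le hs.1) _).ne'
  have h := intervalIntegral.integral_le_sub_of_hasDeriv_right_of_le hrR
    (fun s hs => (hder s (hr.trans_le hs.1)).continuousAt.continuousWithinAt)
    (fun s hs => (hder s (hr.trans hs.1)).hasDerivWithinAt) hint (fun s hs => by
      have hs0 : 0 < s := hr.trans hs.1
      have hx : 2 * (m + 2) ≤ b * s ^ 2 := hc.trans
        (mul_le_mul_of_nonneg_left (pow_le_pow_left₀ hr.le hs.1.le 2) hb.le)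
      have hx0 : 0 < b * s ^ 2 := by positivity
      have h4 : 2 * (m + 1) * (m + 2) / (b * s ^ 2) ^ 2 ≤ ((m : ℝ) + 1) / (b * s ^ 2) := by
        rw [div_le_div_iff₀ (by positivity) hx0]
        have hm : (0 : ℝ) < m + 1 := by positivity
        have : 2 * (m + 1) * (m + 2) * (b * s ^ 2) = (m + 1) * (b * s ^ 2) * (2 * (m + 2)) := by ring
        rw [this]
        calc (m + 1) * (b * s ^ 2) * (2 * (m + 2)) ≤ (m + 1) * (b * s ^ 2) * (b * s ^ 2) :=
              mul_le_mul_of_nonneg_left hx (by positivity)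
          _ = _ := by ring
      simp only [hG']
      refine le_mul_of_one_le_right (by positivity) ?_
      linarith)
  have hGr : 0 ≤ G r := by
    simp only [hG]
    positivity
  linarith

/-- The first term is the contribution of the end `R`. Where `bs² < 2(m+2)` the exponential is
bounded, and the singularity at `0` costs the second term. -/
theorem integral_pow_inv_mul_exp_le {b : ℝ} (hb : 0 < b) (m : ℕ) {r R : ℝ} (hr : r ∈ Ioo 0 R)
    (hR : 2 * (m + 2) ≤ b * R ^ 2) :
    ∫ s in r..R, (s ^ (2 * m + 1))⁻¹ * Real.exp (b * s ^ 2) ≤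
      Real.exp (b * R ^ 2) / (2 * b * R ^ (2 * m + 2)) * (1 + 2 * (m + 1) / (b * R ^ 2)) +
        Real.exp (2 * (m + 2)) * √(2 * (m + 2) / b) * (r ^ (2 * m + 1))⁻¹ := by
  have hr0 := hr.1
  have hR0 : 0 < R := hr.1.trans hr.2
  by_cases hc : 2 * (m + 2) ≤ b * r ^ 2
  · refine (integral_pow_inv_mul_exp_le_of_le hb m hr.1 hr.2.le hc).trans ?_
    have : 0 ≤ Real.exp (2 * (m + 2)) * √(2 * (m + 2) / b) * (r ^ (2 * m + 1))⁻¹ := by positivity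
    linarith
  push Not at hc
  set t := √(2 * (m + 2) / b) with ht
  have ht2 : b * t ^ 2 = 2 * (m + 2) := by
    rw [ht, Real.sq_sqrt (by positivity)]
    field_simp
  have ht0 : 0 < t := Real.sqrt_pos.2 (by positivity)
  have hrt : r ≤ t := by
    refine le_of_sq_le_sq ?_ ht0.le
    nlinarith
  have htR : t ≤ R := by
    refine le_of_sq_le_sq ?_ hR0.le
    nlinarith
  have hcont : ∀ x y : ℝ, 0 < x → x ≤ y → IntervalIntegrable
      (fun s : ℝ => (s ^ (2 * m + 1))⁻¹ * Real.exp (b * s ^ 2)) volume x y := by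
    intro x y hx hxy
    refine ContinuousOn.intervalIntegrable_of_Icc hxy ?_
    refine ContinuousOn.mul ?_ (by fun_prop)
    exact (continuousOn_pow _).inv₀ fun s hs => (pow_pos (hx.trans_le hs.1) _).ne'
  rw [← intervalIntegral.integral_add_adjacent_intervals (hcont r t hr0 hrt) (hcont t R ht0 htR)]
  have h1 := integral_pow_inv_mul_exp_le_of_le hb m ht0 htR ht2.ge
  have h2 : ∫ s in r..t, (s ^ (2 * m + 1))⁻¹ * Real.exp (b * s ^ 2) ≤
      -(Real.exp (2 * (m + 2)) * t * (t ^ (2 * m + 1))⁻¹) -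
        -(Real.exp (2 * (m + 2)) * t * (r ^ (2 * m + 1))⁻¹) := by
    have hder : ∀ s, 0 < s → HasDerivAt
        (fun s : ℝ => -(Real.exp (2 * (m + 2)) * t * (s ^ (2 * m + 1))⁻¹))
        (Real.exp (2 * (m + 2)) * t * (2 * m + 1) * (s ^ (2 * m + 2))⁻¹) s := by
      intro s hs
      have h3 := (((hasDerivAt_pow (2 * m + 1) s).inv (by positivity)).const_mul
        (Real.exp (2 * (m + 2)) * t)).neg
      convert! h3 using 1
      push_cast
      field_simp
      ring
    refine intervalIntegral.integral_le_sub_of_hasDeriv_right_of_le hrt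
      (fun s hs => (hder s (hr0.trans_le hs.1)).continuousAt.continuousWithinAt)
      (fun s hs => (hder s (hr0.trans hs.1)).hasDerivWithinAt)
      ((intervalIntegrable_iff_integrableOn_Icc_of_le hrt).1 (hcont r t hr0 hrt)) fun s hs => ?_
    have hs0 : 0 < s := hr0.trans hs.1
    have h4 : Real.exp (b * s ^ 2) ≤ Real.exp (2 * (m + 2)) := by
      rw [← ht2]
      exact Real.exp_le_exp.2 (mul_le_mul_of_nonneg_left
        (pow_le_pow_left₀ hs0.le hs.2.le 2) hb.le)
    -- Trading one power of `s` for the bound `s ≤ t` avoids the logarithm that `m = 0` would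
    -- produce.
    have h5 : (s ^ (2 * m + 1))⁻¹ = s * (s ^ (2 * m + 2))⁻¹ := by
      field_simp
      ring
    rw [h5]
    calc s * (s ^ (2 * m + 2))⁻¹ * Real.exp (b * s ^ 2)
        ≤ t * (s ^ (2 * m + 2))⁻¹ * Real.exp (2 * (m + 2)) := by
          refine mul_le_mul (mul_le_mul_of_nonneg_right hs.2.le (by positivity)) h4 (by positivity)
            (by positivity)
      _ = Real.exp (2 * (m + 2)) * t * 1 * (s ^ (2 * m + 2))⁻¹ := by ring
      _ ≤ Real.exp (2 * (m + 2)) * t * (2 * m + 1) * (s ^ (2 * m + 2))⁻¹ := by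
          refine mul_le_mul_of_nonneg_right (mul_le_mul_of_nonneg_left ?_ (by positivity))
            (by positivity)
          have : (0 : ℝ) ≤ m := m.cast_nonneg
          linarith
  have h6 : 0 ≤ Real.exp (2 * (m + 2)) * t * (t ^ (2 * m + 1))⁻¹ := by positivity
  linarith

end GaussianIntegrals

/-! ### The Hardy inequality and the lower bound for the ground state. -/

theorem hasDerivAt_pow_inv_mul_exp (b : ℝ) (m : ℕ) {r : ℝ} (hr : r ≠ 0) :
    HasDerivAt (fun r : ℝ => (r ^ m)⁻¹ * Real.exp (b * r ^ 2 / 2))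
      (-(m / r - b * r) * ((r ^ m)⁻¹ * Real.exp (b * r ^ 2 / 2))) r := by
  have h1 : HasDerivAt (fun r : ℝ => b * r ^ 2 / 2) (b * r) r := by
    have := ((hasDerivAt_pow 2 r).const_mul b).div_const 2
    convert! this using 1
    norm_num
    ring
  have h2 := ((hasDerivAt_pow m r).inv (pow_ne_zero _ hr)).mul h1.exp
  convert! h2 using 1
  rcases m with _ | m
  · simp
    ring
  · simp only [Pi.inv_apply]
    push_cast
    field_simp
    ring

/-- Dividing by the zero mode turns the annihilation operator into a derivative, and the
Cauchy-Schwarz inequality gives a pointwise bound. -/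
theorem IsMagneticGradient.sq_norm_primitive_le {B h : ℝ} {m : ℕ} {u g w : RadialL2 R}
    (hu : IsMagneticGradient B R h m u g w) {r : ℝ} (hr : r ∈ Ioo 0 R) :
    ‖∫ s in r..R, g s‖ ^ 2 ≤ r ^ (2 * m) * Real.exp (-(B / (2 * h) * r ^ 2)) *
      ((∫ s in r..R, (s ^ (2 * m + 1))⁻¹ * Real.exp (B / (2 * h) * s ^ 2)) * ‖g - w‖ ^ 2) := by
  have hab := ae_Ioo_iff.1 hu.angular
  set b : ℝ := B / (2 * h) with hb
  set ψ : ℝ → ℝ := fun s => (s ^ m)⁻¹ * Real.exp (b * s ^ 2 / 2) with hψ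
  have hψc : ContinuousOn ψ (Icc r R) := fun s hs =>
    (hasDerivAt_pow_inv_mul_exp b m (hr.1.trans_le hs.1).ne').continuousAt.continuousWithinAt
  have hψ'c : ContinuousOn (fun s => -(m / s - b * s) * ψ s) (Icc r R) := by
    refine ContinuousOn.mul ?_ hψc
    refine ContinuousOn.neg (ContinuousOn.sub ?_ (by fun_prop))
    exact continuousOn_const.div continuousOn_id fun s hs => (hr.1.trans_le hs.1).ne'
  have hψ'i : IntervalIntegrable (fun s => ((-(m / s - b * s) * ψ s : ℝ) : ℂ)) volume r R :=
    (Complex.continuous_ofReal.comp_continuousOn hψ'c).intervalIntegrable_of_Icc hr.2.le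
  have hG : ∀ x ∈ Icc r R, (ψ x : ℂ) = ψ R - ∫ s in x..R, ((-(m / s - b * s) * ψ s : ℝ) : ℂ) := by
    intro x hx
    rw [intervalIntegral.integral_eq_sub_of_hasDerivAt (f := fun s => (ψ s : ℂ))]
    · ring
    · intro s hs
      rw [uIcc_of_le hx.2] at hs
      exact (hasDerivAt_pow_inv_mul_exp b m
        (hr.1.trans_le (hx.1.trans hs.1)).ne').ofReal_comp
    · refine hψ'i.mono_set ?_
      rw [uIcc_of_le hx.2, uIcc_of_le hr.2.le]
      exact Icc_subset_Icc_left hx.1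
  have key := primitive_mul (F := fun x => -∫ s in x..R, g s) (intervalIntegrable R g hr) hψ'i
    (fun x _ => by simp) hG r ⟨le_rfl, hr.2.le⟩
  -- `ψ` is the reciprocal of the zero mode, so `(ψ u)' = ψ (u' - (m/s - bs) u) = ψ (g - w)`.
  have hcongr : ∫ s in r..R, (g s * ψ s +
      (-∫ t in s..R, g t) * ((-(m / s - b * s) * ψ s : ℝ) : ℂ)) =
      ∫ s in r..R, (ψ s : ℂ) * (g - w) s := by
    rw [intervalIntegral.integral_of_le hr.2.le, intervalIntegral.integral_of_le hr.2.le,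
      integral_Ioc_eq_integral_Ioo, integral_Ioc_eq_integral_Ioo]
    refine integral_congr_ae (ae_restrict_of_ae_restrict_of_subset
      (Ioo_subset_Ioo_left hr.1.le) ?_)
    filter_upwards [hu.ae_eq_primitive, hab, ae_Ioo_iff.1 (Lp.coeFn_sub g w),
      ae_restrict_mem measurableSet_Ioo] with s h1 h2 h3 hs
    have hs0 : (s : ℂ) ≠ 0 := by exact_mod_cast hs.1.ne'
    rw [h3, Pi.sub_apply, h2, ← h1]
    have e : ((m : ℤ) : ℝ) / s - B * s / (2 * h) = m / s - b * s := by
      rw [hb]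
      push_cast
      ring
    rw [e]
    push_cast
    ring
  rw [hcongr, intervalIntegral.integral_same, neg_zero, zero_mul, zero_sub] at key
  have h4 := sq_norm_intervalIntegral_mul_le (g - w) hr.1 hr.2.le le_rfl hψc
  have hψr : 0 < ψ r := mul_pos (inv_pos.2 (pow_pos hr.1 m)) (Real.exp_pos _)
  have h5 : ‖∫ s in r..R, g s‖ ^ 2 * ψ r ^ 2 = ‖∫ s in r..R, (ψ s : ℂ) * (g - w) s‖ ^ 2 := by
    rw [← norm_neg (∫ s in r..R, (ψ s : ℂ) * (g - w) s), ← key, norm_mul, norm_neg,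
      Complex.norm_real, Real.norm_of_nonneg hψr.le, ← mul_pow]
  have h6 : ∫ s in r..R, ψ s ^ 2 / s =
      ∫ s in r..R, (s ^ (2 * m + 1))⁻¹ * Real.exp (b * s ^ 2) := by
    congr 1
    ext s
    rw [hψ]
    simp only
    rw [mul_pow, ← Real.exp_nat_mul, inv_pow, ← pow_mul, pow_succ s (2 * m), mul_comm m 2, mul_inv]
    have : ((2 : ℕ) : ℝ) * (b * s ^ 2 / 2) = b * s ^ 2 := by
      push_cast
      ring
    rw [this]
    ring
  have h7 : r ^ (2 * m) * Real.exp (-(b * r ^ 2)) * ψ r ^ 2 = 1 := by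
    have hr0 := hr.1.ne'
    rw [hψ]
    simp only
    rw [mul_pow, ← Real.exp_nat_mul, inv_pow, ← pow_mul, mul_comm m 2]
    have : ((2 : ℕ) : ℝ) * (b * r ^ 2 / 2) = b * r ^ 2 := by
      push_cast
      ring
    rw [this, Real.exp_neg]
    field_simp
  rw [← h6]
  refine le_of_mul_le_mul_right ?_ (pow_pos hψr 2)
  rw [h5]
  calc _ ≤ _ := h4
    _ = r ^ (2 * m) * Real.exp (-(b * r ^ 2)) * ψ r ^ 2 *
        ((∫ s in r..R, ψ s ^ 2 / s) * ‖g - w‖ ^ 2) := by rw [h7, one_mul]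
    _ = _ := by ring

theorem setIntegral_exp_neg_le {b : ℝ} (hb : 0 < b) (R : ℝ) :
    ∫ r in Ioo 0 R, Real.exp (-(b * r ^ 2)) ≤ √(Real.pi / b) / 2 := by
  rw [← integral_gaussian_Ioi]
  simp only [neg_mul]
  refine setIntegral_mono_set ?_ (Eventually.of_forall fun r => (Real.exp_pos _).le)
    (Eventually.of_forall Ioo_subset_Ioi_self)
  simpa using integrableOn_pow_mul_exp_neg hb 0

/-- The weighted Hardy inequality behind the lower bound for the lowest eigenvalue. -/
theorem IsMagneticGradient.norm_sq_le {B h : ℝ} (hb : 0 < B / (2 * h)) {m : ℕ}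
    (hc : 2 * (m + 2) ≤ B / (2 * h) * R ^ 2) {u g w : RadialL2 R}
    (hu : IsMagneticGradient B R h m u g w) :
    ‖u‖ ^ 2 ≤ ‖g - w‖ ^ 2 * (Real.exp (B / (2 * h) * R ^ 2) / (2 * (B / (2 * h)) * R ^ (2 * m + 2)) *
      (1 + 2 * (m + 1) / (B / (2 * h) * R ^ 2)) * (m.factorial / (2 * (B / (2 * h)) ^ (m + 1))) +
      Real.exp (2 * (m + 2)) * √(2 * (m + 2) / (B / (2 * h))) *
        (√(Real.pi / (B / (2 * h))) / 2)) := by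
  have hpt := fun r hr => hu.sq_norm_primitive_le (r := r) hr
  have hpr := hu.ae_eq_primitive
  set b : ℝ := B / (2 * h)
  -- For `R ≤ 0` the interval is empty and `u = 0`; the condition `hc` still gives `R² > 0`, so the
  -- right side is nonnegative.
  rcases le_or_gt R 0 with hR0 | hR0
  · have : ‖u‖ ^ 2 = 0 := by
      rw [norm_sq_eq_integral, Ioo_eq_empty (not_lt.2 hR0)]
      simp
    rw [this]
    have : 0 < R ^ 2 := by
      have : (0 : ℝ) < 2 * (m + 2) := by positivity
      by_contra hn
      have := mul_nonpos_of_nonneg_of_nonpos hb.le (not_lt.1 hn)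
      linarith
    have h2 : 0 < R ^ (2 * m + 2) := by
      rw [show 2 * m + 2 = 2 * (m + 1) by ring, pow_mul]
      positivity
    positivity
  set E := Real.exp (b * R ^ 2) / (2 * b * R ^ (2 * m + 2)) * (1 + 2 * (m + 1) / (b * R ^ 2))
  set K := Real.exp (2 * (m + 2)) * √(2 * (m + 2) / b)
  have hE : 0 ≤ E := by positivity
  have hK : 0 ≤ K := by positivity
  have i1 : IntegrableOn (fun r : ℝ => r ^ (2 * m + 1) * Real.exp (-(b * r ^ 2))) (Ioo 0 R) :=
    (integrableOn_pow_mul_exp_neg hb _).mono_set Ioo_subset_Ioi_self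
  have i2 : IntegrableOn (fun r : ℝ => Real.exp (-(b * r ^ 2))) (Ioo 0 R) := by
    simpa using (integrableOn_pow_mul_exp_neg hb 0).mono_set Ioo_subset_Ioi_self
  rw [norm_sq_eq_integral]
  have h1 : ∫ r in Ioo 0 R, r * ‖u r‖ ^ 2 ≤ ∫ r in Ioo 0 R,
      ‖g - w‖ ^ 2 * (E * (r ^ (2 * m + 1) * Real.exp (-(b * r ^ 2))) +
        K * Real.exp (-(b * r ^ 2))) := by
    refine setIntegral_mono_ae_restrict (integrableOn_norm_sq u)
      (((i1.const_mul E).add (i2.const_mul K)).const_mul _) ?_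
    filter_upwards [hpr, ae_restrict_mem measurableSet_Ioo] with r h2 hr
    have hr0 : 0 < r := hr.1
    rw [h2, norm_neg]
    have h3 := integral_pow_inv_mul_exp_le hb m hr hc
    calc r * ‖∫ s in r..R, g s‖ ^ 2
        ≤ r * (r ^ (2 * m) * Real.exp (-(b * r ^ 2)) *
          ((E + K * (r ^ (2 * m + 1))⁻¹) * ‖g - w‖ ^ 2)) := by
          refine mul_le_mul_of_nonneg_left ((hpt r hr).trans ?_) hr0.le
          refine mul_le_mul_of_nonneg_left ?_ (by positivity)
          exact mul_le_mul_of_nonneg_right h3 (sq_nonneg _)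
      _ = _ := by
          -- The weight `r` and the squared zero mode cancel the singular factor `(r ^ (2 * m +
          -- 1))⁻¹`, leaving a plain Gaussian.
          have h4 : r * r ^ (2 * m) = r ^ (2 * m + 1) := by ring
          have h5 : r ^ (2 * m + 1) * (r ^ (2 * m + 1))⁻¹ = 1 := mul_inv_cancel₀ (by positivity)
          calc _ = (r * r ^ (2 * m)) * Real.exp (-(b * r ^ 2)) *
                ((E + K * (r ^ (2 * m + 1))⁻¹) * ‖g - w‖ ^ 2) := by ring
            _ = ‖g - w‖ ^ 2 * (E * (r ^ (2 * m + 1) * Real.exp (-(b * r ^ 2))) +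
                K * Real.exp (-(b * r ^ 2)) * (r ^ (2 * m + 1) * (r ^ (2 * m + 1))⁻¹)) := by
              rw [h4]
              ring
            _ = _ := by rw [h5, mul_one]
  refine h1.trans ?_
  rw [integral_const_mul, integral_add (i1.const_mul E) (i2.const_mul K), integral_const_mul,
    integral_const_mul]
  refine mul_le_mul_of_nonneg_left ?_ (sq_nonneg _)
  exact add_le_add (mul_le_mul_of_nonneg_left (setIntegral_pow_mul_exp_neg_le hb m R) hE)
    (mul_le_mul_of_nonneg_left (setIntegral_exp_neg_le hb R) hK)

/-- The leading term of the lowest eigenvalue for nonnegative angular momentum. -/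
noncomputable def groundEnergy (B R h : ℝ) (m : ℕ) : ℝ :=
  2 * h * B * ((B * R ^ 2 / (2 * h)) ^ (m + 1) / (m.factorial : ℝ)) *
    Real.exp (-(B * R ^ 2) / (2 * h))

theorem groundEnergy_pos {B h : ℝ} (hR : 0 < R) (hB : 0 < B) (hh : 0 < h) (m : ℕ) :
    0 < groundEnergy B R h m := by
  unfold groundEnergy
  positivity

theorem groundEnergy_eq {B h : ℝ} (hh : h ≠ 0) (m : ℕ) :
    groundEnergy B R h m = h ^ 2 * (4 * (B / (2 * h)) *
      ((B / (2 * h) * R ^ 2) ^ (m + 1) / m.factorial) * Real.exp (-(B / (2 * h) * R ^ 2))) := by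
  have e1 : B * R ^ 2 / (2 * h) = B / (2 * h) * R ^ 2 := by ring
  have e2 : 2 * h * B = h ^ 2 * (4 * (B / (2 * h))) := by
    field_simp
    ring
  rw [groundEnergy, neg_div, e1, e2]
  ring

/-- Multiplied by the leading term, the main part of the Hardy constant is exactly `1 + 2(m+1)/ρ`.
The remaining part is of size `ρ^(m+1) e^(-ρ)`, absorbed into `1/ρ`, so `C` depends on `m` only. -/
theorem exists_groundEnergy_le (m : ℕ) : ∃ C : ℝ, 0 ≤ C ∧ ∀ {R B h : ℝ} {lam : ℕ → ℝ}, 0 < R →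
    0 < B → 0 < h → 2 * (m + 2) ≤ B / (2 * h) * R ^ 2 →
    IsEigenvalueSequence (pauliOperator B R h m) lam →
    groundEnergy B R h m ≤ lam 0 * (1 + C / (B / (2 * h) * R ^ 2)) := by
  set κ : ℝ := Real.exp (2 * (m + 2)) * √(2 * (m + 2)) * √Real.pi / 2
  have hκ : 0 ≤ κ := by positivity
  refine ⟨2 * (m + 1) + 4 * κ * (m + 2).factorial / m.factorial, by positivity, ?_⟩
  intro R B h lam hR hB hh hc hlam
  have hb : 0 < B / (2 * h) := by positivity
  obtain ⟨u, hu0, hu⟩ := hlam.exists_eigenvector 0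
  obtain ⟨g, w, h1, h2⟩ := energy_of_mem_graph hR hh.ne' hu
  rw [re_inner_smul_self] at h2
  have h3 := h1.norm_sq_le hb hc
  rw [groundEnergy_eq hh.ne']
  set b := B / (2 * h)
  set ρ := b * R ^ 2 with hρ
  have hρ0 : 0 < ρ := by positivity
  have h4 : Real.exp (2 * (m + 2)) * √(2 * (m + 2) / b) * (√(Real.pi / b) / 2) = κ / b := by
    have hbb : √b * √b = b := Real.mul_self_sqrt hb.le
    have hb0 : √b ≠ 0 := (Real.sqrt_pos.2 hb).ne'
    rw [Real.sqrt_div' _ hb.le, Real.sqrt_div' _ hb.le]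
    nth_rewrite 3 [← hbb]
    simp only [κ]
    field_simp
  rw [h4] at h3
  have hρp : ρ ^ (m + 1) = b ^ (m + 1) * R ^ (2 * m + 2) := by
    rw [hρ, mul_pow, ← pow_mul]
    ring_nf
  have hexp : Real.exp ρ * Real.exp (-ρ) = 1 := by rw [← Real.exp_add, add_neg_cancel, Real.exp_zero]
  set t := 4 * b * (ρ ^ (m + 1) / m.factorial) * Real.exp (-ρ)
  have ht : 0 < t := by positivity
  have h5 : Real.exp ρ / (2 * b * R ^ (2 * m + 2)) * (1 + 2 * (m + 1) / ρ) *
      (m.factorial / (2 * b ^ (m + 1))) * t = 1 + 2 * (m + 1) / ρ := by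
    calc _ = (Real.exp ρ * Real.exp (-ρ)) * (1 + 2 * (m + 1) / ρ) *
          (m.factorial / (2 * b * R ^ (2 * m + 2) * (2 * b ^ (m + 1))) *
            (4 * b * (ρ ^ (m + 1) / m.factorial))) := by
          simp only [t]
          ring
      _ = _ := by
          rw [hexp, hρp]
          have : (m.factorial / (2 * b * R ^ (2 * m + 2) * (2 * b ^ (m + 1))) *
            (4 * b * (b ^ (m + 1) * R ^ (2 * m + 2) / m.factorial)) : ℝ) = 1 := by
            field_simp
            norm_num
          rw [this]
          ring
  have h6 : κ / b * t ≤ 4 * κ * (m + 2).factorial / m.factorial / ρ := by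
    have h7 := pow_mul_exp_neg_le m hρ0
    calc κ / b * t = 4 * κ / m.factorial * (ρ ^ (m + 1) * Real.exp (-ρ)) := by
          simp only [t]
          field_simp
      _ ≤ 4 * κ / m.factorial * ((m + 2).factorial / ρ) :=
          mul_le_mul_of_nonneg_left h7 (by positivity)
      _ = _ := by ring
  have hpos : 0 < ‖u‖ ^ 2 := by positivity
  refine le_of_mul_le_mul_right ?_ hpos
  calc h ^ 2 * t * ‖u‖ ^ 2 ≤ h ^ 2 * t * _ := mul_le_mul_of_nonneg_left h3 (by positivity)
    _ = h ^ 2 * ‖g - w‖ ^ 2 * (Real.exp ρ / (2 * b * R ^ (2 * m + 2)) * (1 + 2 * (m + 1) / ρ) *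
      (m.factorial / (2 * b ^ (m + 1))) * t + κ / b * t) := by ring
    _ ≤ h ^ 2 * ‖g - w‖ ^ 2 * (1 + 2 * (m + 1) / ρ +
        4 * κ * (m + 2).factorial / m.factorial / ρ) := by
      rw [h5]
      exact mul_le_mul_of_nonneg_left (by linarith) (by positivity)
    _ = _ := by
      rw [h2]
      ring

/-! ### The trial function and the upper bound for the ground state. -/

theorem exists_radialL2_of_continuous (R : ℝ) {f : ℝ → ℝ} (hf : Continuous f) :
    ∃ v : RadialL2 R, ∀ᵐ r ∂radialMeasure R, v r = (f r : ℂ) := by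
  have hfc : Continuous fun r => (f r : ℂ) := Complex.continuous_ofReal.comp hf
  have h : MemLp (fun r => (f r : ℂ)) 2 (radialMeasure R) := by
    refine memLp_radialMeasure_iff.2 ⟨hfc.aestronglyMeasurable, ?_⟩
    have : Continuous fun r : ℝ => r * ‖(f r : ℂ)‖ ^ 2 := by fun_prop
    exact (this.integrableOn_Icc (a := 0) (b := R)).mono_set Ioo_subset_Icc_self
  exact ⟨h.toLp _, h.coeFn_toLp⟩

theorem norm_sq_of_ae_eq {f : ℝ → ℝ} {v : RadialL2 R}
    (hv : ∀ᵐ r ∂radialMeasure R, v r = (f r : ℂ)) :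
    ‖v‖ ^ 2 = ∫ r in Ioo 0 R, r * f r ^ 2 := by
  rw [norm_sq_eq_integral]
  refine integral_congr_ae ?_
  filter_upwards [ae_Ioo_iff.1 hv] with r hr
  rw [hr, Complex.norm_real, Real.norm_eq_abs, sq_abs]

/-- The zero mode, corrected by its reflection so as to satisfy the Dirichlet condition. -/
theorem exists_trial (B R h : ℝ) (m : ℕ) : ∃ u g w, IsMagneticGradient B R h m u g w ∧
    (∀ᵐ r ∂radialMeasure R, u r = ((r ^ m * (Real.exp (-(B / (2 * h) * r ^ 2 / 2)) -
      Real.exp (B / (2 * h) * r ^ 2 / 2 - B / (2 * h) * R ^ 2)) : ℝ) : ℂ)) ∧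
    ∀ᵐ r ∂radialMeasure R, (g - w) r = ((-(2 * (B / (2 * h)) * r ^ (m + 1) *
      Real.exp (B / (2 * h) * r ^ 2 / 2 - B / (2 * h) * R ^ 2)) : ℝ) : ℂ) := by
  have hbe : ∀ r, B * r / (2 * h) = B / (2 * h) * r := fun r => by ring
  have hmag : ∀ u g w : RadialL2 R, (∀ᵐ r ∂radialMeasure R, u r = -∫ s in r..R, g s) →
      (∀ᵐ r ∂radialMeasure R, w r = ((m / r - B / (2 * h) * r : ℝ) : ℂ) * u r) →
      IsMagneticGradient B R h m u g w := fun u g w h1 h2 => ⟨h1, by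
    filter_upwards [h2] with r hr
    rw [hr, hbe, Int.cast_natCast]⟩
  set b := B / (2 * h)
  -- The second exponential is the first with `r²` replaced by `2R² - r²`, so `p` vanishes at `R`.
  set p : ℝ → ℝ := fun r => Real.exp (-(b * r ^ 2 / 2)) - Real.exp (b * r ^ 2 / 2 - b * R ^ 2) with hp
  set U : ℝ → ℝ := fun r => r ^ m * p r with hU
  -- `W = (m/r - br) U` without the division; at `m = 0` the truncated exponent `m - 1` is harmless
  -- because its coefficient is zero. The zero mode is annihilated, so `D = U' - W` comes from the
  -- reflected term alone.
  set W : ℝ → ℝ := fun r => (m * r ^ (m - 1) - b * r ^ (m + 1)) * p r with hW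
  set D : ℝ → ℝ := fun r => -(2 * b * r ^ (m + 1) * Real.exp (b * r ^ 2 / 2 - b * R ^ 2)) with hD
  have hpc : Continuous p := by fun_prop
  have hUc : Continuous U := by fun_prop
  have hWc : Continuous W := by fun_prop
  have hDc : Continuous D := by fun_prop
  have hder : ∀ r, HasDerivAt U ((W + D) r) r := by
    intro r
    have h0 : HasDerivAt (fun r : ℝ => b * r ^ 2 / 2) (b * r) r := by
      have := ((hasDerivAt_pow 2 r).const_mul b).div_const 2
      convert! this using 1
      norm_num
      ring
    have h1 := (hasDerivAt_pow m r).mul (h0.neg.exp.sub (h0.sub_const (b * R ^ 2)).exp)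
    convert! h1 using 1
    simp only [hW, hD, hp, Pi.sub_apply, Pi.neg_apply, Pi.add_apply]
    ring
  obtain ⟨u, hu⟩ := exists_radialL2_of_continuous R hUc
  obtain ⟨g, hg⟩ := exists_radialL2_of_continuous R (hWc.add hDc)
  obtain ⟨w, hw⟩ := exists_radialL2_of_continuous R hWc
  refine ⟨u, g, w, hmag u g w ?_ ?_, hu, ?_⟩
  · filter_upwards [hu, ae_mem_radialMeasure R] with r h1 hr
    rw [h1, intervalIntegral_congr_radial hg hr, intervalIntegral.integral_ofReal,
      intervalIntegral.integral_eq_sub_of_hasDerivAt (f := U) (fun x _ => hder x)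
        ((hWc.add hDc).intervalIntegrable _ _)]
    have : U R = 0 := by
      simp only [hU, hp]
      rw [show b * R ^ 2 / 2 - b * R ^ 2 = -(b * R ^ 2 / 2) by ring, sub_self, mul_zero]
    simp [this]
  · filter_upwards [hu, hw, ae_mem_radialMeasure R] with r h1 h2 hr
    rw [h1, h2, ← Complex.ofReal_mul]
    congr 1
    have hr0 := hr.1.ne'
    simp only [hU, hW]
    rcases m with _ | m
    · simp
    · push_cast
      field_simp
      ring
  · filter_upwards [hg, hw, Lp.coeFn_sub g w] with r h1 h2 h3
    rw [h3, Pi.sub_apply, h1, h2, ← Complex.ofReal_sub, Pi.add_apply, add_sub_cancel_left]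

/-- In the energy, `r^(2m+2) ≤ R^(2m+2)` leaves an exact derivative. In the norm, the square of the
reflected term is dropped and the cross term has the constant exponential `e^(-ρ)`. The loss is `3m
+ 5 = (m + 1) + 2(m + 2)`: Gaussian tail plus cross term. -/
theorem IsEigenvalueSequence.mul_le_groundEnergy (hR : 0 < R) {B h : ℝ} (hB : 0 < B) (hh : 0 < h)
    {m : ℕ} {lam : ℕ → ℝ} (hlam : IsEigenvalueSequence (pauliOperator B R h m) lam) :
    lam 0 * (1 - (3 * m + 5) / (B / (2 * h) * R ^ 2)) ≤ groundEnergy B R h m := by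
  have hb : 0 < B / (2 * h) := by positivity
  have hlam0 : 0 ≤ lam 0 := by simpa using hlam.landau_le hR hB hh 0
  obtain ⟨u, g, w, h1, hu, hd⟩ := exists_trial B R h m
  have hvar := hlam.mul_norm_sq_le hR hh h1
  have henergy : h ^ 2 * (‖g‖ ^ 2 + ‖w‖ ^ 2) - h * B * ‖u‖ ^ 2 = h ^ 2 * ‖g - w‖ ^ 2 := by
    rw [h1.norm_sub_sq hR hh.ne']
    field_simp
  rw [henergy, norm_sq_of_ae_eq hu, norm_sq_of_ae_eq hd] at hvar
  rw [groundEnergy_eq hh.ne']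
  set b := B / (2 * h)
  set ρ := b * R ^ 2 with hρ
  have hρ0 : 0 < ρ := by positivity
  have hρp : ρ ^ (m + 1) = b ^ (m + 1) * R ^ (2 * m + 2) := by
    rw [hρ, mul_pow, ← pow_mul]
    ring_nf
  have hci : ∀ f : ℝ → ℝ, Continuous f → IntegrableOn f (Ioo 0 R) := fun f hf =>
    (hf.integrableOn_Icc (a := 0) (b := R)).mono_set Ioo_subset_Icc_self
  have hI : ∀ f : ℝ → ℝ, ∫ r in Ioo 0 R, f r = ∫ r in (0 : ℝ)..R, f r := fun f => by
    rw [intervalIntegral.integral_of_le hR.le, integral_Ioc_eq_integral_Ioo]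
  have hD : ∫ r in Ioo 0 R, r * (-(2 * b * r ^ (m + 1) * Real.exp (b * r ^ 2 / 2 - ρ))) ^ 2 ≤
      R ^ (2 * m + 2) * (2 * b * Real.exp (-ρ)) := by
    have hder : ∀ r : ℝ, HasDerivAt (fun r => 2 * b * Real.exp (b * r ^ 2 - 2 * ρ))
        (4 * b ^ 2 * r * Real.exp (b * r ^ 2 - 2 * ρ)) r := by
      intro r
      have := ((((hasDerivAt_pow 2 r).const_mul b).sub_const (2 * ρ)).exp).const_mul (2 * b)
      convert! this using 1
      norm_num
      ring
    have h2 : ∫ r in Ioo 0 R, 4 * b ^ 2 * r * Real.exp (b * r ^ 2 - 2 * ρ) ≤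
        2 * b * Real.exp (-ρ) := by
      rw [hI, intervalIntegral.integral_eq_sub_of_hasDerivAt (fun r _ => hder r)
        (Continuous.intervalIntegrable (by fun_prop) _ _), ← hρ,
        show ρ - 2 * ρ = -ρ by ring]
      have : 0 ≤ 2 * b * Real.exp (b * 0 ^ 2 - 2 * ρ) := by positivity
      linarith
    refine le_trans ?_ (mul_le_mul_of_nonneg_left h2 (by positivity))
    rw [← integral_const_mul]
    refine setIntegral_mono_on (hci _ (by fun_prop)) (hci _ (by fun_prop)) measurableSet_Ioo
      fun r hr => ?_
    have hr0 := hr.1.le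
    have e1 : Real.exp (b * r ^ 2 / 2 - ρ) ^ 2 = Real.exp (b * r ^ 2 - 2 * ρ) := by
      rw [← Real.exp_nat_mul]
      congr 1
      push_cast
      ring
    calc r * (-(2 * b * r ^ (m + 1) * Real.exp (b * r ^ 2 / 2 - ρ))) ^ 2
        = r ^ (2 * m + 2) * (4 * b ^ 2 * r * Real.exp (b * r ^ 2 / 2 - ρ) ^ 2) := by ring
      _ ≤ R ^ (2 * m + 2) * (4 * b ^ 2 * r * Real.exp (b * r ^ 2 / 2 - ρ) ^ 2) :=
        mul_le_mul_of_nonneg_right (pow_le_pow_left₀ hr0 hr.2.le _) (by positivity)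
      _ = _ := by rw [e1]
  have hU : m.factorial / (2 * b ^ (m + 1)) * (1 - (3 * m + 5) / ρ) ≤
      ∫ r in Ioo 0 R, r * (r ^ m * (Real.exp (-(b * r ^ 2 / 2)) - Real.exp (b * r ^ 2 / 2 - ρ))) ^ 2 := by
    have h2 : ∫ r in Ioo 0 R, (r ^ (2 * m + 1) * Real.exp (-(b * r ^ 2)) -
        2 * Real.exp (-ρ) * r ^ (2 * m + 1)) ≤
        ∫ r in Ioo 0 R, r * (r ^ m * (Real.exp (-(b * r ^ 2 / 2)) -
          Real.exp (b * r ^ 2 / 2 - ρ))) ^ 2 := by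
      refine setIntegral_mono_on (hci _ (by fun_prop)) (hci _ (by fun_prop)) measurableSet_Ioo
        fun r hr => ?_
      have hr0 := hr.1.le
      have e1 : Real.exp (-(b * r ^ 2)) = Real.exp (-(b * r ^ 2 / 2)) ^ 2 := by
        rw [← Real.exp_nat_mul]
        congr 1
        push_cast
        ring
      have e2 : Real.exp (-ρ) = Real.exp (-(b * r ^ 2 / 2)) * Real.exp (b * r ^ 2 / 2 - ρ) := by
        rw [← Real.exp_add]
        congr 1
        ring
      rw [e1, e2]
      have h3 : 0 ≤ r ^ (2 * m + 1) * Real.exp (b * r ^ 2 / 2 - ρ) ^ 2 := by positivity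
      have h4 : r * (r ^ m * (Real.exp (-(b * r ^ 2 / 2)) - Real.exp (b * r ^ 2 / 2 - ρ))) ^ 2 =
          r ^ (2 * m + 1) * Real.exp (-(b * r ^ 2 / 2)) ^ 2 -
            2 * (Real.exp (-(b * r ^ 2 / 2)) * Real.exp (b * r ^ 2 / 2 - ρ)) * r ^ (2 * m + 1) +
            r ^ (2 * m + 1) * Real.exp (b * r ^ 2 / 2 - ρ) ^ 2 := by ring
      linarith
    refine le_trans ?_ h2
    rw [integral_sub (hci _ (by fun_prop)) (hci _ (by fun_prop)), integral_const_mul,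
      hI fun r => r ^ (2 * m + 1), integral_pow]
    have h3 := le_setIntegral_pow_mul_exp_neg hb m hR
    rw [← hρ] at h3
    have h4 := pow_mul_exp_neg_le m hρ0
    have h5 : 2 * Real.exp (-ρ) * ((R ^ (2 * m + 1 + 1) - 0 ^ (2 * m + 1 + 1)) /
        (((2 * m + 1 : ℕ) : ℝ) + 1)) ≤
        m.factorial / (2 * b ^ (m + 1)) * (2 * (m + 2) / ρ) := by
      calc _ = m.factorial / (2 * b ^ (m + 1)) * (2 / (m + 1).factorial *
            (ρ ^ (m + 1) * Real.exp (-ρ))) := by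
            rw [hρp, Nat.factorial_succ, zero_pow (by omega)]
            push_cast
            field_simp
            ring
        _ ≤ m.factorial / (2 * b ^ (m + 1)) * (2 / (m + 1).factorial * ((m + 2).factorial / ρ)) :=
            mul_le_mul_of_nonneg_left (mul_le_mul_of_nonneg_left h4 (by positivity))
              (by positivity)
        _ = _ := by
            rw [Nat.factorial_succ (m + 1)]
            push_cast
            field_simp
            ring
    calc m.factorial / (2 * b ^ (m + 1)) * (1 - (3 * m + 5) / ρ)
        = m.factorial / (2 * b ^ (m + 1)) * (1 - (m + 1) / ρ) -
          m.factorial / (2 * b ^ (m + 1)) * (2 * (m + 2) / ρ) := by ring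
      _ ≤ _ := by linarith
  have hA : 0 < (m.factorial : ℝ) / (2 * b ^ (m + 1)) := by positivity
  refine le_of_mul_le_mul_left ?_ hA
  calc m.factorial / (2 * b ^ (m + 1)) * (lam 0 * (1 - (3 * m + 5) / ρ))
      = lam 0 * (m.factorial / (2 * b ^ (m + 1)) * (1 - (3 * m + 5) / ρ)) := by ring
    _ ≤ h ^ 2 * (R ^ (2 * m + 2) * (2 * b * Real.exp (-ρ))) :=
      (mul_le_mul_of_nonneg_left hU hlam0).trans
        (hvar.trans (mul_le_mul_of_nonneg_left hD (sq_nonneg h)))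
    _ = _ := by
      rw [hρp]
      field_simp
      norm_num

/-! ### The asymptotic formula and the final assembly. -/

theorem isBigO_ground_state (hR : 0 < R) {B : ℝ} (hB : 0 < B) (m : ℕ) {lam : ℝ → ℕ → ℝ}
    (hlam : ∀ h, 0 < h → IsEigenvalueSequence (pauliOperator B R h m) (lam h)) :
    (fun h => lam h 0 / groundEnergy B R h m - 1) =O[𝓝[>] 0] (fun h : ℝ => h) := by
  obtain ⟨C, hC, hlow⟩ := exists_groundEnergy_le m
  refine IsBigO.of_bound ((2 * (3 * m + 5) + C) * (2 / (B * R ^ 2))) ?_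
  -- Below this threshold `ρ ≥ 2(3m + 5)`, so `x = (3m + 5)/ρ ≤ 1/2` and `1/(1 - x) ≤ 1 + 2x`; the
  -- condition `2(m + 2) ≤ ρ` of the lower bound holds as well.
  have hpos : 0 < B * R ^ 2 / (4 * (3 * m + 5)) := by positivity
  filter_upwards [Ioo_mem_nhdsGT hpos] with h hh
  have hh0 : 0 < h := hh.1
  have hT := groundEnergy_pos hR hB hh0 m
  have hρ : B / (2 * h) * R ^ 2 = B * R ^ 2 / (2 * h) := by ring
  have hlarge : 2 * (3 * m + 5) ≤ B / (2 * h) * R ^ 2 := by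
    have h1 := hh.2
    rw [lt_div_iff₀ (by positivity)] at h1
    rw [hρ, le_div_iff₀ (by positivity)]
    linarith
  have hm : (0 : ℝ) ≤ m := m.cast_nonneg
  have h1 := hlow hR hB hh0 (by linarith) (hlam h hh0)
  have h2 := (hlam h hh0).mul_le_groundEnergy hR hB hh0
  have hρ0 : 0 < B / (2 * h) * R ^ 2 := by positivity
  have hbound : (2 * (3 * m + 5) + C) * (2 / (B * R ^ 2)) * h =
      2 * ((3 * m + 5) / (B / (2 * h) * R ^ 2)) + C / (B / (2 * h) * R ^ 2) := by
    field_simp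
  rw [Real.norm_of_nonneg hh0.le, hbound]
  set ρ := B / (2 * h) * R ^ 2
  set T := groundEnergy B R h m
  have hx : (3 * m + 5) / ρ ≤ 1 / 2 := by
    rw [div_le_div_iff₀ hρ0 two_pos]
    linarith
  have hx0 : 0 ≤ (3 * m + 5) / ρ := by positivity
  have hy0 : 0 ≤ C / ρ := by positivity
  set x := (3 * m + 5) / ρ
  set y := C / ρ
  set q := lam h 0 / T with hq
  have hl : lam h 0 = q * T := by
    rw [hq]
    field_simp
  rw [hl] at h1 h2
  have h3 : q * (1 - x) ≤ 1 := le_of_mul_le_mul_right (by linarith) hT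
  have h4 : 1 ≤ q * (1 + y) := le_of_mul_le_mul_right (by linarith) hT
  rw [Real.norm_eq_abs, abs_le]
  constructor
  -- `(1 - y)(1 + y) ≤ 1` replaces the expansion of `1/(1 + y)`.
  · have h5 : (1 - y) * (1 + y) ≤ q * (1 + y) := by nlinarith
    have h6 : 1 - y ≤ q := le_of_mul_le_mul_right h5 (by linarith)
    linarith
  · have h5 : q * (1 - x) ≤ (1 + 2 * x) * (1 - x) := by nlinarith
    have h6 : q ≤ 1 + 2 * x := le_of_mul_le_mul_right h5 (by linarith)
    linarith

end RadialPauli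

theorem theorem5p1 (B R : ℝ) (hB : 0 < B) (hR : 0 < R) :
    (∀ (m : ℤ) (h : ℝ), 0 < h →
      ∃ lam : ℕ → ℝ, RadialPauli.IsEigenvalueSequence (RadialPauli.pauliOperator B R h m) lam) ∧
    ∀ lam : ℤ → ℝ → ℕ → ℝ,
      (∀ (m : ℤ) (h : ℝ), 0 < h →
        RadialPauli.IsEigenvalueSequence (RadialPauli.pauliOperator B R h m) (lam m h)) →
      (∀ (m : ℤ) (h : ℝ), 0 < h → m < 0 → (2 * |(m : ℝ)| - 1) * h * B ≤ lam m h 0) ∧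
      (∀ (m : ℤ) (h : ℝ), 0 < h → 0 ≤ m → ∀ k : ℕ, 2 * h * B * (k : ℝ) ≤ lam m h k) ∧
      (∀ (m : ℤ) (h : ℝ), 0 < h → 0 ≤ m → 2 * h * B ≤ lam m h 1) ∧
      (∀ m : ℕ, ∃ ε : ℝ → ℝ, ε =O[𝓝[>] 0] (fun h : ℝ => h) ∧
        ∀ h : ℝ, 0 < h →
          lam (m : ℤ) h 0 =
            2 * h * B * ((B * R ^ 2 / (2 * h)) ^ (m + 1) / (m.factorial : ℝ)) *
              Real.exp (-(B * R ^ 2) / (2 * h)) * (1 + ε h)) := by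
  refine ⟨fun m h hh => RadialPauli.exists_isEigenvalueSequence hR B hh m, fun lam hlam => ?_⟩
  have hlevel : ∀ (m : ℤ) (h : ℝ), 0 < h → 0 ≤ m → ∀ k : ℕ, 2 * h * B * (k : ℝ) ≤ lam m h k := by
    intro m h hh hm k
    lift m to ℕ using hm
    exact (hlam m h hh).landau_le hR hB hh k
  refine ⟨fun m h hh hm => (hlam m h hh).le_of_neg hB hh hm, hlevel,
    fun m h hh hm => by simpa using hlevel m h hh hm 1, fun m => ?_⟩
  -- With `ε` the relative error the equation is exact for every `h > 0`; only its size is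
  -- asymptotic.
  refine ⟨fun h => lam m h 0 / RadialPauli.groundEnergy B R h m - 1,
    RadialPauli.isBigO_ground_state hR hB m fun h hh => hlam m h hh, fun h hh => ?_⟩
  have hT := (RadialPauli.groundEnergy_pos hR hB hh m).ne'
  change _ = RadialPauli.groundEnergy B R h m * _
  field_simp
  ring
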